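/- Let $n\ge 1$. For $X\subset\mathbb R^n$, a smooth compactly supported $f:\mathbb R^n\to\mathbb R$ and $N\ge1$ put $S_N(X,f)=N^{-n}\sum_{k\in\mathbb Z^n\cap NX}f(k/N)$. We write $S_N\sim\sum_{q\ge0}N^{-q}T_q$ if $S_N-\sum_{q<M}N^{-q}T_q=O(N^{-M})$ as $N\to\infty$ for every $M\in\mathbb N$. If $F$ is a convex set, $\int_F$ is the integral with respect to the Euclidean measure of the dimension of $F$ (evaluation if $F$ is a point), and $L(F)$ is the linear subspace spanned by the differences of points of $F$. (i) Let $W=\{x:\langle u_i,x\rangle\le c_i,\ 1\le i\le n\}$ be a regular integer $n$-wedge in $\mathbb R^n$: the $c_i$ are integers, the $u_i$ are primitive integer covectors, and $(u_1,\dots,u_n)$ is a basis of the lattice of the integer covectors in its real span. Let $(v_i)$ be the dual basis of $(u_i)$, let $\mathcal H_i=\{x\in W:\langle u_i,x\rangle=c_i\}$, and for $\alpha\in\mathbb N^n$ let $F_\alpha=\bigcap_{\alpha_i>0}\mathcal H_i$ (so $F_0=W$). Let $K_\alpha(W)$ be the Jacobian of the restriction to $F_\alpha$ of the map $x\mapsto(\langle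 u_i,x\rangle-c_i)_i$, let $r(\alpha)_i=1$ if $\alpha_i>0$ and $0$ otherwise, let $\nu(\alpha)$ be the number of $i$ with $\alpha_i>0$, and let $C(W,\alpha)=\frac1{\alpha!}\prod_i b_{\alpha_i}\,K_\alpha(W)$, where $\frac{s}{1-e^{-s}}=\sum_m b_m\frac{s^m}{m!}$ (so $b_0=1$, $b_1=\frac12$, and $b_m$ is the $m$-th Bernoulli number for $m\ge2$). For $\beta\in\mathbb N^n$ let $v_\beta$ be the tuple that lists each $v_i$ exactly $\beta_i$ times. Then for every smooth compactly supported $f$ $$S_N(W,f)\sim\sum_{q\ge0}N^{-q}\sum_{|\alpha|=q}C(W,\alpha)\int_{F_\alpha}D^{q-\nu(\alpha)}f\cdot v_{\alpha-r(\alpha)}.$$ (ii) Let $n\in\{1,2,3\}$. A Delzant lattice polytope is an $n$-dimensional polytope $\Delta\subset\mathbb R^n$ with vertices in $\mathbb Z^n$ such that exactly $n$ edges meet at each vertex $p$ and these lie on the rays $p+ta_i$, $t\ge0$, for some basis $(a_i)$ of $\mathbb Z^n$. For a face $F$ of $\Delta$ let $\int_F^{\star}$ be $\int_F$ divided by the volume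 of the parallelotope generated by a basis of the lattice $L(F)\cap\mathbb Z^n$, and let $C(\Delta,F)$ be the cone generated by the vectors $x-y$, $x\in F$, $y\in\Delta$. For every Delzant lattice polytope $\Delta$, every $q\ge1$ and every face $F$ of $\Delta$ with $1\le\operatorname{codim}F\le q$ there is a constant-coefficient linear differential operator $R_q(F,\cdot)$, homogeneous of degree $q-\operatorname{codim}F$ (possibly zero), that involves only derivatives in directions normal to $F$ and depends only on $q$ and on $F$ as a face (that is, only on $q$ and on the cone $C(\Delta,F)$; in particular neither on $f$ nor on the rest of $\Delta$), such that for every Delzant lattice polytope $\Delta$ and every smooth compactly supported $f$ $$S_N(\Delta,f)\sim\int_\Delta f+\sum_{q\ge1}N^{-q}\sum_{F:\,1\le\operatorname{codim}F\le q}\int_F^{\star}R_q(F,f).$$ -/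

import Mathlib

open MeasureTheory Module Submodule Set Filter
open scoped Pointwise ContDiff Nat

noncomputable section

namespace EulerMaclaurin

/-- Euclidean space `ℝⁿ`. -/
abbrev E (n : ℕ) : Type := EuclideanSpace ℝ (Fin n)

/-- The integer lattice `ℤⁿ` in `ℝⁿ`. -/
def intLattice (n : ℕ) : Submodule ℤ (E n) :=
  span ℤ (range (EuclideanSpace.basisFun (Fin n) ℝ))

/-- The pairing of an integer covector with a point of `ℝⁿ`. -/
def pairing {n : ℕ} (u : Fin n → ℤ) (x : E n) : ℝ := ∑ j, (u j : ℝ) * x j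

/-- The Riemann sum `N⁻ⁿ ∑_{k ∈ ℤⁿ ∩ N X} f (k / N)`
(a finite sum if `f` has compact support and `N ≥ 1`). -/
def riemannSum {n : ℕ} (X : Set (E n)) (f : E n → ℝ) (N : ℕ) : ℝ :=
  ((N : ℝ) ^ n)⁻¹ *
    ∑ᶠ k ∈ (intLattice n : Set (E n)) ∩ (N : ℝ) • X, f ((N : ℝ)⁻¹ • k)

/-- `S N ∼ ∑_{q ≥ 0} N^{-q} T q` modulo `O(N^{-∞})`. -/
def AsymptoticExpansion (S T : ℕ → ℝ) : Prop :=
  ∀ M : ℕ, (fun N : ℕ => S N - ∑ q ∈ Finset.range M, ((N : ℝ) ^ q)⁻¹ * T q)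
    =O[atTop] fun N : ℕ => ((N : ℝ) ^ M)⁻¹

/-- Integral over a convex set `F` (such as a face of a wedge or of a polytope) with respect to
the Euclidean measure of its own dimension; for a single point this is evaluation. -/
def faceIntegral {n : ℕ} (F : Set (E n)) (g : E n → ℝ) : ℝ :=
  ∫ x in F, g x ∂(Measure.euclideanHausdorffMeasure (finrank ℝ (vectorSpan ℝ F)))

/-- The Jacobian (volume distortion `√det (AᵀA)`) of the restriction to the subspace `L` of a
linear map between Euclidean spaces. -/
def jacobianOn {n m : ℕ} (L : Submodule ℝ (E n)) (A : E n →ₗ[ℝ] E m) : ℝ :=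
  √(LinearMap.det ((A.domRestrict L).adjoint ∘ₗ A.domRestrict L))

/-- An integer `m`-wedge in `ℝⁿ`, given by the inequalities `⟨u i, x⟩ ≤ c i` with `c i` integers
and `u i` primitive integer covectors. -/
structure IntegerWedge (n m : ℕ) where
  u : Fin m → Fin n → ℤ
  c : Fin m → ℤ
  primitive : ∀ i, Finset.univ.gcd (u i) = 1

namespace IntegerWedge

variable {n m : ℕ}

/-- The subset of `ℝⁿ` defined by the inequalities. -/
def carrier (W : IntegerWedge n m) : Set (E n) := {x | ∀ i, pairing (W.u i) x ≤ W.c i}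

/-- The facet `H i`. -/
def facet (W : IntegerWedge n m) (i : Fin m) : Set (E n) :=
  {x ∈ W.carrier | pairing (W.u i) x = W.c i}

/-- `W` is regular: the `u i` form a basis of the lattice of the integer covectors that lie in the
real span `U` of the `u i`. -/
def IsRegular (W : IntegerWedge n m) : Prop :=
  LinearIndependent ℤ W.u ∧
    ∀ w : Fin n → ℤ,
      (fun j => (w j : ℝ)) ∈ span ℝ (range fun (i : Fin m) (j : Fin n) => (W.u i j : ℝ)) →
        w ∈ span ℤ (range W.u)

/-- The linear part of the affine map `φ`, `φ(x)_i = ⟨u i, x⟩ - c i`. -/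
def phiLinear (W : IntegerWedge n m) : E n →ₗ[ℝ] E m :=
  Matrix.toEuclideanLin (Matrix.of fun i j => (W.u i j : ℝ))

/-- The dual basis `v` of `u`: the columns of the inverse of the matrix with rows `u i`. -/
def dualVec (W : IntegerWedge n n) (i : Fin n) : E n :=
  WithLp.toLp 2 fun j => (Matrix.of fun i j => (W.u i j : ℝ))⁻¹ j i

/-- The face `⋂_{α i > 0} H i`, which is `W` itself for `α = 0`. -/
def face (W : IntegerWedge n n) (α : Fin n → ℕ) : Set (E n) :=
  W.carrier ∩ ⋂ i, ⋂ (_ : 0 < α i), W.facet i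

/-- `K_α(W)`, the Jacobian of the restriction of `φ` to the face `⋂_{α i > 0} H i`. -/
def K (W : IntegerWedge n n) (α : Fin n → ℕ) : ℝ :=
  jacobianOn (vectorSpan ℝ (W.face α)) W.phiLinear

/-- `C(W, α) = (1/α!) ∏ b_{α i} K_α(W)`, where `b_0 = 1`, `b_1 = 1/2`, `b_2 = 1/6`, … are the
coefficients in `s / (1 - exp (-s)) = ∑ b_n sⁿ / n!`. -/
def C (W : IntegerWedge n n) (α : Fin n → ℕ) : ℝ :=
  (1 / ((∏ i, (α i)! : ℕ) : ℝ) * ∏ i, ((bernoulli' (α i) : ℚ) : ℝ)) * W.K α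

end IntegerWedge

/-- `r(α)_i = 1` if `α i > 0`, and `0` otherwise. -/
def r {n : ℕ} (α : Fin n → ℕ) : Fin n → ℕ := fun i => if 0 < α i then 1 else 0

/-- The tuple of length `|β|` that lists each `v i` exactly `β i` times. -/
def repeatTuple {n : ℕ} (v : Fin n → E n) (β : Fin n → ℕ) : Fin (∑ i, β i) → E n :=
  fun s => v (finSigmaFinEquiv.symm s).1

/-- The directional derivative `D^{|β|} f (x) · v_β`. -/
def derivAlong {n : ℕ} (v : Fin n → E n) (β : Fin n → ℕ) (f : E n → ℝ) (x : E n) : ℝ :=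
  iteratedFDeriv ℝ (∑ i, β i) f x (repeatTuple v β)

/-- `F` is a (nonempty) face of `Δ`: the set of the maximizers on `Δ` of some linear form. -/
def IsFace {n : ℕ} (Δ F : Set (E n)) : Prop := F.Nonempty ∧ IsExposed ℝ Δ F

/-- The codimension of a face in `ℝⁿ`. -/
def codim {n : ℕ} (F : Set (E n)) : ℕ := n - finrank ℝ (vectorSpan ℝ F)

/-- `G` is an edge of `Δ` that contains `p`. -/
def IsEdgeAt {n : ℕ} (Δ : Set (E n)) (p : E n) (G : Set (E n)) : Prop :=
  IsFace Δ G ∧ finrank ℝ (vectorSpan ℝ G) = 1 ∧ p ∈ G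

/-- `Δ` is an `n`-dimensional Delzant polytope in `ℝⁿ` with vertices in `ℤⁿ`. -/
structure IsDelzantLatticePolytope {n : ℕ} (Δ : Set (E n)) : Prop where
  /-- `Δ` is a polytope: a bounded intersection of finitely many closed half-spaces. -/
  polyhedral : ∃ (d : ℕ) (u : Fin d → E n) (c : Fin d → ℝ), Δ = {x | ∀ i, inner ℝ (u i) x ≤ c i}
  bounded : Bornology.IsBounded Δ
  /-- `Δ` is `n`-dimensional. -/
  fullDim : (interior Δ).Nonempty
  /-- The vertices of `Δ` are integer points. -/
  vertices : Δ.extremePoints ℝ ⊆ (intLattice n : Set (E n))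
  /-- `Δ` is simple and regular: exactly `n` edges meet at each vertex `p`, and they lie on the
  rays `p + t a i`, `t ≥ 0`, for a basis `a` of the lattice `ℤⁿ`. -/
  delzant : ∀ p ∈ Δ.extremePoints ℝ,
    ∃ (a : Fin n → E n) (e : Fin n ≃ {G : Set (E n) // IsEdgeAt Δ p G}),
      LinearIndependent ℤ a ∧ span ℤ (range a) = intLattice n ∧
        ∀ i, (e i : Set (E n)) ⊆ {x | ∃ t : ℝ, 0 ≤ t ∧ x = p + t • a i}

/-- The cone generated by the differences `x - y`, `x ∈ F`, `y ∈ Δ`. It records how `Δ` looks near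
the face `F`. -/
def faceCone {n : ℕ} (Δ F : Set (E n)) : Set (E n) :=
  {z | ∃ t : ℝ, 0 ≤ t ∧ ∃ x ∈ F, ∃ y ∈ Δ, z = t • (x - y)}

/-- The lattice of the integer vectors parallel to `F`. -/
def faceLattice {n : ℕ} (F : Set (E n)) : Submodule ℤ (vectorSpan ℝ F) :=
  (intLattice n).comap ((vectorSpan ℝ F).subtype.restrictScalars ℤ)

/-- The normalized integral over `F`: the Euclidean measure of `F` is divided by the volume of the
parallelotope generated by a basis of the lattice of the integer vectors parallel to `F`. -/
def starIntegral {n : ℕ} (F : Set (E n)) (g : E n → ℝ) : ℝ :=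
  (ZLattice.covolume (faceLattice F))⁻¹ * faceIntegral F g

/-- `P` is a homogeneous linear differential operator of degree `k` with constant coefficients
(possibly zero) that involves only derivatives in directions of the subspace `V`. -/
def IsDiffOpAlong {n : ℕ} (V : Submodule ℝ (E n)) (k : ℕ) (P : (E n → ℝ) → E n → ℝ) : Prop :=
  ∃ (l : ℕ) (a : Fin l → ℝ) (w : Fin l → Fin k → E n),
    (∀ i j, w i j ∈ V) ∧
      ∀ f : E n → ℝ, ContDiff ℝ ∞ f → ∀ x, P f x = ∑ i, a i * iteratedFDeriv ℝ k f x (w i)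

end EulerMaclaurin

end

open EulerMaclaurin

/-! In the coordinates `t i = c i - ⟨u i, x⟩` a regular wedge is the orthant, with lattice points
corresponding to integer points, so `S_N` is the integral of `f` against a product of
one-dimensional measures `N⁻¹ ∑ δ_{m/N}`. The classical Euler–Maclaurin formula expands one such
factor: Lebesgue measure at order zero, and at order `k ≥ 1` the coefficient `b_k / k!` times
evaluation at `0` of the derivative of order `k - 1` along `v i`. Replacing the factors one
coordinate at a time gives the expansion over multi-indices (`asymptoticExpansion_pi`); errors stay
uniform because the remaining factors have bounded mass. The Jacobian `K_α` is the inverse covolume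
of the integer vectors parallel to the face, which is exactly the ratio between coordinate measure
and Euclidean measure.

For a Delzant polytope a partition of unity reduces everything to the wedges at the vertices. The
difficulty is that the term at the face where the coordinates in `J` vanish contains derivatives
along `v i`, `i ∈ J`, which need not be normal to the face and depend on the vertex. Let `w` be the
vector normal to the face that is dual to `u i` among the `u k`, `k ∈ J`. Then `v i = w - ∑_{j ∉ J}
⟨u j, w⟩ v j`, and each `v j` with `j ∉ J` is tangent to the face: integrating that derivative by
parts moves the term to the face of `insert j J` with one derivative fewer. Iterating, what is left
at the face of `K` is an operator built from the normals `u k`, `k ∈ K`, alone (`localOp`,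
`orthantIntegral_multiDeriv`).

These normals can be read off from the cone of the face: they are the irreducible elements of the
monoid of integer covectors nonnegative on it (`coneNormals_innerCone`). Hence the operators found
at different vertices of a face coincide, and the pieces of the partition of unity add up to
integrals over whole faces. -/

noncomputable section

namespace EulerMaclaurin

section

/-! ### The Euler–Maclaurin formula in one variable -/

/-- The coefficients of `s / (1 - exp (-s))`. -/
def toddCoeff (k : ℕ) : ℝ := ((bernoulli' k : ℚ) : ℝ) / (k ! : ℝ)

lemma toddCoeff_zero : toddCoeff 0 = 1 := by simp [toddCoeff]

lemma toddCoeff_one : toddCoeff 1 = 1 / 2 := by simp [toddCoeff]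

/-- The part of order `k` of the remainder in the Euler–Maclaurin formula on `[0, L]`. -/
def bernoulliPart (G : ℕ → ℝ → ℝ) (L k : ℕ) : ℝ :=
  ∑ m ∈ Finset.range L, ∫ t in (0 : ℝ)..1, bernoulliFun k t / (k ! : ℝ) * G k (m + t)

/-- Integration by parts, since `B_{k+1} / (k+1)!` is a primitive of `B_k / k!`. The convention `G
k' = -G (k + 1)` anticipates that the coordinates of a wedge run against the vectors `v i`, so that
`G k` will be the `k`-th derivative along `v i`. -/
lemma integral_bernoulliFun_mul {G : ℕ → ℝ → ℝ}
    (hG : ∀ k t, HasDerivAt (G k) (-G (k + 1) t) t) (k : ℕ) (a : ℝ) :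
    ∫ t in (0 : ℝ)..1, bernoulliFun k t / (k ! : ℝ) * G k (a + t) =
      bernoulliFun (k + 1) 1 / ((k + 1)! : ℝ) * G k (a + 1) -
        bernoulliFun (k + 1) 0 / ((k + 1)! : ℝ) * G k a +
        ∫ t in (0 : ℝ)..1, bernoulliFun (k + 1) t / ((k + 1)! : ℝ) * G (k + 1) (a + t) := by
  have hcont : ∀ k, Continuous (G k) := fun k =>
    continuous_iff_continuousAt.2 fun t => (hG k t).continuousAt
  have hu : ∀ t, HasDerivAt (fun t => bernoulliFun (k + 1) t / ((k + 1)! : ℝ))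
      (bernoulliFun k t / (k ! : ℝ)) t := by
    intro t
    refine ((hasDerivAt_bernoulliFun (k + 1) t).div_const ((k + 1)! : ℝ)).congr_deriv ?_
    have : ((k : ℝ) + 1) ≠ 0 := by positivity
    have : (k ! : ℝ) ≠ 0 := by positivity
    rw [Nat.factorial_succ]
    push_cast
    field_simp
  have hw : ∀ t, HasDerivAt (fun t => G k (a + t)) (-G (k + 1) (a + t)) t := by
    intro t
    have := (hG k (a + t)).comp_const_add a t
    simpa using this
  have hc1 := (continuous_bernoulliFun k).div_const (k ! : ℝ)
  have hc2 : Continuous fun t => G (k + 1) (a + t) := (hcont _).comp (by fun_prop)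
  have hc3 := (continuous_bernoulliFun (k + 1)).div_const ((k + 1)! : ℝ)
  have hc4 : Continuous fun t => G k (a + t) := (hcont _).comp (by fun_prop)
  have key := intervalIntegral.integral_deriv_mul_eq_sub (a := 0) (b := 1)
    (fun t _ => hu t) (fun t _ => hw t) (hc1.intervalIntegrable _ _)
    (hc2.neg.intervalIntegrable _ _)
  have h1 : ∫ t in (0 : ℝ)..1, (bernoulliFun k t / (k ! : ℝ) * G k (a + t) +
      bernoulliFun (k + 1) t / ((k + 1)! : ℝ) * -G (k + 1) (a + t)) =
      (∫ t in (0 : ℝ)..1, bernoulliFun k t / (k ! : ℝ) * G k (a + t)) -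
      ∫ t in (0 : ℝ)..1, bernoulliFun (k + 1) t / ((k + 1)! : ℝ) * G (k + 1) (a + t) := by
    refine Eq.trans ?_ (intervalIntegral.integral_sub ((hc1.mul hc4).intervalIntegrable _ _)
      ((hc3.mul hc2).intervalIntegrable _ _))
    congr 1; ext t; simp; ring
  rw [h1] at key
  simp only [add_zero] at key
  linarith

lemma sum_eq_bernoulliPart {G : ℕ → ℝ → ℝ} {L : ℕ}
    (hG : ∀ k t, HasDerivAt (G k) (-G (k + 1) t) t) (hL : ∀ k, G k L = 0) (M : ℕ) :
    ∑ m ∈ Finset.range L, G 0 m = bernoulliPart G L 0 +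
      ∑ k ∈ Finset.range (M + 1), toddCoeff (k + 1) * G k 0 - bernoulliPart G L (M + 1) := by
  induction M with
  | zero =>
    have h : bernoulliPart G L 0 = ∑ m ∈ Finset.range L, (G 0 m + (G 0 (m + 1 : ℕ) - G 0 m) / 2) +
        bernoulliPart G L 1 := by
      -- Since `B_1` takes the values `∓1/2` at `0` and `1`, the first integration by parts produces
      -- the trapezoidal rule, here written as the left endpoint value plus half of a telescoping
      -- difference.
      rw [bernoulliPart, bernoulliPart, ← Finset.sum_add_distrib]
      refine Finset.sum_congr rfl fun m _ => ?_
      rw [integral_bernoulliFun_mul hG]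
      simp only [bernoulliFun_one, zero_add, Nat.factorial_one, Nat.cast_one, Nat.cast_add]
      ring
    have h2 : ∑ m ∈ Finset.range L, (G 0 (m + 1 : ℕ) - G 0 m) = - G 0 0 := by
      rw [Finset.sum_range_sub fun m : ℕ => G 0 m]
      simp [hL]
    rw [h, Finset.sum_add_distrib, ← Finset.sum_div, h2]
    simp [toddCoeff_one]
    ring
  | succ M ih =>
    have h : bernoulliPart G L (M + 1) = -(toddCoeff (M + 1 + 1) * G (M + 1) 0) +
        bernoulliPart G L (M + 1 + 1) := by
      have h2 : ∑ m ∈ Finset.range L, (G (M + 1) (m + 1 : ℕ) - G (M + 1) m) = - G (M + 1) 0 := by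
        rw [Finset.sum_range_sub fun m : ℕ => G (M + 1) m]
        simp [hL]
      -- From index two on, the Bernoulli polynomials agree at `0` and `1`, so the boundary terms
      -- telescope with a common coefficient.
      have h3 : bernoulliFun (M + 1 + 1) 1 / ((M + 1 + 1)! : ℝ) = toddCoeff (M + 1 + 1) ∧
          bernoulliFun (M + 1 + 1) 0 / ((M + 1 + 1)! : ℝ) = toddCoeff (M + 1 + 1) := by
        rw [bernoulliFun_endpoints_eq_of_ne_one (by omega), bernoulliFun_eval_zero,
          bernoulli_eq_bernoulli'_of_ne_one (by omega), toddCoeff]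
        simp
      rw [← mul_neg, ← h2, Finset.mul_sum, bernoulliPart, bernoulliPart, ← Finset.sum_add_distrib]
      refine Finset.sum_congr rfl fun m _ => ?_
      rw [integral_bernoulliFun_mul hG, h3.1, h3.2]
      push_cast
      ring
    rw [ih, Finset.sum_range_succ _ (M + 1), h]
    ring

lemma exists_bernoulliPart_le (k : ℕ) : ∃ C : ℝ, 0 ≤ C ∧ ∀ (G : ℕ → ℝ → ℝ) (L : ℕ) (B : ℝ),
    (∀ t ∈ Icc (0 : ℝ) L, |G k t| ≤ B) → |bernoulliPart G L k| ≤ L * (C * B) := by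
  obtain ⟨C, hC⟩ := (isCompact_Icc (a := (0 : ℝ)) (b := 1)).exists_bound_of_continuousOn
    ((continuous_bernoulliFun k).div_const (k ! : ℝ)).continuousOn
  have hC0 : 0 ≤ C := (norm_nonneg _).trans (hC 0 (by simp))
  refine ⟨C, hC0, fun G L B hB => ?_⟩
  rw [bernoulliPart]
  refine (Finset.abs_sum_le_sum_abs _ _).trans ?_
  have : ∀ m ∈ Finset.range L,
      |∫ t in (0 : ℝ)..1, bernoulliFun k t / (k ! : ℝ) * G k (m + t)| ≤ C * B := by
    intro m hm
    have hmL : (m : ℝ) + 1 ≤ L := by exact_mod_cast Finset.mem_range.1 hm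
    have := intervalIntegral.norm_integral_le_of_norm_le_const (a := 0) (b := 1) (C := C * B)
      (f := fun t => bernoulliFun k t / (k ! : ℝ) * G k (m + t)) (by
        intro t ht
        rw [uIoc_of_le zero_le_one] at ht
        rw [norm_mul]
        gcongr
        · exact hC t ⟨ht.1.le, ht.2⟩
        · exact hB _ ⟨by have := ht.1; positivity, by linarith [ht.2]⟩)
    simpa using this
  refine (Finset.sum_le_sum this).trans ?_
  simp

/-- The measure `N⁻¹ ∑ δ_{m / N}`, where `m / N` runs over the points of `N⁻¹ ℕ` in `[0, R)`. -/
def sampleMeasure (N R : ℕ) : Measure ℝ :=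
  ∑ m ∈ Finset.range (N * R), (N : NNReal)⁻¹ • Measure.dirac ((m : ℝ) / N)

instance (N R : ℕ) : IsFiniteMeasure (sampleMeasure N R) := by
  unfold sampleMeasure; infer_instance

lemma integral_sampleMeasure (N R : ℕ) (h : ℝ → ℝ) :
    ∫ t, h t ∂(sampleMeasure N R) = (N : ℝ)⁻¹ * ∑ m ∈ Finset.range (N * R), h ((m : ℝ) / N) := by
  rw [sampleMeasure, integral_finsetSum_measure, Finset.mul_sum]
  · refine Finset.sum_congr rfl fun m _ => ?_
    rw [integral_smul_nnreal_measure, integral_dirac]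
    simp [NNReal.smul_def]
  · intro m _
    exact (integrable_dirac (by simp)).smul_measure_nnreal

lemma sampleMeasure_real_univ_le (N R : ℕ) : (sampleMeasure N R).real univ ≤ R := by
  have := integral_sampleMeasure N R 1
  simp only [Pi.one_apply, integral_const, smul_eq_mul, mul_one, Finset.sum_const,
    Finset.card_range, nsmul_eq_mul, Nat.cast_mul] at this
  rw [this]
  rcases N.eq_zero_or_pos with rfl | h
  · simp
  · have : (N : ℝ) ≠ 0 := by positivity
    rw [inv_mul_cancel_left₀ this]

/-- Lebesgue measure on `[0, R]` for `k = 0`, the Dirac measure at `0` for `k > 0`. -/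
def boundaryMeasure (R k : ℕ) : Measure ℝ :=
  if k = 0 then volume.restrict (Icc 0 (R : ℝ)) else Measure.dirac 0

instance (R k : ℕ) : IsFiniteMeasure (boundaryMeasure R k) := by
  unfold boundaryMeasure; split_ifs
  · exact ⟨by simp⟩
  · infer_instance

/-- The Euler–Maclaurin formula with an explicit remainder estimate. -/
lemma exists_integral_sampleMeasure_sub_le (M : ℕ) : ∃ C : ℝ, 0 ≤ C ∧
    ∀ (G : ℕ → ℝ → ℝ) (R N : ℕ) (B : ℝ), 0 < N → (∀ k t, HasDerivAt (G k) (-G (k + 1) t) t) →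
      (∀ k, G k R = 0) → (∀ t ∈ Icc (0 : ℝ) R, |G (M + 1) t| ≤ B) →
      |∫ t, G 0 t ∂(sampleMeasure N R) - ∑ k ∈ Finset.range (M + 2),
        ((N : ℝ) ^ k)⁻¹ * (toddCoeff k * ∫ t, G (k - 1) t ∂(boundaryMeasure R k))| ≤
        C * R * B * ((N : ℝ) ^ (M + 1))⁻¹ := by
  obtain ⟨C, hC0, hC⟩ := exists_bernoulliPart_le (M + 1)
  refine ⟨C, hC0, fun G R N B hN hG hR hB => ?_⟩
  have hN0 : (0 : ℝ) < N := by exact_mod_cast hN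
  have hcont : ∀ k, Continuous (G k) := fun k =>
    continuous_iff_continuousAt.2 fun t => (hG k t).continuousAt
  -- Rescaling turns mesh `1 / N` into mesh `1`; each derivative contributes a factor `1 / N`.
  set g : ℕ → ℝ → ℝ := fun k t => ((N : ℝ) ^ k)⁻¹ * G k (t / N) with hgdef
  have hg : ∀ k t, HasDerivAt (g k) (-g (k + 1) t) t := by
    intro k t
    have h1 : HasDerivAt (fun t : ℝ => t / N) (1 / N) t := (hasDerivAt_id t).div_const _
    refine (((hG k (t / N)).comp t h1).const_mul ((N : ℝ) ^ k)⁻¹).congr_deriv ?_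
    simp only [hgdef, pow_succ, mul_inv]
    ring
  have hgL : ∀ k, g k ((N * R : ℕ) : ℝ) = 0 := by
    intro k
    simp only [hgdef, Nat.cast_mul]
    rw [mul_div_cancel_left₀ _ hN0.ne', hR, mul_zero]
  have key := sum_eq_bernoulliPart hg hgL M
  have hb := hC g (N * R) (((N : ℝ) ^ (M + 1))⁻¹ * B) (by
    intro t ht
    simp only [hgdef, abs_mul, abs_inv, abs_pow, Nat.abs_cast]
    gcongr
    refine hB _ ⟨by have := ht.1; positivity, ?_⟩
    have := ht.2
    rw [Nat.cast_mul] at this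
    rw [div_le_iff₀ hN0]
    linarith)
  have h0 : bernoulliPart g (N * R) 0 = N * ∫ t in Icc (0 : ℝ) R, G 0 t := by
    have h1 : bernoulliPart g (N * R) 0 =
        ∑ m ∈ Finset.range (N * R), ∫ t in (m : ℝ)..((m + 1 : ℕ) : ℝ), G 0 (t / N) := by
      refine Finset.sum_congr rfl fun m _ => ?_
      have := intervalIntegral.integral_comp_add_left (a := 0) (b := 1)
        (fun t : ℝ => G 0 (t / N)) (m : ℝ)
      simp only [add_zero] at this
      push_cast
      rw [← this]
      simp [hgdef]
    have h2 := intervalIntegral.sum_integral_adjacent_intervals (μ := volume)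
      (f := fun t : ℝ => G 0 (t / N)) (a := fun m : ℕ => (m : ℝ)) (n := N * R)
      (fun k _ => ((hcont 0).comp (by fun_prop : Continuous fun t : ℝ => t / N)).intervalIntegrable
        _ _)
    rw [h1, h2, intervalIntegral.integral_comp_div _ hN0.ne', integral_Icc_eq_integral_Ioc,
      ← intervalIntegral.integral_of_le (Nat.cast_nonneg R)]
    simp [hN0.ne']
  have hsum : ∫ t, G 0 t ∂(sampleMeasure N R) = (N : ℝ)⁻¹ * ∑ m ∈ Finset.range (N * R), g 0 m := by
    rw [integral_sampleMeasure]
    simp [hgdef]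
  have hmain : ∫ t, G 0 t ∂(sampleMeasure N R) - ∑ k ∈ Finset.range (M + 2),
        ((N : ℝ) ^ k)⁻¹ * (toddCoeff k * ∫ t, G (k - 1) t ∂(boundaryMeasure R k)) =
      -((N : ℝ)⁻¹ * bernoulliPart g (N * R) (M + 1)) := by
    -- The term `k = 0` is split off: there `k - 1` is the truncated value `0`, and the term is the
    -- plain integral of `G 0`.
    rw [hsum, key, h0, Finset.sum_range_succ' _ (M + 1)]
    have h3 : ∑ k ∈ Finset.range (M + 1), ((N : ℝ) ^ (k + 1))⁻¹ *
          (toddCoeff (k + 1) * ∫ t, G (k + 1 - 1) t ∂(boundaryMeasure R (k + 1))) =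
        (N : ℝ)⁻¹ * ∑ k ∈ Finset.range (M + 1), toddCoeff (k + 1) * g k 0 := by
      rw [Finset.mul_sum]
      refine Finset.sum_congr rfl fun k _ => ?_
      simp only [boundaryMeasure, hgdef, pow_succ, mul_inv]
      simp
      ring
    rw [h3]
    simp only [boundaryMeasure, if_true, toddCoeff_zero, pow_zero]
    field_simp
    ring
  rw [hmain, abs_neg, abs_mul, abs_inv, Nat.abs_cast]
  calc (N : ℝ)⁻¹ * |bernoulliPart g (N * R) (M + 1)|
      ≤ (N : ℝ)⁻¹ * (((N * R : ℕ) : ℝ) * (C * (((N : ℝ) ^ (M + 1))⁻¹ * B))) := by gcongr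
    _ = C * R * B * ((N : ℝ) ^ (M + 1))⁻¹ := by
      push_cast
      field_simp

end

section

/-! ### Differential operators with constant coefficients -/

/-- The smooth functions on `ℝⁿ`. -/
def smoothFun (n : ℕ) : Submodule ℝ (E n → ℝ) where
  carrier := {f | ContDiff ℝ ∞ f}
  add_mem' {f g} hf hg := (show ContDiff ℝ ∞ f from hf).add (show ContDiff ℝ ∞ g from hg)
  zero_mem' := (contDiff_const : ContDiff ℝ ∞ fun _ : E n => (0 : ℝ))
  smul_mem' c f hf := (show ContDiff ℝ ∞ f from hf).const_smul c

variable {n : ℕ}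

lemma contDiff_coe (f : smoothFun n) : ContDiff ℝ ∞ (f : E n → ℝ) := f.2

lemma continuous_coe (f : smoothFun n) : Continuous (f : E n → ℝ) := (contDiff_coe f).continuous

lemma differentiable_coe (f : smoothFun n) : Differentiable ℝ (f : E n → ℝ) :=
  (contDiff_coe f).differentiable (by simp)

lemma contDiff_fderiv_coe (f : smoothFun n) : ContDiff ℝ ∞ (fderiv ℝ (f : E n → ℝ)) :=
  (contDiff_coe f).fderiv_right (by simp)

/-- The derivative in the direction of a vector. -/
def dirDeriv (n : ℕ) : E n →ₗ[ℝ] Module.End ℝ (smoothFun n) :=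
  LinearMap.mk₂ ℝ
    (fun w f => (⟨fun x => fderiv ℝ (f : E n → ℝ) x w,
      (contDiff_fderiv_coe f).clm_apply contDiff_const⟩ : smoothFun n))
    (fun v w f => by ext x; simp)
    (fun c w f => by ext x; simp)
    (fun w f g => by
      ext x
      simp [fderiv_add ((differentiable_coe f) x) ((differentiable_coe g) x)])
    (fun c w f => by
      ext x
      simp [fderiv_const_smul ((differentiable_coe f) x) c])

lemma dirDeriv_apply (w : E n) (f : smoothFun n) (x : E n) :
    (dirDeriv n w f : E n → ℝ) x = fderiv ℝ (f : E n → ℝ) x w := rfl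

lemma commute_dirDeriv (v w : E n) : Commute (dirDeriv n v) (dirDeriv n w) := by
  refine LinearMap.ext fun f => Subtype.ext (funext fun x => ?_)
  have h : ∀ v w : E n, (dirDeriv n v (dirDeriv n w f) : E n → ℝ) x =
      fderiv ℝ (fderiv ℝ (f : E n → ℝ)) x v w := by
    intro v w
    have hd : DifferentiableAt ℝ (fderiv ℝ (f : E n → ℝ)) x :=
      ((contDiff_fderiv_coe f).differentiable (by simp)) x
    have : fderiv ℝ (dirDeriv n w f : E n → ℝ) x =
        fderiv ℝ (fun x => fderiv ℝ (f : E n → ℝ) x w) x := rfl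
    rw [dirDeriv_apply, this, fderiv_clm_apply hd (differentiableAt_const w)]
    simp
  simp only [Module.End.mul_apply, h]
  exact ((contDiff_coe f).contDiffAt.isSymmSndFDerivAt (by
    simp only [minSmoothness_of_isRCLikeNormedField]
    exact ENat.LEInfty.out)).eq v w

/-- The composition of the derivatives in the directions of the elements of a multiset. -/
def multiDeriv (m : Multiset (E n)) : Module.End ℝ (smoothFun n) :=
  (m.map (dirDeriv n)).noncommProd <| by
    intro a ha b hb _
    obtain ⟨v, -, rfl⟩ := Multiset.mem_map.1 ha
    obtain ⟨w, -, rfl⟩ := Multiset.mem_map.1 hb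
    exact commute_dirDeriv v w

@[simp] lemma multiDeriv_zero : multiDeriv (0 : Multiset (E n)) = 1 := by
  simp [multiDeriv]

@[simp] lemma multiDeriv_cons (w : E n) (m : Multiset (E n)) :
    multiDeriv (w ::ₘ m) = dirDeriv n w * multiDeriv m := by
  simp [multiDeriv]

lemma multiDeriv_singleton (w : E n) : multiDeriv {w} = dirDeriv n w := by
  rw [← Multiset.cons_zero, multiDeriv_cons, multiDeriv_zero, mul_one]

lemma multiDeriv_add (m m' : Multiset (E n)) :
    multiDeriv (m + m') = multiDeriv m * multiDeriv m' := by
  induction m using Multiset.induction with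
  | empty => simp
  | cons a m ih => rw [Multiset.cons_add, multiDeriv_cons, multiDeriv_cons, ih, mul_assoc]

lemma tsupport_dirDeriv_subset (w : E n) (f : smoothFun n) :
    tsupport (dirDeriv n w f : E n → ℝ) ⊆ tsupport (f : E n → ℝ) :=
  tsupport_fderiv_apply_subset ℝ w

lemma tsupport_multiDeriv_subset (m : Multiset (E n)) (f : smoothFun n) :
    tsupport (multiDeriv m f : E n → ℝ) ⊆ tsupport (f : E n → ℝ) := by
  induction m using Multiset.induction with
  | empty => simp
  | cons a m ih =>
    rw [multiDeriv_cons]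
    exact (tsupport_dirDeriv_subset _ _).trans ih

/-- Translates between iterated Fréchet derivatives and the algebra of operators on smooth
functions, in which products and linear combinations are manipulated below. -/
lemma iteratedFDeriv_apply_eq_multiDeriv (f : smoothFun n) (k : ℕ) (w : Fin k → E n) (x : E n) :
    iteratedFDeriv ℝ k (f : E n → ℝ) x w =
      (multiDeriv (Multiset.ofList (List.ofFn w)) f : E n → ℝ) x := by
  induction k generalizing x with
  | zero => simp
  | succ k ih =>
    have hd : DifferentiableAt ℝ (iteratedFDeriv ℝ k (f : E n → ℝ)) x :=
      ((contDiff_coe f).differentiable_iteratedFDeriv (by exact_mod_cast ENat.natCast_lt_top k)) x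
    have h : (fun y => iteratedFDeriv ℝ k (f : E n → ℝ) y (Fin.tail w)) =
        (multiDeriv (Multiset.ofList (List.ofFn (Fin.tail w))) f : E n → ℝ) :=
      funext fun y => ih (Fin.tail w) y
    rw [iteratedFDeriv_succ_apply_left, List.ofFn_succ, ← Multiset.cons_coe, multiDeriv_cons,
      Module.End.mul_apply, dirDeriv_apply]
    change _ = fderiv ℝ (multiDeriv (Multiset.ofList (List.ofFn (Fin.tail w))) f : E n → ℝ) x (w 0)
    rw [← h, fderiv_continuousMultilinear_apply_const_apply hd]

lemma ofFn_repeatTuple (v : Fin n → E n) (β : Fin n → ℕ) :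
    Multiset.ofList (List.ofFn (repeatTuple v β)) = ∑ i, β i • ({v i} : Multiset (E n)) := by
  rw [← Fin.univ_val_map]
  have : (Finset.univ.val.map (repeatTuple v β)) =
      ∑ s, ({repeatTuple v β s} : Multiset (E n)) := by
    rw [← Multiset.sum_map_singleton (Finset.univ.val.map (repeatTuple v β)), Multiset.map_map]
    rfl
  rw [this, ← Equiv.sum_comp finSigmaFinEquiv, Fintype.sum_sigma]
  simp [repeatTuple]

lemma derivAlong_eq_multiDeriv (v : Fin n → E n) (β : Fin n → ℕ) (f : smoothFun n) :
    derivAlong v β f = multiDeriv (∑ i, β i • ({v i} : Multiset (E n))) f := by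
  ext x
  rw [derivAlong, iteratedFDeriv_apply_eq_multiDeriv, ofFn_repeatTuple]

/-- The differential operators that are homogeneous of degree `k`, with constant coefficients, and
involve only derivatives in the directions of `V`. -/
def homogOp (V : Submodule ℝ (E n)) (k : ℕ) : Submodule ℝ (Module.End ℝ (smoothFun n)) :=
  span ℝ {P | ∃ w : Fin k → E n, (∀ j, w j ∈ V) ∧
    P = multiDeriv (Multiset.ofList (List.ofFn w))}

lemma one_mem_homogOp (V : Submodule ℝ (E n)) : (1 : Module.End ℝ (smoothFun n)) ∈ homogOp V 0 :=
  subset_span ⟨Fin.elim0, fun j => j.elim0, by simp⟩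

lemma mul_dirDeriv_mem_homogOp {V : Submodule ℝ (E n)} {k : ℕ} {P : Module.End ℝ (smoothFun n)}
    (hP : P ∈ homogOp V k) {w : E n} (hw : w ∈ V) : P * dirDeriv n w ∈ homogOp V (k + 1) := by
  induction hP using span_induction with
  | mem P hP =>
    obtain ⟨w', hw', rfl⟩ := hP
    refine subset_span ⟨Fin.cons w w', fun j => ?_, ?_⟩
    · refine Fin.cases ?_ ?_ j
      · exact hw
      · exact hw'
    · rw [List.ofFn_succ, ← Multiset.cons_coe, ← Multiset.singleton_add, add_comm, multiDeriv_add,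
        multiDeriv_singleton]
      simp
  | zero => simp
  | add P P' _ _ h h' => rw [add_mul]; exact add_mem h h'
  | smul c P _ h => rw [smul_mul_assoc]; exact smul_mem _ _ h

lemma exists_sum_of_mem_homogOp {V : Submodule ℝ (E n)} {k : ℕ} {P : Module.End ℝ (smoothFun n)}
    (hP : P ∈ homogOp V k) : ∃ (l : ℕ) (a : Fin l → ℝ) (w : Fin l → Fin k → E n),
      (∀ i j, w i j ∈ V) ∧
        ∀ (f : smoothFun n) x, (P f : E n → ℝ) x =
          ∑ i, a i * iteratedFDeriv ℝ k (f : E n → ℝ) x (w i) := by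
  induction hP using span_induction with
  | mem P hP =>
    obtain ⟨w, hw, rfl⟩ := hP
    exact ⟨1, fun _ => 1, fun _ => w, fun _ => hw, fun f x => by
      simp [iteratedFDeriv_apply_eq_multiDeriv]⟩
  | zero => exact ⟨0, Fin.elim0, Fin.elim0, fun i => i.elim0, fun f x => by simp⟩
  | add P P' _ _ h h' =>
    obtain ⟨l, a, w, hw, h⟩ := h
    obtain ⟨l', a', w', hw', h'⟩ := h'
    refine ⟨l + l', Fin.append a a', Fin.append w w', fun i => ?_, fun f x => ?_⟩
    · refine Fin.addCases (fun i => ?_) (fun i => ?_) i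
      · simpa using hw i
      · simpa using hw' i
    · simp [Fin.sum_univ_add, ← h, ← h']
  | smul c P _ h =>
    obtain ⟨l, a, w, hw, h⟩ := h
    refine ⟨l, fun i => c * a i, w, hw, fun f x => ?_⟩
    simp [mul_assoc, ← Finset.mul_sum, ← h]

open Classical in
/-- The extension by zero of an operator on smooth functions to all functions. -/
def extendOp (P : Module.End ℝ (smoothFun n)) (f : E n → ℝ) : E n → ℝ :=
  if h : ContDiff ℝ ∞ f then (P ⟨f, h⟩ : E n → ℝ) else 0

lemma extendOp_coe (P : Module.End ℝ (smoothFun n)) (f : smoothFun n) :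
    extendOp P f = P f := by
  rw [extendOp, dif_pos (contDiff_coe f)]

lemma isDiffOpAlong_extendOp {V : Submodule ℝ (E n)} {k : ℕ} {P : Module.End ℝ (smoothFun n)}
    (hP : P ∈ homogOp V k) : IsDiffOpAlong V k (extendOp P) := by
  obtain ⟨l, a, w, hw, h⟩ := exists_sum_of_mem_homogOp hP
  exact ⟨l, a, w, hw, fun f hf x => by rw [← h ⟨f, hf⟩ x, ← extendOp_coe]⟩

/-! ### Lattice corners -/

/-- A lattice point together with a basis of the lattice. -/
structure Corner (n : ℕ) where
  p : E n
  v : Basis (Fin n) ℝ (E n)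
  p_mem : p ∈ intLattice n
  span_v : span ℤ (range v) = intLattice n

namespace Corner

variable (c : Corner n)

/-- The affine chart with values in the cone with apex `p` spanned by the vectors `- v i`. -/
def chart (t : Fin n → ℝ) : E n := c.p - ∑ i, t i • c.v i

/-- The coordinates of the chart. -/
def coord (i : Fin n) (x : E n) : ℝ := c.v.repr (c.p - x) i

lemma coord_chart (t : Fin n → ℝ) (i : Fin n) : c.coord i (c.chart t) = t i := by
  simp [coord, chart, Finsupp.single_apply]

lemma chart_coord (x : E n) : c.chart (fun i => c.coord i x) = x := by
  simp only [chart, coord, c.v.sum_repr]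
  simp

lemma continuous_chart : Continuous c.chart := by unfold chart; fun_prop

lemma continuous_coord (i : Fin n) : Continuous (c.coord i) := by
  unfold coord
  exact (LinearMap.continuous_of_finiteDimensional (c.v.coord i)).comp
    (continuous_const.sub continuous_id)

/-- The chart as a homeomorphism. -/
def chartHomeo : (Fin n → ℝ) ≃ₜ E n where
  toFun := c.chart
  invFun x i := c.coord i x
  left_inv t := funext fun i => c.coord_chart t i
  right_inv := c.chart_coord
  continuous_toFun := c.continuous_chart
  continuous_invFun := continuous_pi c.continuous_coord

/-- Moving in the `i`-th coordinate means moving along `- v i`; hence the sign, which matches the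
convention of the one-variable formula. -/
lemma hasDerivAt_chart_update (f : smoothFun n) (t : Fin n → ℝ) (i : Fin n) (s : ℝ) :
    HasDerivAt (fun s => (f : E n → ℝ) (c.chart (Function.update t i s)))
      (-(dirDeriv n (c.v i) f : E n → ℝ) (c.chart (Function.update t i s))) s := by
  have h1 : HasDerivAt (fun s => c.chart (Function.update t i s)) (-c.v i) s := by
    have : (fun s => c.chart (Function.update t i s)) =
        fun s => c.chart (Function.update t i 0) - s • c.v i := by
      ext1 s
      have : ∀ s, ∑ j, Function.update t i s j • c.v j =
          s • c.v i + ∑ j ∈ Finset.univ.erase i, t j • c.v j := by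
        intro s
        rw [← Finset.add_sum_erase _ _ (Finset.mem_univ i), Function.update_self]
        congr 1
        exact Finset.sum_congr rfl fun j hj => by
          rw [Function.update_of_ne (Finset.ne_of_mem_erase hj)]
      simp only [chart, this]
      rw [zero_smul]
      abel
    rw [this]
    simpa using ((hasDerivAt_id s).smul_const (c.v i)).const_sub (c.chart (Function.update t i 0))
  have h2 := (((differentiable_coe f) (c.chart (Function.update t i s))).hasFDerivAt).comp_hasDerivAt s h1
  rw [dirDeriv_apply, ← map_neg]
  exact h2

end Corner

end

section

/-! ### Asymptotic expansions -/

lemma isBigO_inv_pow_of_le {m k : ℕ} (h : m ≤ k) :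
    (fun N : ℕ => ((N : ℝ) ^ k)⁻¹) =O[atTop] fun N : ℕ => ((N : ℝ) ^ m)⁻¹ := by
  refine Asymptotics.IsBigO.of_bound 1 ?_
  filter_upwards [eventually_ge_atTop 1] with N hN
  have : (1 : ℝ) ≤ N := by exact_mod_cast hN
  rw [one_mul, norm_inv, norm_inv, norm_pow, norm_pow, Real.norm_natCast]
  gcongr

namespace AsymptoticExpansion

lemma isBigO_one {S T : ℕ → ℝ} (h : AsymptoticExpansion S T) :
    S =O[atTop] fun _ => (1 : ℝ) := by simpa using h 0

lemma const_mul {S T : ℕ → ℝ} (h : AsymptoticExpansion S T) (a : ℝ) :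
    AsymptoticExpansion (fun N => a * S N) fun q => a * T q := by
  intro M
  refine ((h M).const_mul_left a).congr_left fun N => ?_
  rw [mul_sub, Finset.mul_sum]
  congr 1
  exact Finset.sum_congr rfl fun q _ => by ring

lemma sum {ι : Type*} (s : Finset ι) {S T : ι → ℕ → ℝ}
    (h : ∀ i ∈ s, AsymptoticExpansion (S i) (T i)) :
    AsymptoticExpansion (fun N => ∑ i ∈ s, S i N) fun q => ∑ i ∈ s, T i q := by
  intro M
  refine (Asymptotics.IsBigO.sum fun i hi => h i hi M).congr_left fun N => ?_
  simp only [Finset.sum_apply, Finset.sum_sub_distrib, Finset.mul_sum]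
  rw [Finset.sum_comm]

lemma congr {S S' T T' : ℕ → ℝ} (h : AsymptoticExpansion S T) (hS : ∀ N, 0 < N → S N = S' N)
    (hT : ∀ q, T q = T' q) : AsymptoticExpansion S' T' := by
  obtain rfl : T = T' := funext hT
  intro M
  refine (h M).congr' ?_ (EventuallyEq.refl _ _)
  filter_upwards [eventually_gt_atTop 0] with N hN
  rw [hS N hN]

lemma of_const (a : ℝ) : AsymptoticExpansion (fun _ => a) fun q => if q = 0 then a else 0 := by
  intro M
  rcases M with - | M
  · simpa using Asymptotics.isBigO_const_const a (one_ne_zero : (1 : ℝ) ≠ 0) atTop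
  · simp only [mul_ite, mul_zero, Finset.sum_ite_eq', Finset.mem_range, Nat.succ_pos, if_true,
      pow_zero, inv_one, one_mul, sub_self]
    exact Asymptotics.isBigO_zero _ _

/-- An expansion whose coefficients themselves have expansions can be multiplied out, as for a
Cauchy product. This is what permits treating the coordinates one after the other. -/
lemma of_iterated {S : ℕ → ℝ} {S' T : ℕ → ℕ → ℝ}
    (h : ∀ M, (fun N : ℕ => S N - ∑ k ∈ Finset.range (M + 2), ((N : ℝ) ^ k)⁻¹ * S' k N)
      =O[atTop] fun N : ℕ => ((N : ℝ) ^ (M + 1))⁻¹)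
    (h' : ∀ k, AsymptoticExpansion (S' k) (T k)) :
    AsymptoticExpansion S fun q => ∑ a ∈ Finset.HasAntidiagonal.antidiagonal q, T a.1 a.2 := by
  have hk : ∀ k m : ℕ, m ≤ k → (fun N : ℕ => ((N : ℝ) ^ k)⁻¹ * S' k N)
      =O[atTop] fun N : ℕ => ((N : ℝ) ^ m)⁻¹ := by
    intro k m hm
    simpa using (isBigO_inv_pow_of_le hm).mul (h' k).isBigO_one
  have h2 : ∀ M, (fun N : ℕ => S N - ∑ k ∈ Finset.range M, ((N : ℝ) ^ k)⁻¹ * S' k N)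
      =O[atTop] fun N : ℕ => ((N : ℝ) ^ M)⁻¹ := by
    intro M
    -- The coefficients are bounded, so the terms `k = M` and `k = M + 1` can be moved into the
    -- error.
    have h3 := (h M).trans (isBigO_inv_pow_of_le (Nat.le_succ M))
    refine ((h3.add (hk M M le_rfl)).add (hk (M + 1) M (Nat.le_succ M))).congr_left fun N => ?_
    rw [Finset.sum_range_succ, Finset.sum_range_succ]
    ring
  intro M
  have h4 : ∀ k ∈ Finset.range M, (fun N : ℕ => ((N : ℝ) ^ k)⁻¹ *
      (S' k N - ∑ j ∈ Finset.range (M - k), ((N : ℝ) ^ j)⁻¹ * T k j))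
      =O[atTop] fun N : ℕ => ((N : ℝ) ^ M)⁻¹ := by
    intro k hk
    refine ((Asymptotics.isBigO_refl (fun N : ℕ => ((N : ℝ) ^ k)⁻¹) atTop).mul
      (h' k (M - k))).congr_right fun N => ?_
    rw [← mul_inv, ← pow_add, Nat.add_sub_cancel' (Finset.mem_range.1 hk).le]
  refine ((h2 M).add (Asymptotics.IsBigO.sum h4)).congr_left fun N => ?_
  have h5 : ∑ q ∈ Finset.range M, ((N : ℝ) ^ q)⁻¹ * ∑ a ∈ Finset.HasAntidiagonal.antidiagonal q, T a.1 a.2 =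
      ∑ k ∈ Finset.range M, ((N : ℝ) ^ k)⁻¹ *
        ∑ j ∈ Finset.range (M - k), ((N : ℝ) ^ j)⁻¹ * T k j := by
    simp only [Finset.mul_sum]
    rw [← Finset.sum_range_diag_flip M fun k j =>
      ((N : ℝ) ^ k)⁻¹ * (((N : ℝ) ^ j)⁻¹ * T k j)]
    refine Finset.sum_congr rfl fun q _ => ?_
    rw [Finset.Nat.sum_antidiagonal_eq_sum_range_succ fun k j => ((N : ℝ) ^ q)⁻¹ * T k j]
    refine Finset.sum_congr rfl fun k hk => ?_
    rw [← mul_assoc, ← mul_inv, ← pow_add,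
      Nat.add_sub_cancel' (Nat.lt_succ_iff.1 (Finset.mem_range.1 hk))]
  simp only [h5, Finset.sum_apply, mul_sub, Finset.sum_sub_distrib]
  ring

end AsymptoticExpansion

/-! ### The Euler–Maclaurin formula on an orthant -/

variable {n : ℕ}

/-- Fubini in the `i`-th coordinate. The outer integral keeps all `n` coordinates, with a Dirac mass
as a placeholder in the `i`-th, so that no change of index type is needed. -/
lemma integral_pi_eq_integral_update (μ : Fin n → Measure ℝ) [∀ i, SigmaFinite (μ i)] (i : Fin n)
    {F : (Fin n → ℝ) → ℝ} (hF : Integrable F (Measure.pi μ)) :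
    Integrable (fun x => ∫ s, F (Function.update x i s) ∂(μ i))
        (Measure.pi (Function.update μ i (Measure.dirac 0))) ∧
      ∫ x, F x ∂(Measure.pi μ) = ∫ x, ∫ s, F (Function.update x i s) ∂(μ i)
        ∂(Measure.pi (Function.update μ i (Measure.dirac 0))) := by
  obtain ⟨m, rfl⟩ : ∃ m, n = m + 1 := ⟨n - 1, by have := i.2; omega⟩
  have hs : ∀ j, SigmaFinite (Function.update μ i (Measure.dirac 0) j) := by
    intro j
    rcases eq_or_ne j i with rfl | h
    · rw [Function.update_self]; infer_instance
    · rw [Function.update_of_ne h]; infer_instance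
  have h1 := measurePreserving_piFinSuccAbove μ i
  have h2 := measurePreserving_piFinSuccAbove (Function.update μ i (Measure.dirac 0)) i
  simp only [Function.update_self, ne_eq, Fin.succAbove_ne, not_false_eq_true,
    Function.update_of_ne] at h2
  set ρ := Measure.pi fun j => μ (i.succAbove j) with hρ
  have hF' : Integrable (fun z : ℝ × (Fin m → ℝ) => F (i.insertNth z.1 z.2)) ((μ i).prod ρ) := by
    have := (h1.symm.integrable_comp_emb
      (MeasurableEquiv.piFinSuccAbove _ i).symm.measurableEmbedding (g := F)).2 hF
    exact this
  have e1 : ∫ x, F x ∂(Measure.pi μ) = ∫ y, ∫ s, F (i.insertNth s y) ∂(μ i) ∂ρ := by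
    rw [← integral_prod_symm (fun z : ℝ × (Fin m → ℝ) => F (i.insertNth z.1 z.2)) hF']
    exact (h1.symm.integral_comp
      (MeasurableEquiv.piFinSuccAbove _ i).symm.measurableEmbedding F).symm
  have e2 : (fun x => ∫ s, F (Function.update x i s) ∂(μ i)) ∘
      (MeasurableEquiv.piFinSuccAbove (fun _ => ℝ) i).symm =
      fun z : ℝ × (Fin m → ℝ) => ∫ s, F (i.insertNth s z.2) ∂(μ i) := by
    funext z
    have h3 : ∀ s, Function.update ((MeasurableEquiv.piFinSuccAbove (fun _ => ℝ) i).symm z) i s =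
        i.insertNth s z.2 := fun s => Fin.update_insertNth (α := fun _ => ℝ) i z.1 s z.2
    simp only [Function.comp_apply, h3]
  constructor
  · rw [← h2.symm.integrable_comp_emb
      (MeasurableEquiv.piFinSuccAbove _ i).symm.measurableEmbedding, e2]
    exact hF'.integral_prod_right.comp_snd _
  · rw [e1, ← h2.symm.integral_comp
      (MeasurableEquiv.piFinSuccAbove _ i).symm.measurableEmbedding]
    have : ∀ z, ∫ s, F (Function.update ((MeasurableEquiv.piFinSuccAbove (fun _ => ℝ) i).symm z)
        i s) ∂(μ i) = ∫ s, F (i.insertNth s z.2) ∂(μ i) := fun z => congrFun e2 z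
    simp only [this]
    rw [integral_fun_snd fun y => ∫ s, F (i.insertNth s y) ∂(μ i)]
    simp

namespace Corner

variable (c : Corner n)

/-- The support of `f` is contained in the region where all the coordinates are less than `R`. -/
def SupportedBelow (R : ℕ) (f : smoothFun n) : Prop :=
  ∀ x ∈ tsupport (f : E n → ℝ), ∀ i, c.coord i x < R

variable {c}

lemma SupportedBelow.multiDeriv {R : ℕ} {f : smoothFun n} (hf : c.SupportedBelow R f)
    (m : Multiset (E n)) : c.SupportedBelow R (multiDeriv m f) :=
  fun x hx => hf x (tsupport_multiDeriv_subset m f hx)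

lemma SupportedBelow.apply_chart_eq_zero {R : ℕ} {f : smoothFun n} (hf : c.SupportedBelow R f)
    {t : Fin n → ℝ} {i : Fin n} (ht : R ≤ t i) : (f : E n → ℝ) (c.chart t) = 0 := by
  by_contra h
  have := hf _ (subset_tsupport _ h) i
  rw [coord_chart] at this
  linarith

lemma exists_supportedBelow (c : Corner n) {f : smoothFun n}
    (hf : HasCompactSupport (f : E n → ℝ)) : ∃ R : ℕ, c.SupportedBelow R f := by
  have h : ∀ i, ∃ R : ℕ, ∀ x ∈ tsupport (f : E n → ℝ), c.coord i x < R := by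
    intro i
    obtain ⟨C, hC⟩ := hf.isCompact.exists_bound_of_continuousOn (c.continuous_coord i).continuousOn
    obtain ⟨R, hR⟩ := exists_nat_gt C
    exact ⟨R, fun x hx => ((le_abs_self _).trans (hC x hx)).trans_lt hR⟩
  choose R hR using h
  refine ⟨∑ i, R i, fun x hx i => (hR i x hx).trans_le ?_⟩
  exact_mod_cast Finset.single_le_sum (fun j _ => Nat.zero_le (R j)) (Finset.mem_univ i)

lemma hasCompactSupport_multiDeriv {f : smoothFun n}
    (hf : HasCompactSupport (f : E n → ℝ)) (m : Multiset (E n)) :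
    HasCompactSupport (multiDeriv m f : E n → ℝ) :=
  hf.of_isClosed_subset (isClosed_tsupport _) (tsupport_multiDeriv_subset m f)

lemma integrable_comp_chart (c : Corner n) {f : smoothFun n}
    (hf : HasCompactSupport (f : E n → ℝ)) (μ : Measure (Fin n → ℝ))
    [IsFiniteMeasureOnCompacts μ] : Integrable (fun t => (f : E n → ℝ) (c.chart t)) μ :=
  ((continuous_coe f).comp c.continuous_chart).integrable_of_hasCompactSupport
    (hf.comp_homeomorph c.chartHomeo)

instance isFiniteMeasure_update (μ : Fin n → Measure ℝ) [∀ i, IsFiniteMeasure (μ i)] (i : Fin n)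
    (ν : Measure ℝ) [IsFiniteMeasure ν] (j : Fin n) :
    IsFiniteMeasure (Function.update μ i ν j) := by
  rcases eq_or_ne j i with rfl | h
  · rw [Function.update_self]; infer_instance
  · rw [Function.update_of_ne h]; infer_instance

/-- The one-variable formula in the coordinate `i`, integrated over the others. The constant depends
on the other measures only through the bound `A` on their masses: these measures may vary with `N`,
because some of them are sample measures. -/
lemma exists_integral_update_sampleMeasure_sub_le {g : smoothFun n}
    (hg : HasCompactSupport (g : E n → ℝ)) {R : ℕ} (hR : c.SupportedBelow R g)
    (i : Fin n) (A : ℝ) (M : ℕ) :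
    ∃ C : ℝ, ∀ (N : ℕ) (μ : Fin n → Measure ℝ) [∀ j, IsFiniteMeasure (μ j)], 0 < N →
      (∀ j, (Function.update μ i (Measure.dirac 0) j).real univ ≤ A) →
      |∫ t, (g : E n → ℝ) (c.chart t) ∂(Measure.pi (Function.update μ i (sampleMeasure N R))) -
        ∑ k ∈ Finset.range (M + 2), ((N : ℝ) ^ k)⁻¹ * (toddCoeff k *
          ∫ t, (multiDeriv ((k - 1) • {c.v i}) g : E n → ℝ) (c.chart t)
            ∂(Measure.pi (Function.update μ i (boundaryMeasure R k))))| ≤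
        C * ((N : ℝ) ^ (M + 1))⁻¹ := by
  obtain ⟨C, hC0, hC⟩ := exists_integral_sampleMeasure_sub_le M
  -- The remainder of order `M + 1` only needs a bound on the derivative of that order, and it is
  -- uniform over all lines parallel to `v i`.
  obtain ⟨B, hB⟩ := (hasCompactSupport_multiDeriv hg ((M + 1) • {c.v i})).exists_bound_of_continuous
    (continuous_coe _)
  refine ⟨C * R * B * A ^ n, fun N μ _ hN hμ => ?_⟩
  set κ := Measure.pi (Function.update μ i (Measure.dirac 0)) with hκ
  have key : ∀ (ν : Measure ℝ) [IsFiniteMeasure ν] (m : Multiset (E n)),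
      Integrable (fun x => ∫ s, (multiDeriv m g : E n → ℝ) (c.chart (Function.update x i s)) ∂ν) κ ∧
      ∫ t, (multiDeriv m g : E n → ℝ) (c.chart t) ∂(Measure.pi (Function.update μ i ν)) =
        ∫ x, ∫ s, (multiDeriv m g : E n → ℝ) (c.chart (Function.update x i s)) ∂ν ∂κ := by
    intro ν _ m
    have := integral_pi_eq_integral_update (Function.update μ i ν) i
      (c.integrable_comp_chart (hasCompactSupport_multiDeriv hg m) _)
    simpa using this
  have k0 := fun (ν : Measure ℝ) [IsFiniteMeasure ν] => key ν 0
  simp only [multiDeriv_zero, Module.End.one_apply] at k0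
  rw [(k0 _).2]
  simp only [(key _ _).2]
  have hsum : ∑ k ∈ Finset.range (M + 2), ((N : ℝ) ^ k)⁻¹ * (toddCoeff k *
        ∫ x, ∫ s, (multiDeriv ((k - 1) • {c.v i}) g : E n → ℝ) (c.chart (Function.update x i s))
          ∂(boundaryMeasure R k) ∂κ) =
      ∫ x, ∑ k ∈ Finset.range (M + 2), ((N : ℝ) ^ k)⁻¹ * (toddCoeff k *
        ∫ s, (multiDeriv ((k - 1) • {c.v i}) g : E n → ℝ) (c.chart (Function.update x i s))
          ∂(boundaryMeasure R k)) ∂κ := by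
    rw [integral_finsetSum]
    · simp only [integral_const_mul]
    · intro k _
      exact ((key _ _).1.const_mul _).const_mul _
  rw [hsum, ← integral_sub (k0 _).1
    (integrable_finsetSum _ fun k _ => ((key _ _).1.const_mul _).const_mul _)]
  have hpt := fun x : Fin n → ℝ => hC
      (fun k s => (multiDeriv (k • {c.v i}) g : E n → ℝ) (c.chart (Function.update x i s))) R N B hN
      (fun k t => by
        rw [succ_nsmul', Multiset.singleton_add, multiDeriv_cons]
        exact c.hasDerivAt_chart_update _ x i t)
      (fun k => (hR.multiDeriv _).apply_chart_eq_zero (i := i) (by simp))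
      (fun t _ => hB _)
  simp only [zero_nsmul, multiDeriv_zero, Module.End.one_apply, ← Real.norm_eq_abs] at hpt
  refine (norm_integral_le_of_norm_le_const (Eventually.of_forall hpt)).trans ?_
  have hB0 : 0 ≤ B := (norm_nonneg _).trans (hB 0)
  have hmass : κ.real univ ≤ A ^ n := by
    rw [hκ, Measure.real, Measure.pi_univ, ENNReal.toReal_prod]
    calc _ ≤ ∏ _j : Fin n, A := Finset.prod_le_prod (fun _ _ => ENNReal.toReal_nonneg)
            fun j _ => hμ j
      _ = A ^ n := by simp
  calc _ ≤ C * R * B * ((N : ℝ) ^ (M + 1))⁻¹ * A ^ n := by gcongr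
    _ = _ := by ring

/-- Induction on the set `s` of sampled coordinates. The measures `μ` in the other coordinates are
arbitrary so that, after the formula has been applied in one coordinate, the induction hypothesis
accepts a boundary measure there. -/
theorem asymptoticExpansion_pi {R : ℕ} (s : Finset (Fin n)) :
    ∀ (μ : Fin n → Measure ℝ) [∀ j, IsFiniteMeasure (μ j)] (g : smoothFun n),
      HasCompactSupport (g : E n → ℝ) → c.SupportedBelow R g →
      AsymptoticExpansion
        (fun N => ∫ t, (g : E n → ℝ) (c.chart t)
          ∂(Measure.pi fun j => if j ∈ s then sampleMeasure N R else μ j))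
        fun q => ∑ α ∈ s.piAntidiag q, (∏ i ∈ s, toddCoeff (α i)) *
          ∫ t, (multiDeriv (∑ i ∈ s, (α i - 1) • {c.v i}) g : E n → ℝ) (c.chart t)
            ∂(Measure.pi fun j => if j ∈ s then boundaryMeasure R (α j) else μ j) := by
  induction s using Finset.cons_induction with
  | empty =>
    intro μ _ g hg hR
    refine (AsymptoticExpansion.of_const
      (∫ t, (g : E n → ℝ) (c.chart t) ∂(Measure.pi μ))).congr (by simp) fun q => ?_
    rcases eq_or_ne q 0 with rfl | hq
    · simp
    · simp [hq]
  | cons i s hi ih =>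
    intro μ _ g hg hR
    have hN : ∀ N (ν : Measure ℝ), (fun j => if j ∈ s then sampleMeasure N R else
        Function.update μ i ν j) =
        Function.update (fun j => if j ∈ s then sampleMeasure N R else μ j) i ν := by
      intro N ν
      funext j
      rcases eq_or_ne j i with rfl | h
      · simp [hi]
      · simp [h]
    have hfin : ∀ N j, IsFiniteMeasure (if j ∈ s then sampleMeasure N R else μ j) := by
      intro N j; split_ifs <;> infer_instance
    have hexp := AsymptoticExpansion.of_iterated
      (S := fun N => ∫ t, (g : E n → ℝ) (c.chart t)
          ∂(Measure.pi fun j => if j ∈ Finset.cons i s hi then sampleMeasure N R else μ j))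
      (S' := fun k N => toddCoeff k *
        ∫ t, (multiDeriv ((k - 1) • {c.v i}) g : E n → ℝ) (c.chart t)
          ∂(Measure.pi fun j => if j ∈ s then sampleMeasure N R else
            Function.update μ i (boundaryMeasure R k) j)) ?_
      (fun k => (ih (Function.update μ i (boundaryMeasure R k)) (multiDeriv ((k - 1) • {c.v i}) g)
        (hasCompactSupport_multiDeriv hg _) (hR.multiDeriv _)).const_mul (toddCoeff k))
    · refine hexp.congr (fun _ _ => rfl) fun q => ?_
      rw [Finset.piAntidiag_cons, Finset.sum_disjiUnion]
      refine Finset.sum_congr rfl fun a _ => ?_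
      rw [Finset.sum_map, Finset.mul_sum]
      refine Finset.sum_congr rfl fun α hα => ?_
      have hαi : α i = 0 := by
        by_contra h
        exact hi ((Finset.mem_piAntidiag.1 hα).2 i h)
      have hne : ∀ j ∈ s, j ≠ i := fun j hj h => hi (h ▸ hj)
      have e1 : ∏ j ∈ s, toddCoeff (α j + if j = i then a.1 else 0) = ∏ j ∈ s, toddCoeff (α j) :=
        Finset.prod_congr rfl fun j hj => by rw [if_neg (hne j hj), add_zero]
      have e2 : ∑ j ∈ s, (α j + (if j = i then a.1 else 0) - 1) • ({c.v j} : Multiset (E n)) =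
          ∑ j ∈ s, (α j - 1) • ({c.v j} : Multiset (E n)) :=
        Finset.sum_congr rfl fun j hj => by rw [if_neg (hne j hj), add_zero]
      have e3 : (fun j => if j ∈ Finset.cons i s hi then
            boundaryMeasure R (α j + if j = i then a.1 else 0) else μ j) =
          fun j => if j ∈ s then boundaryMeasure R (α j) else
            Function.update μ i (boundaryMeasure R a.1) j := by
        funext j
        rcases eq_or_ne j i with rfl | h
        · simp [hi, hαi]
        · simp [h]
      simp only [addRightEmbedding_apply, Pi.add_apply, Finset.prod_cons, Finset.sum_cons,
        if_true, hαi, zero_add, e1, e2, e3]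
      rw [add_comm, multiDeriv_add, Module.End.mul_apply, mul_assoc]
    · intro M
      obtain ⟨C, hC⟩ := exists_integral_update_sampleMeasure_sub_le hg hR i
        (R + 1 + ∑ j, (μ j).real univ) M
      refine Asymptotics.IsBigO.of_bound C ?_
      filter_upwards [eventually_gt_atTop 0] with N hN0
      have := hfin N
      have h := hC N (fun j => if j ∈ s then sampleMeasure N R else μ j) hN0 (fun j => by
        have h0 : 0 ≤ ∑ j, (μ j).real univ := Finset.sum_nonneg fun _ _ => measureReal_nonneg
        have hj := Finset.single_le_sum (f := fun j => (μ j).real univ)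
          (fun _ _ => measureReal_nonneg) (Finset.mem_univ j)
        have hσ := sampleMeasure_real_univ_le N R
        rcases eq_or_ne j i with rfl | h
        · simp only [Function.update_self, probReal_univ]
          have : (0 : ℝ) ≤ R := Nat.cast_nonneg R
          linarith
        · rw [Function.update_of_ne h]
          have : (0 : ℝ) ≤ R := Nat.cast_nonneg R
          split_ifs <;> linarith)
      simp only [← hN] at h
      have e : (fun j => if j ∈ s then sampleMeasure N R else
          Function.update μ i (sampleMeasure N R) j) =
          fun j => if j ∈ Finset.cons i s hi then sampleMeasure N R else μ j := by
        funext j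
        rcases eq_or_ne j i with rfl | h
        · simp [hi]
        · simp [h]
      rw [e] at h
      simpa using h

end Corner

end

/-! ### Riemann sums of a wedge, removal of the truncation, and integration by parts -/

section

variable {n : ℕ}

lemma pi_sampleMeasure (N R : ℕ) : Measure.pi (fun _ : Fin n => sampleMeasure N R) =
    ∑ m ∈ Fintype.piFinset fun _ : Fin n => Finset.range (N * R),
      ((N : NNReal)⁻¹ ^ n) • Measure.dirac fun i => (m i : ℝ) / N := by
  refine Measure.pi_eq fun s hs => ?_
  simp only [sampleMeasure, Measure.finsetSum_apply, Measure.smul_apply]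
  rw [Finset.prod_univ_sum]
  refine Finset.sum_congr rfl fun m _ => ?_
  rw [Measure.dirac_apply' _ (MeasurableSet.univ_pi hs)]
  simp only [ENNReal.smul_def, smul_eq_mul, Finset.prod_mul_distrib, Finset.prod_const,
    Finset.card_univ, Fintype.card_fin]
  push_cast
  congr 1
  have : ∀ i, Measure.dirac ((m i : ℝ) / N) (s i) = (s i).indicator 1 ((m i : ℝ) / N) :=
    fun i => Measure.dirac_apply' _ (hs i)
  simp only [this]
  classical
  simp only [Set.indicator_apply, Set.mem_univ_pi, Pi.one_apply, Finset.prod_ite_zero,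
    Finset.mem_univ, true_imp_iff, Finset.prod_const_one]

lemma integral_pi_sampleMeasure (N R : ℕ) (F : (Fin n → ℝ) → ℝ) :
    ∫ t, F t ∂(Measure.pi fun _ : Fin n => sampleMeasure N R) =
      ((N : ℝ) ^ n)⁻¹ * ∑ m ∈ Fintype.piFinset fun _ : Fin n => Finset.range (N * R),
        F fun i => (m i : ℝ) / N := by
  rw [pi_sampleMeasure, integral_finsetSum_measure, Finset.mul_sum]
  · refine Finset.sum_congr rfl fun m _ => ?_
    rw [integral_smul_nnreal_measure, integral_dirac]
    simp [NNReal.smul_def]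
  · intro m _
    exact (integrable_dirac (by simp)).smul_measure_nnreal

namespace Corner

variable (c : Corner n)

/-- The cone with apex `p` spanned by the vectors `- v i`. -/
def wedge : Set (E n) := {x | ∀ i, 0 ≤ c.coord i x}

/-- The integral over the face of the wedge on which the coordinates in `J` vanish, with respect to
Lebesgue measure in the other coordinates. -/
def orthantIntegral (J : Finset (Fin n)) (h : E n → ℝ) : ℝ :=
  ∫ t, h (c.chart t)
    ∂(Measure.pi fun j => if j ∈ J then Measure.dirac 0 else volume.restrict (Ici (0 : ℝ)))

variable {c}

lemma v_mem_intLattice (i : Fin n) : c.v i ∈ intLattice n := by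
  rw [← c.span_v]; exact subset_span ⟨i, rfl⟩

lemma mem_intLattice_iff (x : E n) : x ∈ intLattice n ↔ ∀ i, ∃ m : ℤ, c.v.repr x i = m := by
  rw [← c.span_v, c.v.mem_span_iff_repr_mem ℤ]
  simp [eq_comm]

lemma riemannSum_wedge {f : smoothFun n} {R : ℕ} (hR : c.SupportedBelow R f) {N : ℕ}
    (hN : 0 < N) : riemannSum c.wedge f N =
      ∫ t, (f : E n → ℝ) (c.chart t) ∂(Measure.pi fun _ : Fin n => sampleMeasure N R) := by
  have hN0 : (N : ℝ) ≠ 0 := by positivity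
  rw [integral_pi_sampleMeasure, riemannSum]
  congr 1
  -- As `p` is a lattice point and `v` a lattice basis, `κ` enumerates the lattice points of `N •
  -- c.wedge` by `ℕⁿ`; those with `f ≠ 0` have all entries below `N * R`.
  set κ : (Fin n → ℕ) → E n := fun m => (N : ℝ) • c.chart (fun i => (m i : ℝ) / N) with hκ
  have hκinv : ∀ m, (N : ℝ)⁻¹ • κ m = c.chart (fun i => (m i : ℝ) / N) := fun m => by
    simp only [hκ]; rw [inv_smul_smul₀ hN0]
  have hκinj : Function.Injective κ := by
    intro m m' h
    have h2 : c.chart (fun i => (m i : ℝ) / N) = c.chart (fun i => (m' i : ℝ) / N) := by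
      rw [← hκinv, ← hκinv, h]
    funext i
    have h3 := congrArg (c.coord i) h2
    rw [coord_chart, coord_chart, div_left_inj' hN0] at h3
    exact_mod_cast h3
  have hκmem : ∀ m, κ m ∈ (intLattice n : Set (E n)) ∩ (N : ℝ) • c.wedge := by
    intro m
    refine ⟨?_, smul_mem_smul_set fun i => ?_⟩
    · have : κ m = (N : ℤ) • c.p - ∑ i, (m i : ℤ) • c.v i := by
        simp only [hκ, chart, smul_sub, Finset.smul_sum, smul_smul, mul_div_cancel₀ _ hN0]
        simp only [Nat.cast_smul_eq_nsmul]
      rw [this]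
      exact sub_mem (zsmul_mem c.p_mem _) (sum_mem fun i _ => zsmul_mem (v_mem_intLattice i) _)
    · rw [coord_chart]; positivity
  rw [finsum_mem_eq_sum_of_inter_support_eq (t := (Fintype.piFinset fun _ : Fin n =>
      Finset.range (N * R)).image κ), Finset.sum_image hκinj.injOn]
  · simp only [hκinv]
  · ext k
    simp only [Finset.coe_image, mem_inter_iff, Function.mem_support]
    refine and_congr_left fun hk => ⟨fun ⟨h1, h2⟩ => ?_, ?_⟩
    · obtain ⟨x, hx, rfl⟩ := h2
      simp only [inv_smul_smul₀ hN0] at hk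
      have hz : (N : ℤ) • c.p - (N : ℝ) • x ∈ intLattice n := sub_mem (zsmul_mem c.p_mem _) h1
      have hco : ∀ i, ∃ m : ℕ, (N : ℝ) * c.coord i x = m := by
        intro i
        obtain ⟨z, hz⟩ := (mem_intLattice_iff (c := c) _).1 hz i
        have : (N : ℝ) * c.coord i x = z := by
          rw [← hz, coord, natCast_zsmul, ← Nat.cast_smul_eq_nsmul ℝ, ← smul_sub]
          simp
        have h0 : (0 : ℝ) ≤ z := by rw [← this]; exact mul_nonneg (by positivity) (hx i)
        lift z to ℕ using by exact_mod_cast h0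
        exact ⟨z, by simpa using this⟩
      choose m hm using hco
      refine ⟨m, ?_, ?_⟩
      · simp only [Finset.mem_coe, Fintype.mem_piFinset, Finset.mem_range]
        intro i
        have := hR x (subset_tsupport _ hk) i
        have h4 : (m i : ℝ) < N * R := by
          rw [← hm]; gcongr
        exact_mod_cast h4
      · have : (fun i => (m i : ℝ) / N) = fun i => c.coord i x := by
          funext i; rw [← hm]; field_simp
        simp only [hκ, this, chart_coord]
    · rintro ⟨m, -, rfl⟩
      exact hκmem m

lemma orthantIntegral_eq {f : smoothFun n} {R : ℕ} (hR : c.SupportedBelow R f)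
    (α : Fin n → ℕ) : ∫ t, (f : E n → ℝ) (c.chart t)
        ∂(Measure.pi fun j => boundaryMeasure R (α j)) =
      c.orthantIntegral (Finset.univ.filter fun i => 0 < α i) f := by
  have h : ∀ j, SigmaFinite (if j ∈ Finset.univ.filter (fun i => 0 < α i) then Measure.dirac 0
      else volume.restrict (Ici (0 : ℝ))) := by
    intro j; split_ifs <;> infer_instance
  have h2 : (fun j => boundaryMeasure R (α j)) = fun j =>
      (if j ∈ Finset.univ.filter (fun i => 0 < α i) then Measure.dirac 0
        else volume.restrict (Ici (0 : ℝ))).restrict (Iic (R : ℝ)) := by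
    funext j
    simp only [boundaryMeasure, Finset.mem_filter, Finset.mem_univ, true_and]
    rcases (α j).eq_zero_or_pos with h0 | h0
    · rw [if_pos h0, if_neg (by omega), Measure.restrict_restrict measurableSet_Iic, inter_comm,
        Ici_inter_Iic]
    · rw [if_neg h0.ne', if_pos h0, restrict_dirac, if_pos]
      simp
  rw [h2, ← Measure.restrict_pi_pi, orthantIntegral]
  refine setIntegral_eq_integral_of_forall_compl_eq_zero fun t ht => ?_
  simp only [mem_univ_pi, mem_Iic, not_forall, not_le] at ht
  obtain ⟨i, hi⟩ := ht
  exact hR.apply_chart_eq_zero hi.le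

/-- The Euler–Maclaurin expansion for a corner. -/
theorem asymptoticExpansion_wedge (c : Corner n) {f : smoothFun n}
    (hf : HasCompactSupport (f : E n → ℝ)) :
    AsymptoticExpansion (riemannSum c.wedge f) fun q =>
      ∑ α ∈ Finset.univ.piAntidiag q, (∏ i, toddCoeff (α i)) *
        c.orthantIntegral (Finset.univ.filter fun i => 0 < α i)
          (multiDeriv (∑ i, (α i - 1) • {c.v i}) f) := by
  obtain ⟨R, hR⟩ := c.exists_supportedBelow hf
  -- All coordinates are sampled, so the family `μ` plays no role; any finite measures would do.
  refine (asymptoticExpansion_pi Finset.univ (fun _ => sampleMeasure 0 0) f hf hR).congr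
    (fun N hN => ?_) fun q => ?_
  · simp [riemannSum_wedge hR hN]
  · refine Finset.sum_congr rfl fun α _ => ?_
    simp only [Finset.mem_univ, if_true]
    rw [orthantIntegral_eq (hR.multiDeriv _)]

/-- Integration by parts. -/
lemma orthantIntegral_dirDeriv (c : Corner n) {f : smoothFun n}
    (hf : HasCompactSupport (f : E n → ℝ)) {J : Finset (Fin n)} {i : Fin n} (hi : i ∉ J) :
    c.orthantIntegral J (dirDeriv n (c.v i) f) = c.orthantIntegral (insert i J) f := by
  have h : ∀ (J : Finset (Fin n)) j, SigmaFinite (if j ∈ J then Measure.dirac 0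
      else volume.restrict (Ici (0 : ℝ))) := by
    intro J j; split_ifs <;> infer_instance
  have h' : ∀ (J : Finset (Fin n)) j, IsLocallyFiniteMeasure (if j ∈ J then Measure.dirac 0
      else volume.restrict (Ici (0 : ℝ))) := by
    intro J j; split_ifs <;> infer_instance
  have hdf : HasCompactSupport (dirDeriv n (c.v i) f : E n → ℝ) := by
    rw [← multiDeriv_singleton]; exact hasCompactSupport_multiDeriv hf _
  rw [orthantIntegral, orthantIntegral,
    (integral_pi_eq_integral_update _ i (c.integrable_comp_chart hdf _)).2,
    (integral_pi_eq_integral_update _ i (c.integrable_comp_chart hf _)).2]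
  have e : (fun j => if j ∈ insert i J then Measure.dirac 0 else volume.restrict (Ici (0 : ℝ))) =
      Function.update (fun j => if j ∈ J then Measure.dirac 0 else volume.restrict (Ici (0 : ℝ))) i
        (Measure.dirac 0) := by
    funext j
    rcases eq_or_ne j i with rfl | h
    · simp
    · simp [h]
  rw [e, Function.update_idem]
  congr 1
  funext x
  simp only [if_neg hi, if_pos (Finset.mem_insert_self i J), integral_dirac]
  obtain ⟨R, hR⟩ := c.exists_supportedBelow hf
  rw [integral_Ici_eq_integral_Ioi]
  -- The derivative along `v i` is minus the coordinate derivative, so its integral over `[0, ∞)` is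
  -- the value at `0`, with sign plus.
  have hd := fun s => c.hasDerivAt_chart_update f x i s
  have hcl : Topology.IsClosedEmbedding fun s : ℝ => c.chart (Function.update x i s) :=
    c.chartHomeo.isClosedEmbedding.comp
      (Function.LeftInverse.isClosedEmbedding (f := fun y : Fin n → ℝ => y i)
        (fun s => by simp) (by fun_prop) (by fun_prop))
  have hint : Integrable (fun s => (dirDeriv n (c.v i) f : E n → ℝ)
      (c.chart (Function.update x i s))) :=
    ((continuous_coe _).comp hcl.continuous).integrable_of_hasCompactSupport
      (hdf.comp_isClosedEmbedding hcl)
  have key := integral_Ioi_of_hasDerivAt_of_tendsto' (a := 0) (m := 0) (fun s _ => hd s)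
    hint.neg.integrableOn (tendsto_const_nhds.congr' (by
      filter_upwards [eventually_ge_atTop (R : ℝ)] with s hs
      exact (hR.apply_chart_eq_zero (i := i) (by simpa using hs)).symm))
  rw [integral_neg] at key
  linarith

end Corner

end

section

/-! ### Integrals over faces -/

section Covolume

variable {V : Type*} [NormedAddCommGroup V] [InnerProductSpace ℝ V] [FiniteDimensional ℝ V]
  [MeasurableSpace V] [BorelSpace V] {κ : Type*} [Fintype κ]

lemma covolume_span_basis (b : Basis κ ℝ V) {Λ : Submodule ℤ V} (hb : span ℤ (range b) = Λ) :
    volume (parallelepiped b) = ENNReal.ofReal (ZLattice.covolume Λ) ∧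
      0 < ZLattice.covolume Λ := by
  subst hb
  rw [ZLattice.covolume_eq_measure_fundamentalDomain _ _ (ZSpan.isAddFundamentalDomain b volume),
    Measure.real, ENNReal.ofReal_toReal, measure_congr (ZSpan.fundamentalDomain_ae_parallelepiped b
      volume)]
  · refine ⟨rfl, ENNReal.toReal_pos ?_ ?_⟩
    · rw [← measure_congr (ZSpan.fundamentalDomain_ae_parallelepiped b volume)]
      exact ZSpan.measure_fundamentalDomain_ne_zero b
    · rw [← Basis.coe_parallelepiped]
      exact b.parallelepiped.isCompact.measure_ne_top
  · exact (ZSpan.fundamentalDomain_isBounded b).measure_lt_top.ne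

/-- Both sides are Haar measures, and the unit cube goes to the parallelotope of `b`, whose volume
is the covolume. -/
lemma map_volume_basis (b : Basis κ ℝ V) {Λ : Submodule ℤ V} (hb : span ℤ (range b) = Λ) :
    Measure.map (fun s : κ → ℝ => ∑ j, s j • b j) volume =
      ENNReal.ofReal (ZLattice.covolume Λ)⁻¹ • volume := by
  classical
  obtain ⟨h1, h2⟩ := covolume_span_basis b hb
  have h3 : Measure.map (fun s : κ → ℝ => ∑ j, s j • b j) volume = b.addHaar := by
    have e : (fun s : κ → ℝ => ∑ j, s j • b j) = b.equivFun.symm.toContinuousLinearEquiv := by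
      ext s
      simp [Basis.equivFun_symm_apply]
    rw [e, ← addHaarMeasure_eq_volume_pi, ← Basis.parallelepiped_basisFun, ← Basis.addHaar,
      Basis.map_addHaar]
    congr 1
    ext i
    simp [Basis.equivFun_symm_apply, Pi.single_apply]
  have h4 := Measure.isAddLeftInvariant_eq_smul (volume : Measure V) b.addHaar
  set a := Measure.addHaarScalarFactor (volume : Measure V) b.addHaar
  have h5 : (a : ENNReal) = ENNReal.ofReal (ZLattice.covolume Λ) := by
    rw [← h1, h4, Measure.smul_apply, b.addHaar_self]
    simp [ENNReal.smul_def]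
  have h6 : (a : ENNReal) ≠ 0 := by rw [h5]; simpa using h2
  rw [h3, ENNReal.ofReal_inv_of_pos h2, ← h5]
  conv_rhs => rw [h4]
  rw [ENNReal.smul_def, smul_smul, ENNReal.inv_mul_cancel h6 (by simp), one_smul]

/-- Let `T` send an orthonormal basis to `b`. Then `A ∘ T` is isometric, so `det (A* A) (det T)² =
1`, while `|det T|` is the volume of the parallelotope of `b`, that is, the covolume. -/
lemma sqrt_det_adjoint_comp {W : Type*} [NormedAddCommGroup W] [InnerProductSpace ℝ W]
    [FiniteDimensional ℝ W] (b : Basis κ ℝ V) {Λ : Submodule ℤ V} (hb : span ℤ (range b) = Λ)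
    (A : V →ₗ[ℝ] W) (hA : Orthonormal ℝ fun j => A (b j)) :
    √(LinearMap.det (A.adjoint ∘ₗ A)) = (ZLattice.covolume Λ)⁻¹ := by
  classical
  obtain ⟨h1, h2⟩ := covolume_span_basis b hb
  have hcard : finrank ℝ V = Fintype.card κ := finrank_eq_card_basis b
  let o : OrthonormalBasis κ ℝ V := (stdOrthonormalBasis ℝ V).reindex
    (Fintype.equivOfCardEq (by simpa using hcard))
  let T : V →ₗ[ℝ] V := o.toBasis.constr ℝ b
  have hT : ∀ j, T (o j) = b j := fun j => by
    have := o.toBasis.constr_basis ℝ b j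
    rwa [OrthonormalBasis.coe_toBasis] at this
  have hdet : ZLattice.covolume Λ = |LinearMap.det T| := by
    have : parallelepiped b = T '' parallelepiped o := by
      rw [image_parallelepiped]
      congr 1
      ext j
      simp [hT]
    rw [this, Measure.addHaar_image_linearMap, o.volume_parallelepiped, mul_one] at h1
    exact ((ENNReal.ofReal_eq_ofReal_iff (abs_nonneg _) h2.le).1 h1).symm
  have hid : T.adjoint ∘ₗ (A.adjoint ∘ₗ A) ∘ₗ T = LinearMap.id := by
    refine o.toBasis.ext fun i => InnerProductSpace.ext_inner_left_basis o.toBasis fun j => ?_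
    simp only [OrthonormalBasis.coe_toBasis, LinearMap.comp_apply, LinearMap.id_apply,
      LinearMap.adjoint_inner_right, hT]
    rw [orthonormal_iff_ite.1 hA, orthonormal_iff_ite.1 o.orthonormal]
  have hadj : LinearMap.det T.adjoint = LinearMap.det T := by
    rw [← LinearMap.det_toMatrix o.toBasis, ← LinearMap.det_toMatrix o.toBasis,
      LinearMap.toMatrix_adjoint, Matrix.det_conjTranspose]
    simp
  have hd := congrArg LinearMap.det hid
  rw [LinearMap.det_comp, LinearMap.det_comp, LinearMap.det_id, hadj] at hd
  have hd2 : LinearMap.det (A.adjoint ∘ₗ A) * |LinearMap.det T| ^ 2 = 1 := by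
    rw [sq_abs, ← hd]
    ring
  rw [← hdet] at hd2
  rw [eq_inv_of_mul_eq_one_left hd2, Real.sqrt_inv, Real.sqrt_sq h2.le]

end Covolume

variable {n : ℕ}

/-- The lattice of the integer vectors in a subspace. -/
def subspaceLattice (L : Submodule ℝ (E n)) : Submodule ℤ L :=
  (intLattice n).comap (L.subtype.restrictScalars ℤ)

namespace Corner

variable (c : Corner n)

/-- The face of the wedge on which the coordinates in `J` vanish. -/
def face (J : Finset (Fin n)) : Set (E n) := {x ∈ c.wedge | ∀ i ∈ J, c.coord i x = 0}

/-- The linear span of the vectors `v j` for `j ∉ J`. -/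
def dirSpace (J : Finset (Fin n)) : Submodule ℝ (E n) :=
  span ℝ (range fun j : {j // j ∉ J} => c.v j)

/-- The vectors `v j` for `j ∉ J` as a basis of their span. -/
def dirBasis (J : Finset (Fin n)) : Basis {j // j ∉ J} ℝ (c.dirSpace J) :=
  Basis.span (c.v.linearIndependent.comp _ Subtype.val_injective)

lemma dirBasis_apply (J : Finset (Fin n)) (j : {j // j ∉ J}) :
    (c.dirBasis J j : E n) = c.v j :=
  congrArg Subtype.val
    (Basis.span_apply (c.v.linearIndependent.comp _ Subtype.val_injective) j)

lemma mem_dirSpace_iff (J : Finset (Fin n)) (x : E n) :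
    x ∈ c.dirSpace J ↔ ∀ i ∈ J, c.v.repr x i = 0 := by
  have : (range fun j : {j // j ∉ J} => c.v j) = c.v '' {j | j ∉ J} := by
    ext; simp
  rw [dirSpace, this, c.v.mem_span_image]
  simp only [Set.subset_def, Finset.mem_coe, Finsupp.mem_support_iff, mem_ofPred_eq]
  exact forall_congr' fun i => by rw [not_imp_comm]; simp

lemma span_dirBasis (J : Finset (Fin n)) :
    span ℤ (range (c.dirBasis J)) = subspaceLattice (c.dirSpace J) := by
  ext x
  rw [(c.dirBasis J).mem_span_iff_repr_mem ℤ]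
  have hrepr : ∀ j : {j // j ∉ J}, (c.dirBasis J).repr x j = c.v.repr (x : E n) j := by
    intro j
    have h := congrArg (fun y : c.dirSpace J => c.v.repr (y : E n) j) ((c.dirBasis J).sum_repr x)
    rw [← h]
    simp [-Basis.sum_repr, dirBasis_apply, Finsupp.single_apply, Subtype.coe_inj]
  change _ ↔ (x : E n) ∈ intLattice n
  rw [mem_intLattice_iff (c := c)]
  constructor
  · intro h i
    by_cases hi : i ∈ J
    · exact ⟨0, by simpa using (c.mem_dirSpace_iff J x).1 x.2 i hi⟩
    · obtain ⟨m, hm⟩ := h ⟨i, hi⟩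
      exact ⟨m, by rw [← hrepr ⟨i, hi⟩, ← hm]; simp⟩
  · intro h j
    obtain ⟨m, hm⟩ := h j
    exact ⟨m, by rw [hrepr, hm]; simp⟩

lemma finrank_dirSpace (J : Finset (Fin n)) : finrank ℝ (c.dirSpace J) = n - J.card := by
  rw [finrank_eq_card_basis (c.dirBasis J), Fintype.card_subtype_compl]
  simp

/-- Stated for subsets of a wedge face that contain short segments at the apex, so that it serves
both for faces of the wedge and for faces of a polytope. -/
lemma vectorSpan_eq_dirSpace {F : Set (E n)} {J : Finset (Fin n)} (hF : F ⊆ c.face J)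
    (hp : c.p ∈ F) (hv : ∀ j ∉ J, ∃ ε : ℝ, 0 < ε ∧ c.p - ε • c.v j ∈ F) :
    vectorSpan ℝ F = c.dirSpace J := by
  apply le_antisymm
  · rw [vectorSpan_def, span_le]
    rintro _ ⟨x, hx, y, hy, rfl⟩
    rw [SetLike.mem_coe, mem_dirSpace_iff]
    intro i hi
    have h1 := (hF hx).2 i hi
    have h2 := (hF hy).2 i hi
    simp only [coord, map_sub, Finsupp.sub_apply] at h1 h2
    simp only [vsub_eq_sub, map_sub, Finsupp.sub_apply]
    linarith
  · rw [dirSpace, span_le]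
    rintro _ ⟨⟨j, hj⟩, rfl⟩
    obtain ⟨ε, hε, h⟩ := hv j hj
    have := vsub_mem_vectorSpan ℝ hp h
    simp only [vsub_eq_sub, sub_sub_cancel] at this
    simpa [smul_smul, hε.ne'] using smul_mem _ ε⁻¹ this

lemma coord_p (i : Fin n) : c.coord i c.p = 0 := by simp [coord]

lemma coord_p_sub (i : Fin n) (x : E n) : c.coord i (c.p - x) = c.v.repr x i := by simp [coord]

lemma vectorSpan_face (J : Finset (Fin n)) : vectorSpan ℝ (c.face J) = c.dirSpace J := by
  refine c.vectorSpan_eq_dirSpace subset_rfl ⟨fun i => (c.coord_p i).ge, fun i _ => c.coord_p i⟩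
    fun j hj => ⟨1, one_pos, fun i => ?_, fun i hi => ?_⟩
  · rw [one_smul, coord_p_sub, Basis.repr_self, Finsupp.single_apply]
    split_ifs <;> norm_num
  · rw [one_smul, coord_p_sub, Basis.repr_self, Finsupp.single_apply, if_neg]
    rintro rfl; exact hj hi

/-- Extension by zero from the coordinates not in `J`. -/
def extendCoord (J : Finset (Fin n)) (s : {j // j ∉ J} → ℝ) (i : Fin n) : ℝ :=
  if h : i ∈ J then 0 else s ⟨i, h⟩

lemma continuous_extendCoord (J : Finset (Fin n)) :
    Continuous (extendCoord J : ({j // j ∉ J} → ℝ) → Fin n → ℝ) := by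
  refine continuous_pi fun i => ?_
  unfold extendCoord
  split_ifs <;> fun_prop

lemma pi_dirac_eq_map_extendCoord (J : Finset (Fin n)) :
    Measure.pi (fun j => if j ∈ J then Measure.dirac 0 else volume.restrict (Ici (0 : ℝ))) =
      Measure.map (extendCoord J) (volume.restrict (univ.pi fun _ => Ici (0 : ℝ))) := by
  classical
  have h : ∀ j, SigmaFinite (if j ∈ J then Measure.dirac 0
      else volume.restrict (Ici (0 : ℝ))) := by
    intro j; split_ifs <;> infer_instance
  refine Measure.pi_eq fun s hs => ?_
  rw [Measure.map_apply (continuous_extendCoord J).measurable (MeasurableSet.univ_pi hs)]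
  rw [volume_pi, Measure.restrict_pi_pi]
  have hprod : ∏ i, (if i ∈ J then Measure.dirac 0 else volume.restrict (Ici (0 : ℝ))) (s i) =
      (∏ i ∈ J, (Measure.dirac (0 : ℝ)) (s i)) *
        ∏ j : {j // j ∉ J}, (volume.restrict (Ici (0 : ℝ))) (s j) := by
    rw [← Finset.prod_mul_prod_compl J]
    congr 1
    · exact Finset.prod_congr rfl fun i hi => by rw [if_pos hi]
    · rw [← Finset.prod_subtype (Jᶜ) (by simp) fun j => (volume.restrict (Ici (0 : ℝ))) (s j)]
      exact Finset.prod_congr rfl fun i hi => by rw [if_neg (Finset.mem_compl.1 hi)]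
  rw [hprod]
  by_cases h0 : ∀ i ∈ J, (0 : ℝ) ∈ s i
  · have e : extendCoord J ⁻¹' univ.pi s = univ.pi fun j : {j // j ∉ J} => s j := by
      ext x
      simp only [mem_preimage, mem_univ_pi, extendCoord]
      refine ⟨fun h j => by simpa [j.2] using h j, fun h i => ?_⟩
      split_ifs with hi
      · exact h0 i hi
      · exact h ⟨i, hi⟩
    rw [e, Measure.pi_pi, Finset.prod_eq_one (s := J), one_mul]
    intro i hi
    exact Measure.dirac_apply_of_mem (h0 i hi)
  · push Not at h0
    obtain ⟨i, hi, h0⟩ := h0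
    have e : extendCoord J ⁻¹' univ.pi s = ∅ := by
      ext x
      simp only [mem_preimage, mem_univ_pi, extendCoord, mem_empty_iff_false, iff_false, not_forall]
      exact ⟨i, by simpa [hi] using h0⟩
    rw [e, measure_empty, Finset.prod_eq_zero hi, zero_mul]
    rw [Measure.dirac_apply' _ (hs i)]
    simp [h0]

/-- The chart of the face is the coordinate map of the lattice basis `c.dirBasis J` followed by the
isometry `x ↦ c.p - x`. The first scales volume by the inverse covolume, the second preserves
Hausdorff measure. -/
lemma map_faceChart (J : Finset (Fin n)) :
    Measure.map (fun s : {j // j ∉ J} → ℝ => c.chart (extendCoord J s))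
        (volume.restrict (univ.pi fun _ => Ici (0 : ℝ))) =
      ENNReal.ofReal (ZLattice.covolume (subspaceLattice (c.dirSpace J)))⁻¹ •
        (Measure.euclideanHausdorffMeasure (finrank ℝ (c.dirSpace J))).restrict (c.face J) := by
  classical
  set G : ({j // j ∉ J} → ℝ) → E n := fun s => c.chart (extendCoord J s) with hG
  set ι : c.dirSpace J → E n := fun x => c.p - x with hι
  have hιiso : Isometry ι := by
    refine Isometry.of_dist_eq fun x y => ?_
    simp only [hι, dist_sub_left]
    rfl
  have hGc : Continuous G := c.continuous_chart.comp (continuous_extendCoord J)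
  have hGι : G = ι ∘ fun s : {j // j ∉ J} → ℝ => ∑ j, s j • c.dirBasis J j := by
    funext s
    simp only [hG, hι, chart, Function.comp_apply, AddSubmonoidClass.coe_finsetSum, coe_smul,
      dirBasis_apply]
    congr 1
    rw [← Finset.sum_add_sum_compl J, Finset.sum_eq_zero, zero_add]
    · rw [Finset.sum_subtype (p := fun j => j ∉ J) Jᶜ (by simp)
        fun i => extendCoord J s i • c.v i]
      refine Finset.sum_congr rfl fun j _ => ?_
      simp [extendCoord, j.2]
    · intro i hi
      simp [extendCoord, hi]
  have hpre : (univ.pi fun _ : {j // j ∉ J} => Ici (0 : ℝ)) = G ⁻¹' c.face J := by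
    ext s
    simp only [mem_univ_pi, mem_Ici, hG, mem_preimage, face, wedge, mem_ofPred_eq, coord_chart,
      extendCoord]
    refine ⟨fun h => ⟨fun i => ?_, fun i hi => by simp [hi]⟩, fun h j => by simpa [j.2] using h.1 j⟩
    split_ifs with hi
    · exact le_rfl
    · exact h ⟨i, hi⟩
  have hmeas : MeasurableSet (c.face J) := by
    have : c.face J = (⋂ i, {x | 0 ≤ c.coord i x}) ∩ ⋂ i ∈ J, {x | c.coord i x = 0} := by
      ext x; simp [face, wedge]
    rw [this]
    exact ((isClosed_iInter fun i => isClosed_le continuous_const (c.continuous_coord i)).inter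
      (isClosed_biInter fun i _ => isClosed_eq (c.continuous_coord i) continuous_const)).measurableSet
  have hsub : c.face J ⊆ range ι := by
    intro x hx
    refine ⟨⟨c.p - x, (c.mem_dirSpace_iff J _).2 fun i hi => hx.2 i hi⟩, by simp [hι]⟩
  rw [hpre, ← Measure.restrict_map hGc.measurable hmeas, hGι,
    ← Measure.map_map hιiso.continuous.measurable (by fun_prop),
    map_volume_basis _ (c.span_dirBasis J), Measure.map_smul,
    ← InnerProductSpace.euclideanHausdorffMeasure_eq_volume, hιiso.map_euclideanHausdorffMeasure,
    Measure.restrict_smul, Measure.restrict_restrict hmeas, inter_eq_left.2 hsub]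

lemma orthantIntegral_eq_setIntegral (J : Finset (Fin n)) {h : E n → ℝ} (hh : Continuous h) :
    c.orthantIntegral J h = (ZLattice.covolume (subspaceLattice (c.dirSpace J)))⁻¹ *
      ∫ x in c.face J, h x ∂(Measure.euclideanHausdorffMeasure (finrank ℝ (c.dirSpace J))) := by
  have hc := continuous_extendCoord J
  rw [orthantIntegral, pi_dirac_eq_map_extendCoord, integral_map hc.aemeasurable
    (show AEStronglyMeasurable (fun t => h (c.chart t)) _ from
      (hh.comp c.continuous_chart).aestronglyMeasurable)]
  have := integral_map (c.continuous_chart.comp hc).aemeasurable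
    (μ := volume.restrict (univ.pi fun _ => Ici (0 : ℝ))) (f := h) hh.aestronglyMeasurable
  simp only [Function.comp_def] at this
  rw [← this, map_faceChart, integral_smul_measure, ENNReal.toReal_ofReal, smul_eq_mul]
  exact inv_nonneg.2 (covolume_span_basis _ (c.span_dirBasis J)).2.le

lemma starIntegral_eq {F : Set (E n)} {J : Finset (Fin n)} (hF : vectorSpan ℝ F = c.dirSpace J)
    (h : E n → ℝ) : starIntegral F h = (ZLattice.covolume (subspaceLattice (c.dirSpace J)))⁻¹ *
      ∫ x in F, h x ∂(Measure.euclideanHausdorffMeasure (finrank ℝ (c.dirSpace J))) := by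
  -- The type of the lattice depends on the subspace; abstracting the subspace makes the rewriting
  -- possible.
  change (fun L : Submodule ℝ (E n) => (ZLattice.covolume (subspaceLattice L))⁻¹ *
      ∫ x in F, h x ∂(Measure.euclideanHausdorffMeasure (finrank ℝ L))) (vectorSpan ℝ F) = _
  rw [hF]

lemma orthantIntegral_empty {h : E n → ℝ} (hh : Continuous h) :
    c.orthantIntegral ∅ h = ∫ x in c.wedge, h x := by
  have hcov : ZLattice.covolume (intLattice n) = 1 := by
    obtain ⟨h1, h2⟩ := covolume_span_basis (EuclideanSpace.basisFun (Fin n) ℝ).toBasis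
      (Λ := intLattice n) (by simp [intLattice])
    have h3 := (EuclideanSpace.basisFun (Fin n) ℝ).volume_parallelepiped
    rw [OrthonormalBasis.coe_toBasis, h3] at h1
    have := congrArg ENNReal.toReal h1
    rw [ENNReal.toReal_ofReal h2.le] at this
    simpa using this.symm
  have hmap : Measure.map c.chart volume = volume := by
    have h1 := map_volume_basis c.v c.span_v
    rw [hcov, inv_one, ENNReal.ofReal_one, one_smul] at h1
    have h2 : c.chart = (fun x => c.p - x) ∘ fun s : Fin n → ℝ => ∑ j, s j • c.v j := rfl
    rw [h2, ← Measure.map_map (by fun_prop) (by fun_prop), h1]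
    exact (Measure.measurePreserving_sub_left volume c.p).map_eq
  have hmeas : MeasurableSet c.wedge := by
    have : c.wedge = ⋂ i, {x | 0 ≤ c.coord i x} := by
      ext x; simp [wedge]
    rw [this]
    exact (isClosed_iInter fun i =>
      isClosed_le continuous_const (c.continuous_coord i)).measurableSet
  have hpre : (univ.pi fun _ => Ici (0 : ℝ)) = c.chart ⁻¹' c.wedge := by
    ext s; simp [wedge, coord_chart, Pi.le_def]
  rw [orthantIntegral]
  simp only [Finset.notMem_empty, if_false]
  rw [← Measure.restrict_pi_pi, ← volume_pi, hpre,
    ← integral_map (f := h) c.continuous_chart.aemeasurable hh.aestronglyMeasurable,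
    ← Measure.restrict_map c.continuous_chart.measurable hmeas, hmap]

end Corner

end

section

/-! ### Regular integer wedges -/

variable {n : ℕ}

lemma mem_intLattice_iff_coord (x : E n) : x ∈ intLattice n ↔ ∀ j, ∃ m : ℤ, x j = m := by
  have : intLattice n = span ℤ (range (EuclideanSpace.basisFun (Fin n) ℝ).toBasis) := by
    simp [intLattice]
  rw [this, Basis.mem_span_iff_repr_mem ℤ]
  simp [eq_comm]

namespace IntegerWedge

variable (W : IntegerWedge n n)

/-- The matrix whose rows are the covectors of the wedge. -/
def mat : Matrix (Fin n) (Fin n) ℝ := Matrix.of fun i j => (W.u i j : ℝ)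

variable {W}

lemma IsRegular.det_ne_zero (hW : W.IsRegular) : W.mat.det ≠ 0 := by
  have h : (Matrix.of W.u).det ≠ 0 := by
    intro h
    obtain ⟨a, ha, h⟩ := Matrix.exists_vecMul_eq_zero_iff.2 h
    refine ha (funext fun i => ?_)
    refine Fintype.linearIndependent_iff.1 hW.1 a ?_ i
    rw [← h]
    ext j
    simp [Matrix.vecMul, dotProduct]
  have h2 : W.mat = (Matrix.of W.u).map (Int.castRingHom ℝ) := by
    ext i j; simp [mat]
  rw [h2, ← RingHom.mapMatrix_apply, ← RingHom.map_det]
  simpa using h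

lemma IsRegular.isUnit_det (hW : W.IsRegular) : IsUnit W.mat.det := hW.det_ne_zero.isUnit

/-- The real span of the `u i` is everything, so regularity writes each standard covector as an
integer combination of the `u i`; the coefficients form the inverse matrix. -/
lemma IsRegular.exists_inv_eq (hW : W.IsRegular) (j i : Fin n) :
    ∃ m : ℤ, W.mat⁻¹ j i = m := by
  have hli : LinearIndependent ℝ fun (i : Fin n) (j : Fin n) => (W.u i j : ℝ) :=
    Matrix.linearIndependent_rows_of_isUnit (A := W.mat)
      ((Matrix.isUnit_iff_isUnit_det _).2 hW.isUnit_det)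
  have htop : span ℝ (range fun (i : Fin n) (j : Fin n) => (W.u i j : ℝ)) = ⊤ :=
    hli.span_eq_top_of_card_eq_finrank' (by simp)
  have h : ∀ j, ∃ b : Fin n → ℤ, ∑ i, b i • W.u i = Pi.single j 1 := fun j =>
    (mem_span_range_iff_exists_fun ℤ).1 (hW.2 (Pi.single j 1) (by rw [htop]; trivial))
  choose b hb using h
  have hB : (Matrix.of fun j i => (b j i : ℝ)) * W.mat = 1 := by
    ext j k
    have := congrFun (hb j) k
    simp only [Finset.sum_apply, Pi.smul_apply, smul_eq_mul] at this
    rw [Matrix.mul_apply, Matrix.one_apply]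
    have h2 : ((∑ i, b j i * W.u i k : ℤ) : ℝ) = ((Pi.single j 1 : Fin n → ℤ) k : ℤ) := by
      rw [this]
    push_cast at h2
    simp only [Matrix.of_apply, mat]
    rw [h2, Pi.single_apply]
    simp [eq_comm]
  refine ⟨b j i, ?_⟩
  rw [Matrix.inv_eq_left_inv hB]
  rfl

/-- The values of the covectors of the wedge as linear coordinates. -/
def IsRegular.equiv (hW : W.IsRegular) : E n ≃ₗ[ℝ] (Fin n → ℝ) where
  toFun x := W.mat.mulVec x
  map_add' x y := by simp [Matrix.mulVec_add]
  map_smul' a x := by simp [Matrix.mulVec_smul]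
  invFun t := WithLp.toLp 2 (W.mat⁻¹.mulVec t)
  left_inv x := by
    simp [Matrix.mulVec_mulVec, Matrix.nonsing_inv_mul _ hW.isUnit_det]
  right_inv t := by
    simp [Matrix.mulVec_mulVec, Matrix.mul_nonsing_inv _ hW.isUnit_det]

/-- The corner of a regular integer wedge. -/
def IsRegular.corner (hW : W.IsRegular) : Corner n where
  v := Basis.ofEquivFun hW.equiv
  p := ∑ i, (W.c i : ℝ) • Basis.ofEquivFun hW.equiv i
  p_mem := by
    refine sum_mem fun i _ => ?_
    rw [Int.cast_smul_eq_zsmul]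
    refine zsmul_mem ((mem_intLattice_iff_coord _).2 fun j => ?_) _
    obtain ⟨m, hm⟩ := hW.exists_inv_eq j i
    exact ⟨m, by rw [← hm]; simp [IsRegular.equiv]⟩
  span_v := by
    ext x
    rw [Basis.mem_span_iff_repr_mem ℤ]
    constructor
    · intro h
      rw [← (Basis.ofEquivFun hW.equiv).sum_repr x]
      refine sum_mem fun i _ => ?_
      obtain ⟨m, hm⟩ := h i
      rw [← hm, algebraMap_int_eq, eq_intCast, Int.cast_smul_eq_zsmul]
      refine zsmul_mem ((mem_intLattice_iff_coord _).2 fun j => ?_) _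
      obtain ⟨m, hm⟩ := hW.exists_inv_eq j i
      exact ⟨m, by rw [← hm]; simp [IsRegular.equiv]⟩
    · intro h i
      choose m hm using (mem_intLattice_iff_coord _).1 h
      refine ⟨∑ j, W.u i j * m j, ?_⟩
      simp [IsRegular.equiv, Matrix.mulVec, dotProduct, mat, hm]

lemma IsRegular.corner_v (hW : W.IsRegular) (i : Fin n) : hW.corner.v i = W.dualVec i := by
  ext j
  simp [IsRegular.corner, IsRegular.equiv, dualVec, mat]

lemma IsRegular.corner_coord (hW : W.IsRegular) (i : Fin n) (x : E n) :
    hW.corner.coord i x = W.c i - pairing (W.u i) x := by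
  have : hW.corner.v.repr x i = pairing (W.u i) x := by
    simp [IsRegular.corner, IsRegular.equiv, Matrix.mulVec, dotProduct, mat, pairing]
  rw [Corner.coord, map_sub, Finsupp.sub_apply, this]
  congr 1
  have : hW.corner.p = ∑ i, (W.c i : ℝ) • hW.corner.v i := rfl
  rw [this]
  simp [Finsupp.single_apply]

lemma IsRegular.carrier_eq (hW : W.IsRegular) : W.carrier = hW.corner.wedge := by
  ext x
  simp [carrier, Corner.wedge, hW.corner_coord]

lemma IsRegular.face_eq (hW : W.IsRegular) (α : Fin n → ℕ) :
    W.face α = hW.corner.face (Finset.univ.filter fun i => 0 < α i) := by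
  ext x
  simp only [face, hW.carrier_eq, Corner.face, mem_inter_iff, mem_iInter, facet, mem_ofPred_eq,
    Finset.mem_filter, Finset.mem_univ, true_and, hW.corner_coord, sub_eq_zero]
  refine and_congr_right fun hx => forall₂_congr fun i _ => ?_
  rw [eq_comm (a := (W.c i : ℝ))]
  exact and_iff_right hx

/-- The linear part of `φ` maps the dual basis to the standard basis, hence a lattice basis of the
directions of the face to an orthonormal family. -/
lemma IsRegular.K_eq (hW : W.IsRegular) (α : Fin n → ℕ) : W.K α =
    (ZLattice.covolume (subspaceLattice
      (hW.corner.dirSpace (Finset.univ.filter fun i => 0 < α i))))⁻¹ := by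
  rw [K, hW.face_eq, Corner.vectorSpan_face, jacobianOn]
  refine sqrt_det_adjoint_comp _ (hW.corner.span_dirBasis _) _ ?_
  have h : ∀ j, W.phiLinear (hW.corner.v j) = EuclideanSpace.basisFun (Fin n) ℝ j := by
    intro j
    ext i
    have h2 := congrFun (congrFun (Matrix.mul_nonsing_inv _ hW.isUnit_det) i) j
    rw [hW.corner_v]
    rw [Matrix.mul_apply, Matrix.one_apply] at h2
    simpa [phiLinear, dualVec, mat, Pi.single_apply, Matrix.mulVec_eq_sum, mul_comm] using h2
  have h2 : (fun j => W.phiLinear.domRestrict _ (hW.corner.dirBasis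
      (Finset.univ.filter fun i => 0 < α i) j)) =
      fun j : {j // j ∉ Finset.univ.filter fun i => 0 < α i} =>
        EuclideanSpace.basisFun (Fin n) ℝ (j : Fin n) := by
    funext j
    rw [LinearMap.domRestrict_apply, Corner.dirBasis_apply, h]
  rw [h2]
  exact (EuclideanSpace.basisFun (Fin n) ℝ).orthonormal.comp _ Subtype.val_injective

end IntegerWedge

theorem asymptoticExpansion_regularWedge {W : IntegerWedge n n} (hW : W.IsRegular)
    {f : E n → ℝ} (hf : ContDiff ℝ ∞ f) (hf' : HasCompactSupport f) :
    AsymptoticExpansion (riemannSum W.carrier f) fun q =>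
      ∑ α ∈ Finset.piAntidiag (Finset.univ : Finset (Fin n)) q,
        W.C α * faceIntegral (W.face α) (derivAlong W.dualVec (α - r α) f) := by
  lift f to smoothFun n using hf
  refine (hW.corner.asymptoticExpansion_wedge hf').congr (fun N _ => by rw [hW.carrier_eq])
    fun q => Finset.sum_congr rfl fun α _ => ?_
  have h1 : (α - r α) = fun i => α i - 1 := by
    funext i
    simp only [Pi.sub_apply, r]
    split_ifs <;> omega
  have h2 : W.dualVec = hW.corner.v := funext fun i => (hW.corner_v i).symm
  rw [h1, h2, derivAlong_eq_multiDeriv, Corner.orthantIntegral_eq_setIntegral _ _ (continuous_coe _),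
    faceIntegral, hW.face_eq, Corner.vectorSpan_face, ← hW.K_eq, IntegerWedge.C, ← mul_assoc]
  congr 2
  simp only [toddCoeff, Finset.prod_div_distrib]
  push_cast
  ring

end

section

/-! ### Localization of the expansion at the faces -/

variable {n : ℕ}

/-- The operators that do not enlarge the support. -/
def localOps (n : ℕ) : Subalgebra ℝ (Module.End ℝ (smoothFun n)) where
  carrier := {P | ∀ f, tsupport (P f : E n → ℝ) ⊆ tsupport (f : E n → ℝ)}
  mul_mem' hP hQ f := (hP _).trans (hQ f)
  add_mem' {P Q} hP hQ f := by
    refine (closure_mono (Function.support_add (P f : E n → ℝ) (Q f : E n → ℝ))).trans ?_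
    rw [closure_union]
    exact union_subset (hP f) (hQ f)
  algebraMap_mem' a f := closure_mono fun x hx => by
    simp only [Module.algebraMap_end_apply, SetLike.val_smul, Function.mem_support, Pi.smul_apply,
      smul_eq_mul] at hx
    exact right_ne_zero_of_mul hx

lemma dirDeriv_mem_localOps (w : E n) : dirDeriv n w ∈ localOps n := tsupport_dirDeriv_subset w

lemma hasCompactSupport_of_mem_localOps {P : Module.End ℝ (smoothFun n)} (hP : P ∈ localOps n)
    {f : smoothFun n} (hf : HasCompactSupport (f : E n → ℝ)) :
    HasCompactSupport (P f : E n → ℝ) :=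
  hf.of_isClosed_subset (isClosed_tsupport _) (hP f)

open Classical in
/-- The vector in the span of `J` that is dual to `u ∈ J`, if there is one. -/
def dualIn (J : Finset (E n)) (u : E n) : E n :=
  if h : ∃ w ∈ span ℝ (J : Set (E n)), ∀ u' ∈ J, inner ℝ u' w = if u' = u then 1 else 0
  then h.choose else 0

lemma dualIn_mem_span (J : Finset (E n)) (u : E n) : dualIn J u ∈ span ℝ (J : Set (E n)) := by
  rw [dualIn]
  split_ifs with h
  · exact h.choose_spec.1
  · exact zero_mem _

open Classical in
lemma inner_dualIn {J : Finset (E n)} {u : E n}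
    (h : ∃ w ∈ span ℝ (J : Set (E n)), ∀ u' ∈ J, inner ℝ u' w = if u' = u then 1 else 0)
    {u' : E n} (hu' : u' ∈ J) : inner ℝ u' (dualIn J u) = if u' = u then 1 else 0 := by
  rw [dualIn, dif_pos h]
  exact h.choose_spec.2 u' hu'

open Classical in
/-- The contribution at the face with normal vectors `K` of an iterated derivative integrated over
the face with normal vectors `J`; the list `l` consists of elements of `J` and stands for the
derivatives in the directions of the vectors dual to them. -/
def localOp (K : Finset (E n)) : List (E n) → Finset (E n) → Module.End ℝ (smoothFun n)
  | [], J => if K = J then 1 else 0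
  | u :: l, J => localOp K l J * dirDeriv n (dualIn J u) +
      ∑ j ∈ K \ J, (-inner ℝ j (dualIn J u) : ℝ) • localOp K l (insert j J)

/-- The set `J` only grows along the recursion, so `K` can only be reached from its subsets. -/
lemma localOp_eq_zero {K : Finset (E n)} (l : List (E n)) :
    ∀ {J : Finset (E n)}, ¬ J ⊆ K → localOp K l J = 0 := by
  classical
  induction l with
  | nil =>
    intro J h
    rw [localOp, if_neg]
    rintro rfl; exact h subset_rfl
  | cons u l ih =>
    intro J h
    rw [localOp, ih h, zero_mul, zero_add]
    refine Finset.sum_eq_zero fun j _ => ?_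
    rw [ih fun h' => h ((Finset.subset_insert _ _).trans h'), smul_zero]

lemma localOp_mem_localOps (K : Finset (E n)) (l : List (E n)) :
    ∀ J : Finset (E n), localOp K l J ∈ localOps n := by
  classical
  induction l with
  | nil =>
    intro J
    rw [localOp]
    split_ifs
    · exact one_mem _
    · exact zero_mem _
  | cons u l ih =>
    intro J
    rw [localOp]
    exact add_mem (mul_mem (ih J) (dirDeriv_mem_localOps _))
      (sum_mem fun j _ => Subalgebra.smul_mem _ (ih _) _)

/-- Each entry of the list is used up either by a derivative normal to the current face, hence in
the span of `K`, or by the addition of one normal to `J`. So the degree plus `K.card` equals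
`l.length + J.card`. -/
lemma localOp_homog (K : Finset (E n)) (l : List (E n)) : ∀ {J : Finset (E n)}, J ⊆ K →
    (∀ k, k + K.card = l.length + J.card →
      localOp K l J ∈ homogOp (span ℝ (K : Set (E n))) k) ∧
    (l.length + J.card < K.card → localOp K l J = 0) := by
  classical
  induction l with
  | nil =>
    intro J h
    rw [localOp]
    refine ⟨fun k hk => ?_, fun hk => ?_⟩
    · split_ifs with hKJ
      · subst hKJ
        obtain rfl : k = 0 := by simpa using hk
        exact one_mem_homogOp _
      · exact zero_mem _
    · rw [if_neg]
      rintro rfl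
      simp at hk
  | cons u l ih =>
    intro J h
    have hw : dualIn J u ∈ span ℝ (K : Set (E n)) :=
      span_mono (by exact_mod_cast h) (dualIn_mem_span J u)
    have hj : ∀ j ∈ K \ J, insert j J ⊆ K ∧ (insert j J).card = J.card + 1 := fun j hj =>
      ⟨Finset.insert_subset (Finset.mem_sdiff.1 hj).1 h,
        Finset.card_insert_of_notMem (Finset.mem_sdiff.1 hj).2⟩
    rw [localOp]
    simp only [List.length_cons]
    refine ⟨fun k hk => add_mem ?_ (sum_mem fun j hjK => smul_mem _ _ ?_), fun hk => ?_⟩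
    · rcases k with - | k
      · rw [(ih h).2 (by omega), zero_mul]
        exact zero_mem _
      · exact mul_dirDeriv_mem_homogOp ((ih h).1 k (by omega)) hw
    · obtain ⟨h1, h2⟩ := hj j hjK
      exact (ih h1).1 k (by omega)
    · rw [(ih h).2 (by omega), zero_mul, zero_add]
      refine Finset.sum_eq_zero fun j hjK => ?_
      obtain ⟨h1, h2⟩ := hj j hjK
      rw [(ih h1).2 (by omega), smul_zero]

/-- The multiset that contains each `u ∈ U` exactly `α u - 1` times. -/
def predMultiset (U : Finset (E n)) (α : E n → ℕ) : Multiset (E n) :=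
  ∑ u ∈ U, (α u - 1) • {u}

lemma card_predMultiset (U : Finset (E n)) (α : E n → ℕ) :
    (predMultiset U α).card + (U.filter fun u => 0 < α u).card = ∑ u ∈ U, α u := by
  have : (predMultiset U α).card = ∑ u ∈ U, (α u - 1) := by
    rw [predMultiset, Multiset.card_sum]
    simp
  rw [this, Finset.card_filter, ← Finset.sum_add_distrib]
  refine Finset.sum_congr rfl fun u _ => ?_
  split_ifs <;> omega

open Classical in
/-- The coefficient operator of order `q` at the face with normal vectors `U`. -/
def faceOp (q : ℕ) (U : Finset (E n)) : Module.End ℝ (smoothFun n) :=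
  ∑ α ∈ U.piAntidiag q, (∏ u ∈ U, toddCoeff (α u)) •
    localOp U (predMultiset U α).toList (U.filter fun u => 0 < α u)

lemma faceOp_mem_localOps (q : ℕ) (U : Finset (E n)) : faceOp q U ∈ localOps n :=
  sum_mem fun _ _ => Subalgebra.smul_mem _ (localOp_mem_localOps _ _ _) _

lemma faceOp_mem_homogOp {q : ℕ} {U : Finset (E n)} (h : U.card ≤ q) :
    faceOp q U ∈ homogOp (span ℝ (U : Set (E n))) (q - U.card) := by
  classical
  refine sum_mem fun α hα => smul_mem _ _ ?_
  refine (localOp_homog U _ (Finset.filter_subset _ _)).1 _ ?_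
  rw [Multiset.length_toList, card_predMultiset, (Finset.mem_piAntidiag.1 hα).1]
  omega

lemma faceOp_eq_zero {q : ℕ} {U : Finset (E n)} (h : q < U.card) : faceOp q U = 0 := by
  classical
  refine Finset.sum_eq_zero fun α hα => ?_
  rw [(localOp_homog U _ (Finset.filter_subset _ _)).2, smul_zero]
  rw [Multiset.length_toList, card_predMultiset, (Finset.mem_piAntidiag.1 hα).1]
  exact h

lemma faceOp_empty {q : ℕ} (h : q ≠ 0) : faceOp q (∅ : Finset (E n)) = 0 := by
  classical
  rw [faceOp, Finset.piAntidiag_empty_of_ne_zero h, Finset.sum_empty]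

lemma faceOp_zero_empty : faceOp 0 (∅ : Finset (E n)) = 1 := by
  classical
  simp [faceOp, predMultiset, localOp]

namespace Corner

variable (c : Corner n)

/-- The vectors of the dual basis. -/
def u (i : Fin n) : E n :=
  (InnerProductSpace.toDual ℝ (E n)).symm (LinearMap.toContinuousLinearMap (c.v.coord i))

lemma inner_u (i : Fin n) (x : E n) : inner ℝ (c.u i) x = c.v.repr x i := by
  rw [u, InnerProductSpace.toDual_symm_apply]
  rfl

lemma inner_u_v (i j : Fin n) : inner ℝ (c.u i) (c.v j) = if i = j then (1 : ℝ) else 0 := by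
  rw [inner_u, Basis.repr_self, Finsupp.single_apply]
  simp [eq_comm]

lemma u_injective : Function.Injective c.u := by
  intro i j h
  by_contra hij
  have h1 := c.inner_u_v i i
  rw [h, inner_u_v, if_neg (Ne.symm hij)] at h1
  simp at h1

lemma sum_inner_v_smul_u (x : E n) : ∑ i, (inner ℝ (c.v i) x : ℝ) • c.u i = x := by
  refine InnerProductSpace.ext_inner_left_basis c.v fun j => ?_
  rw [inner_sum]
  have h : ∀ i, inner ℝ (c.v j) (c.u i) = if i = j then (1 : ℝ) else 0 := fun i => by
    rw [real_inner_comm, inner_u_v]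
  simp [inner_smul_right, h]

lemma orthogonal_dirSpace (J : Finset (Fin n)) :
    (c.dirSpace J)ᗮ = span ℝ (c.u '' (J : Set (Fin n))) := by
  apply le_antisymm
  · intro x hx
    rw [← c.sum_inner_v_smul_u x]
    refine sum_mem fun i _ => ?_
    by_cases hi : i ∈ J
    · exact smul_mem _ _ (subset_span ⟨i, hi, rfl⟩)
    · rw [(mem_orthogonal _ _).1 hx _ (subset_span ⟨⟨i, hi⟩, rfl⟩), zero_smul]
      exact zero_mem _
  · rw [span_le]
    rintro _ ⟨i, hi, rfl⟩
    rw [SetLike.mem_coe, mem_orthogonal]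
    intro x hx
    rw [real_inner_comm, inner_u]
    exact (c.mem_dirSpace_iff J x).1 hx i hi

-- The component of `v i` orthogonal to the face pairs with the `u k`, `k ∈ J`, in the same way as
-- `v i` itself, since these `u k` vanish on the directions of the face.
open Classical in
lemma exists_dualIn (J : Finset (Fin n)) {i : Fin n} :
    ∃ w ∈ span ℝ ((J.image c.u : Finset (E n)) : Set (E n)), ∀ u' ∈ J.image c.u,
      inner ℝ u' w = if u' = c.u i then (1 : ℝ) else 0 := by
  refine ⟨c.v i - (c.dirSpace J).starProjection (c.v i), ?_, ?_⟩
  · rw [Finset.coe_image, ← orthogonal_dirSpace]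
    exact sub_starProjection_mem_orthogonal _
  · intro u' hu'
    obtain ⟨k, hk, rfl⟩ := Finset.mem_image.1 hu'
    rw [inner_sub_right, c.inner_u k (starProjection _ _),
      (c.mem_dirSpace_iff J _).1 (starProjection_apply_mem _ _) k hk, inner_u_v, sub_zero]
    simp only [c.u_injective.eq_iff]

variable {c}

lemma orthantIntegral_add {f g : smoothFun n} (hf : HasCompactSupport (f : E n → ℝ))
    (hg : HasCompactSupport (g : E n → ℝ)) (J : Finset (Fin n)) :
    c.orthantIntegral J (f + g : smoothFun n) = c.orthantIntegral J f + c.orthantIntegral J g := by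
  have h : ∀ j, SigmaFinite (if j ∈ J then Measure.dirac 0
      else volume.restrict (Ici (0 : ℝ))) := by
    intro j; split_ifs <;> infer_instance
  have h' : ∀ j, IsLocallyFiniteMeasure (if j ∈ J then Measure.dirac 0
      else volume.restrict (Ici (0 : ℝ))) := by
    intro j; split_ifs <;> infer_instance
  exact integral_add (c.integrable_comp_chart hf _) (c.integrable_comp_chart hg _)

lemma orthantIntegral_sum {ι : Type*} (s : Finset ι) {f : ι → smoothFun n}
    (hf : ∀ i ∈ s, HasCompactSupport (f i : E n → ℝ)) (J : Finset (Fin n)) :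
    c.orthantIntegral J (∑ i ∈ s, f i : smoothFun n) = ∑ i ∈ s, c.orthantIntegral J (f i) := by
  have h : ∀ j, SigmaFinite (if j ∈ J then Measure.dirac 0
      else volume.restrict (Ici (0 : ℝ))) := by
    intro j; split_ifs <;> infer_instance
  have h' : ∀ j, IsLocallyFiniteMeasure (if j ∈ J then Measure.dirac 0
      else volume.restrict (Ici (0 : ℝ))) := by
    intro j; split_ifs <;> infer_instance
  simp only [orthantIntegral, AddSubmonoidClass.coe_finsetSum, Finset.sum_apply]
  exact integral_finsetSum _ fun i hi => c.integrable_comp_chart (hf i hi) _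

lemma orthantIntegral_smul (a : ℝ) (f : smoothFun n) (J : Finset (Fin n)) :
    c.orthantIntegral J (a • f : smoothFun n) = a * c.orthantIntegral J f :=
  integral_const_mul a _

lemma orthantIntegral_add_sum_smul {ι : Type*} {s : Finset ι} {P : Module.End ℝ (smoothFun n)}
    {Q : ι → Module.End ℝ (smoothFun n)} (hP : P ∈ localOps n) (hQ : ∀ i, Q i ∈ localOps n)
    (a : ι → ℝ) {f : smoothFun n} (hf : HasCompactSupport (f : E n → ℝ)) (J : Finset (Fin n)) :
    c.orthantIntegral J ((P + ∑ i ∈ s, a i • Q i) f) =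
      c.orthantIntegral J (P f) + ∑ i ∈ s, a i * c.orthantIntegral J (Q i f) := by
  have h1 : ∀ i, HasCompactSupport (a i • Q i f : smoothFun n).1 := fun i =>
    hasCompactSupport_of_mem_localOps (Subalgebra.smul_mem _ (hQ i) (a i)) hf
  have h2 : HasCompactSupport (∑ i ∈ s, a i • Q i f : smoothFun n).1 := by
    have := hasCompactSupport_of_mem_localOps (P := ∑ i ∈ s, a i • Q i)
      (sum_mem fun i _ => Subalgebra.smul_mem _ (hQ i) (a i)) hf
    simpa only [LinearMap.sum_apply, LinearMap.smul_apply] using this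
  rw [LinearMap.add_apply, LinearMap.sum_apply]
  simp only [LinearMap.smul_apply]
  rw [orthantIntegral_add (hasCompactSupport_of_mem_localOps hP hf) h2,
    orthantIntegral_sum _ fun i _ => h1 i]
  simp only [orthantIntegral_smul]

-- The heart of the localization: derivatives along the `v i` are traded for derivatives normal to
-- faces. By induction on the list, the first `v i` is split into its normal part and tangent
-- vectors, and the tangent derivatives are integrated by parts.
open Classical in
lemma orthantIntegral_multiDeriv (l : List (Fin n)) :
    ∀ {f : smoothFun n} {J : Finset (Fin n)}, HasCompactSupport (f : E n → ℝ) → (∀ i ∈ l, i ∈ J) →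
      c.orthantIntegral J (multiDeriv (Multiset.ofList (l.map c.v)) f) =
        ∑ K : Finset (Fin n),
          c.orthantIntegral K (localOp (K.image c.u) (l.map c.u) (J.image c.u) f) := by
  induction l with
  | nil =>
    intro f J hf _
    rw [Finset.sum_eq_single J]
    · simp [localOp]
    · intro K _ hK
      rw [List.map_nil, localOp, if_neg fun h => hK (Finset.image_injective c.u_injective h)]
      simp [orthantIntegral]
    · simp
  | cons i l ih =>
    intro f J hf hl
    have hi : i ∈ J := hl i (by simp)
    set w := dualIn (J.image c.u) (c.u i) with hw
    have hw' : ∀ k ∈ J, inner ℝ (c.u k) w = if k = i then (1 : ℝ) else 0 := by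
      intro k hk
      rw [hw, inner_dualIn (c.exists_dualIn J) (Finset.mem_image_of_mem _ hk)]
      simp only [c.u_injective.eq_iff]
    -- Expand `w` in the basis `v`: its coefficients are the `⟨u k, w⟩`, which for `k ∈ J` are those
    -- of `v i`.
    have hv : c.v i = w + ∑ j ∈ Jᶜ, (-inner ℝ (c.u j) w : ℝ) • c.v j := by
      simp only [neg_smul, Finset.sum_neg_distrib]
      rw [← sub_eq_add_neg, eq_sub_iff_add_eq]
      conv_rhs => rw [← c.v.sum_repr w]
      simp only [← inner_u]
      rw [← Finset.sum_add_sum_compl J]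
      congr 1
      rw [Finset.sum_congr rfl fun k hk => by rw [hw' k hk]]
      simp [hi]
    have hm : ∀ {g : smoothFun n}, HasCompactSupport (g : E n → ℝ) → ∀ m : Multiset (E n),
        HasCompactSupport (multiDeriv m g : E n → ℝ) :=
      fun hg m => hasCompactSupport_multiDeriv hg m
    have hd : ∀ {g : smoothFun n}, HasCompactSupport (g : E n → ℝ) → ∀ x : E n,
        HasCompactSupport (dirDeriv n x g : E n → ℝ) :=
      fun hg x => hasCompactSupport_of_mem_localOps (dirDeriv_mem_localOps x) hg
    set D := multiDeriv (Multiset.ofList (l.map c.v)) with hD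
    have hcomm : ∀ x : E n, dirDeriv n x * D = D * dirDeriv n x := by
      intro x
      rw [hD, ← multiDeriv_singleton, ← multiDeriv_add, ← multiDeriv_add, add_comm]
    have e1 : multiDeriv (Multiset.ofList ((i :: l).map c.v)) = D * dirDeriv n w +
        ∑ j ∈ Jᶜ, (-inner ℝ (c.u j) w : ℝ) • (dirDeriv n (c.v j) * D) := by
      rw [List.map_cons, ← Multiset.cons_coe, multiDeriv_cons, ← hD, hv, map_add, map_sum, add_mul,
        hcomm, Finset.sum_mul]
      simp only [map_smul, smul_mul_assoc]
    have hDloc : D ∈ localOps n := tsupport_multiDeriv_subset _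
    rw [e1, orthantIntegral_add_sum_smul (mul_mem hDloc (dirDeriv_mem_localOps _))
      (fun j => mul_mem (dirDeriv_mem_localOps _) hDloc) _ hf, Module.End.mul_apply,
      ih (hd hf w) fun k hk => hl k (by simp [hk])]
    have e2 : ∀ j ∈ Jᶜ, (-inner ℝ (c.u j) w : ℝ) *
        c.orthantIntegral J ((dirDeriv n (c.v j) * D) f : smoothFun n) =
        ∑ K : Finset (Fin n), (-inner ℝ (c.u j) w : ℝ) * c.orthantIntegral K
          (localOp (K.image c.u) (l.map c.u) ((insert j J).image c.u) f) := by
      intro j hj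
      rw [Module.End.mul_apply, c.orthantIntegral_dirDeriv (hm hf _) (Finset.mem_compl.1 hj),
        ih hf fun k hk => Finset.mem_insert_of_mem (hl k (by simp [hk])), Finset.mul_sum]
    rw [Finset.sum_congr rfl e2, Finset.sum_comm, ← Finset.sum_add_distrib]
    refine Finset.sum_congr rfl fun K _ => ?_
    rw [List.map_cons, localOp, ← hw, orthantIntegral_add_sum_smul
      (mul_mem (localOp_mem_localOps _ _ _) (dirDeriv_mem_localOps _))
      (fun j => localOp_mem_localOps _ _ _) _ hf, Module.End.mul_apply]
    congr 1
    -- The integration by parts yields all `j ∉ J`, the recursion only those in `K`; the other `j`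
    -- lead to faces from which `K` is not reached.
    have e3 : K.image c.u \ J.image c.u = (Jᶜ.filter (· ∈ K)).image c.u := by
      rw [← Finset.image_sdiff _ _ c.u_injective]
      congr 1
      ext; simp [and_comm]
    rw [e3, Finset.sum_image c.u_injective.injOn, Finset.sum_filter]
    refine Finset.sum_congr rfl fun j hj => ?_
    split_ifs with hjK
    · rw [Finset.image_insert]
    · rw [localOp_eq_zero]
      · simp [orthantIntegral]
      · intro h
        obtain ⟨k, hk, hkj⟩ := Finset.mem_image.1
          (h (Finset.mem_image_of_mem c.u (Finset.mem_insert_self j J)))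
        exact hjK (c.u_injective hkj ▸ hk)

end Corner

end

/-! ### Regrouping the expansion of a corner by faces -/

section

variable {n : ℕ}

namespace Corner

variable {c : Corner n}

/-- `localOp` is written in terms of an ordered list, and `faceOp` uses the order chosen by
`toList`. This provides a list of indices in precisely that order, the same for every `K` that
contains the support of `α`. -/
lemma exists_list_map_u (α : Fin n → ℕ) : ∃ l : List (Fin n), (∀ i ∈ l, 0 < α i) ∧
    (Multiset.ofList (l.map c.v) = ∑ i, (α i - 1) • {c.v i}) ∧
    ∀ (K : Finset (Fin n)) (β : E n → ℕ), (∀ i, β (c.u i) = α i) → (∀ i, 0 < α i → i ∈ K) →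
      l.map c.u = (predMultiset (K.map ⟨c.u, c.u_injective⟩) β).toList := by
  classical
  set m : Multiset (Fin n) := ∑ i, (α i - 1) • {i} with hm
  have hmap : ∀ w : Fin n → E n, m.map w = ∑ i, (α i - 1) • {w i} := by
    intro w
    rw [hm, ← Multiset.coe_mapAddMonoidHom, map_sum]
    simp [Multiset.map_nsmul]
  have hK : ∀ (K : Finset (Fin n)) (β : E n → ℕ), (∀ i, β (c.u i) = α i) →
      (∀ i, 0 < α i → i ∈ K) → predMultiset (K.map ⟨c.u, c.u_injective⟩) β = m.map c.u := by
    intro K β hβ h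
    rw [predMultiset, Finset.sum_map, hmap]
    simp only [Function.Embedding.coeFn_mk, hβ]
    refine Finset.sum_subset (Finset.subset_univ K) fun i _ hi => ?_
    rw [Nat.eq_zero_of_not_pos fun h0 => hi (h i h0)]
    simp
  obtain ⟨l, hl⟩ : ∃ l : List (Fin n), l.map c.u = (m.map c.u).toList := by
    rw [← Set.mem_range, Set.range_list_map]
    intro x hx
    obtain ⟨i, -, rfl⟩ := Multiset.mem_map.1 (Multiset.mem_toList.1 hx)
    exact ⟨i, rfl⟩
  have hlm : (l : Multiset (Fin n)) = m := by
    refine Multiset.map_injective c.u_injective ?_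
    rw [Multiset.map_coe, hl, Multiset.coe_toList]
  refine ⟨l, fun i hi => ?_, ?_, fun K β hβ h => ?_⟩
  · have : i ∈ m := by rw [← hlm]; exact hi
    rw [hm, Multiset.mem_sum] at this
    obtain ⟨j, -, hj⟩ := this
    have hji := Multiset.mem_of_mem_nsmul hj
    rw [Multiset.mem_singleton] at hji
    subst hji
    by_contra h0
    rw [Nat.eq_zero_of_not_pos h0] at hj
    simp at hj
  · rw [← hmap, ← hlm, Multiset.map_coe]
  · rw [hK K β hβ h, hl]

-- Apply `orthantIntegral_multiDeriv` to each multi-index and exchange the sums. For fixed `K` only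
-- the `α` supported in `K` survive, and these are the multi-indices in the definition of `faceOp`.
open Classical in
theorem sum_orthantIntegral_eq {f : smoothFun n} (hf : HasCompactSupport (f : E n → ℝ)) (q : ℕ) :
    ∑ α ∈ Finset.univ.piAntidiag q, (∏ i, toddCoeff (α i)) *
        c.orthantIntegral (Finset.univ.filter fun i => 0 < α i)
          (multiDeriv (∑ i, (α i - 1) • {c.v i}) f) =
      ∑ K : Finset (Fin n), c.orthantIntegral K (faceOp q (K.image c.u) f) := by
  choose l hl0 hlv hlu using exists_list_map_u (c := c)
  set J : (Fin n → ℕ) → Finset (Fin n) := fun α => Finset.univ.filter fun i => 0 < α i with hJ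
  have h1 : ∀ α : Fin n → ℕ, c.orthantIntegral (J α) (multiDeriv (∑ i, (α i - 1) • {c.v i}) f) =
      ∑ K : Finset (Fin n), c.orthantIntegral K
        (localOp (K.image c.u) ((l α).map c.u) ((J α).image c.u) f) := by
    intro α
    rw [← hlv, orthantIntegral_multiDeriv _ hf fun i hi => by simp [hJ, hl0 α i hi]]
  have h2 : ∀ K : Finset (Fin n), c.orthantIntegral K (faceOp q (K.image c.u) f) =
      ∑ α ∈ K.piAntidiag q, (∏ i ∈ K, toddCoeff (α i)) * c.orthantIntegral K
        (localOp (K.image c.u) ((l α).map c.u) ((J α).image c.u) f) := by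
    intro K
    have h0 := orthantIntegral_add_sum_smul (c := c) (s := (K.image c.u).piAntidiag q)
      (zero_mem (localOps n))
      (fun β : E n → ℕ => localOp_mem_localOps (K.image c.u) (predMultiset (K.image c.u) β).toList
        ((K.image c.u).filter fun u => 0 < β u))
      (fun β => ∏ u ∈ K.image c.u, toddCoeff (β u)) hf K
    rw [zero_add] at h0
    rw [faceOp, h0]
    have hz : c.orthantIntegral K ((0 : Module.End ℝ (smoothFun n)) f) = 0 := by
      simp [orthantIntegral]
    rw [hz, zero_add]
    have hext : ∀ (α : Fin n → ℕ) i, Function.extend c.u α 0 (c.u i) = α i := fun α i =>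
      c.u_injective.extend_apply α 0 i
    symm
    -- Multi-indices on `K` correspond to functions on vectors supported in the image of `K` under
    -- `u`, by extension by zero.
    refine Finset.sum_nbij' (fun α => Function.extend c.u α 0) (fun β => β ∘ c.u) ?_ ?_ ?_ ?_ ?_
    · intro α hα
      rw [Finset.mem_piAntidiag] at hα ⊢
      refine ⟨?_, fun x hx => ?_⟩
      · rw [Finset.sum_image c.u_injective.injOn]
        simp only [hext]
        exact hα.1
      · by_cases hxr : ∃ i, c.u i = x
        · obtain ⟨i, rfl⟩ := hxr
          rw [hext] at hx
          exact Finset.mem_image_of_mem _ (hα.2 i hx)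
        · rw [Function.extend_apply' _ _ _ hxr] at hx
          exact absurd rfl hx
    · intro β hβ
      rw [Finset.mem_piAntidiag] at hβ ⊢
      refine ⟨?_, fun i hi => ?_⟩
      · rw [← hβ.1, Finset.sum_image c.u_injective.injOn]
        rfl
      · obtain ⟨k, hk, hki⟩ := Finset.mem_image.1 (hβ.2 _ hi)
        exact c.u_injective hki ▸ hk
    · intro α _
      funext i
      exact hext α i
    · intro β hβ
      funext x
      by_cases hxr : ∃ i, c.u i = x
      · obtain ⟨i, rfl⟩ := hxr
        rw [hext]; rfl
      · rw [Function.extend_apply' _ _ _ hxr]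
        by_contra hx
        obtain ⟨k, -, hk⟩ := Finset.mem_image.1
          ((Finset.mem_piAntidiag.1 hβ).2 x (fun h => hx (by rw [h]; rfl)))
        exact hxr ⟨k, hk⟩
    · intro α hα
      have hsupp : ∀ i, 0 < α i → i ∈ K := fun i hi => (Finset.mem_piAntidiag.1 hα).2 i hi.ne'
      have e1 : ((K.image c.u).filter fun u => 0 < Function.extend c.u α 0 u) =
          (J α).image c.u := by
        ext x
        simp only [Finset.mem_filter, Finset.mem_image, hJ, Finset.mem_univ, true_and]
        constructor
        · rintro ⟨⟨i, hi, rfl⟩, h⟩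
          rw [hext] at h
          exact ⟨i, h, rfl⟩
        · rintro ⟨i, hi, rfl⟩
          exact ⟨⟨i, hsupp i hi, rfl⟩, by rwa [hext]⟩
      have e2 : (l α).map c.u = (predMultiset (K.image c.u) (Function.extend c.u α 0)).toList := by
        rw [hlu α K _ (hext α) hsupp, Finset.map_eq_image]
        rfl
      rw [e1, ← e2, Finset.prod_image c.u_injective.injOn]
      simp only [hext]
  simp only [h2]
  refine (Finset.sum_congr rfl fun α _ => ((congrArg _ (h1 α)).trans
    (Finset.mul_sum _ _ _))).trans ?_
  rw [Finset.sum_comm]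
  refine Finset.sum_congr rfl fun K _ => ?_
  symm
  refine Finset.sum_subset_zero_on_sdiff (fun α hα => ?_) (fun α hα => ?_) fun α hα => ?_
  · rw [Finset.mem_piAntidiag] at hα ⊢
    refine ⟨?_, by simp⟩
    rw [← hα.1]
    symm
    exact Finset.sum_subset (Finset.subset_univ K) fun i _ hi => by
      by_contra h; exact hi (hα.2 i h)
  · rw [Finset.mem_sdiff, Finset.mem_piAntidiag, Finset.mem_piAntidiag] at hα
    rw [localOp_eq_zero]
    · simp [orthantIntegral]
    · intro h
      have hJK : ∀ i, α i ≠ 0 → i ∈ K := by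
        intro i hi
        have : i ∈ J α := by simp [hJ, Nat.pos_of_ne_zero hi]
        obtain ⟨k, hk, hki⟩ := Finset.mem_image.1 (h (Finset.mem_image_of_mem c.u this))
        exact c.u_injective hki ▸ hk
      refine hα.2 ⟨?_, hJK⟩
      rw [← hα.1.1]
      exact Finset.sum_subset (Finset.subset_univ K) fun i _ hi => by
        by_contra h; exact hi (hJK i h)
  · congr 1
    refine Finset.prod_subset (Finset.subset_univ K) fun i _ hi => ?_
    have : α i = 0 := by
      by_contra h; exact hi ((Finset.mem_piAntidiag.1 hα).2 i h)
    rw [this, toddCoeff_zero]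

open Classical in
theorem asymptoticExpansion_wedge_faceOp (c : Corner n) {f : smoothFun n}
    (hf : HasCompactSupport (f : E n → ℝ)) :
    AsymptoticExpansion (riemannSum c.wedge f) fun q =>
      ∑ K : Finset (Fin n), c.orthantIntegral K (faceOp q (K.image c.u) f) :=
  (c.asymptoticExpansion_wedge hf).congr (fun _ _ => rfl) fun q => sum_orthantIntegral_eq hf q

end Corner

end

section

/-! ### The primitive inner normals of a cone -/

variable {n : ℕ}

/-- The integer covectors that are nonnegative on `C`. -/
def dualMonoid (C : Set (E n)) : AddSubmonoid (E n) where
  carrier := {w | w ∈ intLattice n ∧ ∀ z ∈ C, 0 ≤ inner ℝ w z}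
  zero_mem' := ⟨zero_mem _, fun z _ => by simp⟩
  add_mem' ha hb := ⟨add_mem ha.1 hb.1, fun z hz => by
    rw [inner_add_left]; exact add_nonneg (ha.2 z hz) (hb.2 z hz)⟩

/-- The irreducible integer covectors that are nonnegative on `C`. -/
def coneNormals (C : Set (E n)) : Set (E n) :=
  {w | w ∈ dualMonoid C ∧ w ≠ 0 ∧
    ∀ a ∈ dualMonoid C, ∀ b ∈ dualMonoid C, w = a + b → a = 0 ∨ b = 0}

lemma exists_int_inner {a b : E n} (ha : a ∈ intLattice n) (hb : b ∈ intLattice n) :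
    ∃ m : ℤ, inner ℝ a b = m := by
  choose k hk using (mem_intLattice_iff_coord a).1 ha
  choose l hl using (mem_intLattice_iff_coord b).1 hb
  refine ⟨∑ j, l j * k j, ?_⟩
  simp [PiLp.inner_apply, hk, hl]

namespace Corner

variable {c : Corner n} {J : Finset (Fin n)}

variable (c J) in
/-- The cone in which the coordinates with respect to `v i`, `i ∈ J`, are nonnegative. -/
def innerCone : Set (E n) := {z | ∀ i ∈ J, 0 ≤ inner ℝ (c.u i) z}

lemma u_mem_intLattice (i : Fin n) : c.u i ∈ intLattice n := by
  rw [mem_intLattice_iff_coord]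
  intro j
  have he : EuclideanSpace.single j (1 : ℝ) ∈ intLattice n := by
    rw [mem_intLattice_iff_coord]
    intro k
    by_cases h : k = j
    · exact ⟨1, by simp [h]⟩
    · exact ⟨0, by simp [h]⟩
  obtain ⟨m, hm⟩ := (mem_intLattice_iff (c := c) _).1 he i
  refine ⟨m, ?_⟩
  rw [← hm, ← inner_u]
  simp [EuclideanSpace.inner_single_right]

lemma u_mem_dualMonoid {i : Fin n} (hi : i ∈ J) : c.u i ∈ dualMonoid (c.innerCone J) :=
  ⟨u_mem_intLattice i, fun _ hz => hz i hi⟩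

lemma exists_nat_inner_v {w : E n} (hw : w ∈ dualMonoid (c.innerCone J)) (i : Fin n) :
    ∃ m : ℕ, inner ℝ (c.v i) w = m := by
  have hv : c.v i ∈ c.innerCone J := fun j _ => by rw [inner_u_v]; split_ifs <;> norm_num
  obtain ⟨m, hm⟩ := exists_int_inner hw.1 (v_mem_intLattice (c := c) i)
  have h0 := hw.2 _ hv
  rw [hm] at h0
  lift m to ℕ using by exact_mod_cast h0
  exact ⟨m, by rw [real_inner_comm, hm]; simp⟩

lemma inner_v_eq_zero {w : E n} (hw : w ∈ dualMonoid (c.innerCone J)) {i : Fin n} (hi : i ∉ J) :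
    inner ℝ (c.v i) w = 0 := by
  have hv : -c.v i ∈ c.innerCone J := fun j hj => by
    rw [inner_neg_right, inner_u_v, if_neg (by rintro rfl; exact hi hj), neg_zero]
  obtain ⟨m, hm⟩ := exists_nat_inner_v hw i
  have h0 := hw.2 _ hv
  rw [inner_neg_right, real_inner_comm, hm] at h0
  rw [hm]
  exact le_antisymm (by linarith) (Nat.cast_nonneg m)

/-- An integer covector is nonnegative on the cone exactly when it is a combination of the `u i`, `i
∈ J`, with coefficients in `ℕ`. The monoid is thus free on these `u i`, and its irreducible elements
are the free generators. -/
theorem coneNormals_innerCone (c : Corner n) (J : Finset (Fin n)) :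
    coneNormals (c.innerCone J) = c.u '' J := by
  have hzero : ∀ w : E n, (∀ i, inner ℝ (c.v i) w = 0) → w = 0 := fun w hw => by
    rw [← sum_inner_v_smul_u (c := c) w]
    exact Finset.sum_eq_zero fun i _ => by rw [hw, zero_smul]
  have hvu : ∀ k i : Fin n, inner ℝ (c.v k) (c.u i) = if i = k then (1 : ℝ) else 0 := fun k i => by
    rw [real_inner_comm, inner_u_v]
  ext w
  constructor
  · rintro ⟨hw, hw0, hirr⟩
    obtain ⟨i, hi⟩ : ∃ i, inner ℝ (c.v i) w ≠ 0 := by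
      by_contra! h
      exact hw0 (hzero w h)
    have hiJ : i ∈ J := by
      by_contra h
      exact hi (inner_v_eq_zero hw h)
    -- The `i`-th coefficient of `w` is a positive integer, so `u i` can be subtracted without
    -- leaving the monoid; irreducibility then forces `w = u i`.
    have hmem : w - c.u i ∈ dualMonoid (c.innerCone J) := by
      refine ⟨sub_mem hw.1 (u_mem_intLattice i), fun z hz => ?_⟩
      rw [← sum_inner_v_smul_u (c := c) (w - c.u i), sum_inner]
      refine Finset.sum_nonneg fun k _ => ?_
      rw [real_inner_smul_left]
      obtain ⟨m, hm⟩ := exists_nat_inner_v hw k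
      by_cases hk : k ∈ J
      · refine mul_nonneg ?_ (hz k hk)
        rw [inner_sub_right, hvu, hm, sub_nonneg]
        split_ifs with h
        · subst h
          rw [hm] at hi
          exact_mod_cast Nat.one_le_iff_ne_zero.2 (by exact_mod_cast hi)
        · exact Nat.cast_nonneg m
      · rw [inner_sub_right, hvu, if_neg (by rintro rfl; exact hk hiJ), inner_v_eq_zero hw hk]
        simp
    rcases hirr _ (u_mem_dualMonoid hiJ) _ hmem (by abel) with h | h
    · have := hvu i i
      rw [h] at this
      simp at this
    · exact ⟨i, hiJ, (sub_eq_zero.1 h).symm⟩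
  · rintro ⟨i, hi, rfl⟩
    refine ⟨u_mem_dualMonoid hi, fun h => ?_, fun a ha b hb hab => ?_⟩
    · have := hvu i i
      rw [h] at this
      simp at this
    · choose k hk using exists_nat_inner_v ha
      choose l hl using exists_nat_inner_v hb
      have hkl : ∀ j, k j + l j = if i = j then 1 else 0 := fun j => by
        have := hvu j i
        rw [hab, inner_add_right, hk, hl] at this
        split_ifs at this ⊢ <;> exact_mod_cast this
      have hj : ∀ j, j ≠ i → k j = 0 ∧ l j = 0 := fun j hji => by
        have := hkl j
        rw [if_neg (Ne.symm hji)] at this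
        omega
      have hii := hkl i
      rw [if_pos rfl] at hii
      rcases Nat.eq_zero_or_pos (k i) with h | h
      · refine Or.inl (hzero a fun j => ?_)
        rw [hk, Nat.cast_eq_zero]
        by_cases hji : j = i
        · rw [hji, h]
        · exact (hj j hji).1
      · refine Or.inr (hzero b fun j => ?_)
        rw [hl, Nat.cast_eq_zero]
        by_cases hji : j = i
        · rw [hji]; omega
        · exact (hj j hji).2

end Corner

open Classical in
/-- The operator of order `q` attached to a face with cone `C`. -/
def coneOp (q : ℕ) (C : Set (E n)) : (E n → ℝ) → E n → ℝ :=
  extendOp (faceOp q (if h : (coneNormals C).Finite then h.toFinset else ∅))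

open Classical in
lemma coneOp_innerCone (c : Corner n) (J : Finset (Fin n)) (q : ℕ) :
    coneOp q (c.innerCone J) = extendOp (faceOp q (J.image c.u)) := by
  have h : coneNormals (c.innerCone J) = ((J.image c.u : Finset (E n)) : Set (E n)) := by
    rw [c.coneNormals_innerCone, Finset.coe_image]
  rw [coneOp, dif_pos (by rw [h]; exact Finset.finite_toSet _)]
  congr 2
  apply Finset.coe_injective
  rw [Set.Finite.coe_toFinset, h]

end

section

/-! ### The faces of a polytope near a vertex -/

variable {n : ℕ}

lemma eventually_add_smul_mem {U : Set (E n)} (hU : IsOpen U) {x : E n} (hx : x ∈ U) (w : E n) :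
    ∀ᶠ t : ℝ in nhdsWithin 0 (Ioi 0), x + t • w ∈ U := by
  have h : Continuous fun t : ℝ => x + t • w := by fun_prop
  refine (h.tendsto' 0 x (by simp)).mono_left nhdsWithin_le_nhds (hU.mem_nhds hx)

lemma exists_add_smul_mem {U : Set (E n)} (hU : IsOpen U) {x : E n} (hx : x ∈ U) (w : E n) :
    ∃ t : ℝ, 0 < t ∧ x + t • w ∈ U := by
  obtain ⟨t, h1, h2⟩ := ((eventually_add_smul_mem hU hx w).and self_mem_nhdsWithin).exists
  exact ⟨t, h2, h1⟩

namespace Corner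

/-- The polytope `Δ` coincides on the open neighbourhood `U` of `c.p` with the wedge of the corner,
and is contained in it. -/
structure IsLocalModel (c : Corner n) (Δ U : Set (E n)) : Prop where
  isOpen : IsOpen U
  p_mem : c.p ∈ U
  subset_wedge : Δ ⊆ c.wedge
  inter_subset : c.wedge ∩ U ⊆ Δ

variable {c : Corner n} {Δ U F : Set (E n)} {J : Finset (Fin n)}

lemma coord_eq_inner (i : Fin n) (x : E n) : c.coord i x = inner ℝ (c.u i) (c.p - x) := by
  rw [inner_u, coord]

lemma p_mem_face (J : Finset (Fin n)) : c.p ∈ c.face J :=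
  ⟨fun i => (c.coord_p i).ge, fun i _ => c.coord_p i⟩

lemma coord_add_smul (i : Fin n) (x w : E n) (t : ℝ) :
    c.coord i (x + t • w) = c.coord i x - t * inner ℝ (c.u i) w := by
  rw [coord_eq_inner, coord_eq_inner, ← sub_sub, inner_sub_right, inner_smul_right]

namespace IsLocalModel

variable (h : c.IsLocalModel Δ U)
include h

lemma p_mem_polytope : c.p ∈ Δ := h.inter_subset ⟨fun i => (c.coord_p i).ge, h.p_mem⟩

/-- The segment from `c.p` to a point `x` of `F` in `U` can be prolonged beyond `x` inside `Δ`. A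
linear form maximal at `x` is therefore no smaller at `c.p`. -/
lemma p_mem_of_isFace (hF : IsFace Δ F) (hFU : (F ∩ U).Nonempty) : c.p ∈ F := by
  obtain ⟨x, hxF, hxU⟩ := hFU
  obtain ⟨l, hl⟩ := hF.2 hF.1
  have hx := hxF
  rw [hl] at hx
  obtain ⟨t, ht, htU⟩ := exists_add_smul_mem h.isOpen hxU (x - c.p)
  have hy : x + t • (x - c.p) ∈ Δ := by
    refine h.inter_subset ⟨fun i => ?_, htU⟩
    rw [coord_add_smul, ← neg_sub c.p x, inner_neg_right, ← coord_eq_inner]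
    have := h.subset_wedge hx.1 i
    nlinarith
  rw [hl]
  refine ⟨h.p_mem_polytope, fun y hy' => (hx.2 y hy').trans ?_⟩
  have h1 := hx.2 _ hy
  rw [map_add, map_smul, map_sub, smul_eq_mul] at h1
  nlinarith

lemma exists_p_add_smul_mem {w : E n} (hw : ∀ i, inner ℝ (c.u i) w ≤ 0) :
    ∃ t : ℝ, 0 < t ∧ c.p + t • w ∈ Δ := by
  obtain ⟨t, ht, htU⟩ := exists_add_smul_mem h.isOpen h.p_mem w
  refine ⟨t, ht, h.inter_subset ⟨fun i => ?_, htU⟩⟩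
  rw [coord_add_smul, coord_p]
  nlinarith [hw i]

lemma exists_p_sub_smul_v_mem (j : Fin n) : ∃ t : ℝ, 0 < t ∧ c.p - t • c.v j ∈ Δ := by
  obtain ⟨t, ht, h⟩ := h.exists_p_add_smul_mem (w := -c.v j) fun i => by
    rw [inner_neg_right, inner_u_v]
    split_ifs <;> norm_num
  exact ⟨t, ht, by simpa [sub_eq_add_neg] using h⟩

/-- The exposing form is the pairing with `∑ i ∈ J, c.u i`, which equals its value at `c.p` minus a
sum of nonnegative coordinates. -/
lemma isFace_inter_face (J : Finset (Fin n)) : IsFace Δ (Δ ∩ c.face J) := by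
  refine ⟨⟨c.p, h.p_mem_polytope, p_mem_face J⟩, fun _ => ⟨innerSL ℝ (∑ i ∈ J, c.u i), ?_⟩⟩
  have key : ∀ x, (innerSL ℝ (∑ i ∈ J, c.u i)) x =
      (innerSL ℝ (∑ i ∈ J, c.u i)) c.p - ∑ i ∈ J, c.coord i x := by
    intro x
    simp only [coord_eq_inner, innerSL_apply_apply, sum_inner, inner_sub_right,
      Finset.sum_sub_distrib]
    ring
  ext x
  constructor
  · rintro ⟨hx, hxJ⟩
    refine ⟨hx, fun y hy => ?_⟩
    rw [key x, key y, Finset.sum_eq_zero hxJ.2]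
    have := Finset.sum_nonneg fun i (_ : i ∈ J) => h.subset_wedge hy i
    linarith
  · rintro ⟨hx, hxm⟩
    refine ⟨hx, h.subset_wedge hx, ?_⟩
    have := hxm _ h.p_mem_polytope
    rw [key x] at this
    have h0 := Finset.sum_nonneg fun i (_ : i ∈ J) => h.subset_wedge hx i
    exact (Finset.sum_eq_zero_iff_of_nonneg fun i _ => h.subset_wedge hx i).1
      (le_antisymm (by linarith) h0)

lemma exists_eq_inter_face (hF : IsFace Δ F) (hp : c.p ∈ F) : ∃ J, F = Δ ∩ c.face J := by
  classical
  obtain ⟨l, hl⟩ := hF.2 hF.1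
  have hpl := hp
  rw [hl] at hpl
  have hv : ∀ i, 0 ≤ l (c.v i) := fun i => by
    obtain ⟨t, ht, htΔ⟩ := h.exists_p_sub_smul_v_mem i
    have := hpl.2 _ htΔ
    rw [map_sub, map_smul, smul_eq_mul] at this
    nlinarith
  have key : ∀ x, l x = l c.p - ∑ i, c.coord i x * l (c.v i) := fun x => by
    conv_lhs => rw [← c.chart_coord x]
    simp [chart]
  have hnn : ∀ x ∈ Δ, ∀ i ∈ Finset.univ, 0 ≤ c.coord i x * l (c.v i) := fun x hx i _ =>
    mul_nonneg (h.subset_wedge hx i) (hv i)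
  -- The exposing form decreases along each coordinate with `l (c.v i) > 0`, so exactly these
  -- coordinates must vanish on the face.
  refine ⟨Finset.univ.filter fun i => l (c.v i) ≠ 0, ?_⟩
  ext x
  constructor
  · intro hx
    rw [hl] at hx
    refine ⟨hx.1, h.subset_wedge hx.1, fun i hi => ?_⟩
    have h1 := hx.2 _ hpl.1
    rw [key x] at h1
    have h2 := (Finset.sum_eq_zero_iff_of_nonneg (hnn x hx.1)).1
      (le_antisymm (by linarith) (Finset.sum_nonneg (hnn x hx.1))) i (Finset.mem_univ i)
    exact (mul_eq_zero.1 h2).resolve_right (by simpa using hi)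
  · rintro ⟨hx, hxJ⟩
    rw [hl]
    refine ⟨hx, fun y hy => (hpl.2 y hy).trans ?_⟩
    rw [key x, Finset.sum_eq_zero, sub_zero]
    intro i _
    by_cases hi : l (c.v i) = 0
    · rw [hi, mul_zero]
    · rw [hxJ.2 i (by simpa using hi), zero_mul]

lemma vectorSpan_inter_face (J : Finset (Fin n)) :
    vectorSpan ℝ (Δ ∩ c.face J) = c.dirSpace J := by
  refine c.vectorSpan_eq_dirSpace inter_subset_right ⟨h.p_mem_polytope, p_mem_face J⟩ fun j hj => ?_
  obtain ⟨t, ht, htΔ⟩ := h.exists_p_sub_smul_v_mem j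
  refine ⟨t, ht, htΔ, h.subset_wedge htΔ, fun i hi => ?_⟩
  rw [coord_p_sub, map_smul, Basis.repr_self, Finsupp.smul_single, Finsupp.single_apply, if_neg]
  rintro rfl
  exact hj hi

lemma codim_inter_face (J : Finset (Fin n)) : codim (Δ ∩ c.face J) = J.card := by
  rw [codim, h.vectorSpan_inter_face, finrank_dirSpace]
  have := J.card_le_univ
  rw [Fintype.card_fin] at this
  omega

lemma inter_face_injective : Function.Injective fun J : Finset (Fin n) => Δ ∩ c.face J := by
  intro J K hJK
  have h1 : c.dirSpace J = c.dirSpace K := by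
    rw [← h.vectorSpan_inter_face, ← h.vectorSpan_inter_face]
    exact congrArg _ hJK
  ext j
  have h2 : ∀ L : Finset (Fin n), c.v j ∈ c.dirSpace L ↔ j ∉ L := fun L => by
    rw [mem_dirSpace_iff]
    constructor
    · intro hj hjL
      simpa using hj j hjL
    · intro hj i hi
      rw [Basis.repr_self, Finsupp.single_apply, if_neg]
      rintro rfl
      exact hj hi
  rw [← not_iff_not, ← h2, ← h2, h1]

lemma faceCone_inter_face (J : Finset (Fin n)) : faceCone Δ (Δ ∩ c.face J) = c.innerCone J := by
  ext z
  constructor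
  · rintro ⟨t, ht, x, hx, y, hy, rfl⟩ i hi
    have h1 := hx.2.2 i hi
    have h2 := h.subset_wedge hy i
    rw [coord_eq_inner, inner_sub_right] at h1 h2
    rw [inner_smul_right, inner_sub_right]
    exact mul_nonneg ht (by linarith)
  · intro hz
    -- Moving along `w` gives a point `x` near the apex on the face, with all coordinates outside
    -- `J` positive. From there `x - t • z` stays in `Δ` for small `t > 0`.
    set w : E n := -∑ i ∈ Jᶜ, c.v i with hw
    have hwu : ∀ i, inner ℝ (c.u i) w = if i ∈ J then 0 else -1 := fun i => by
      rw [hw, inner_neg_right, inner_sum]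
      simp only [inner_u_v]
      by_cases hi : i ∈ J <;> simp [hi]
    obtain ⟨s, hs, hsU⟩ := exists_add_smul_mem h.isOpen h.p_mem w
    set x : E n := c.p + s • w with hx
    have hxc : ∀ i, c.coord i x = if i ∈ J then 0 else s := fun i => by
      rw [hx, coord_add_smul, coord_p, hwu]
      split_ifs <;> simp
    have hev : ∀ i ∉ J, ∀ᶠ t : ℝ in nhdsWithin 0 (Ioi 0), 0 ≤ c.coord i (x + t • -z) := by
      intro i hi
      have ho : IsOpen {y | 0 < c.coord i y} := isOpen_lt continuous_const (c.continuous_coord i)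
      filter_upwards [eventually_add_smul_mem ho (x := x) (by
        rw [mem_ofPred_eq, hxc, if_neg hi]; exact hs) (-z)] with t ht using le_of_lt ht
    have hev' : ∀ᶠ t : ℝ in nhdsWithin 0 (Ioi 0), ∀ i, i ∉ J → 0 ≤ c.coord i (x + t • -z) :=
      eventually_all.2 fun i => by
        by_cases hi : i ∈ J
        · exact Eventually.of_forall fun t h => absurd hi h
        · filter_upwards [hev i hi] with t ht using fun _ => ht
    obtain ⟨t, ⟨ht1, ht2⟩, ht0⟩ :=
      ((hev'.and (eventually_add_smul_mem h.isOpen hsU (-z))).and self_mem_nhdsWithin).exists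
    have ht : 0 < t := ht0
    have hxw : x ∈ c.wedge := fun i => by
      rw [hxc]
      split_ifs
      · exact le_rfl
      · exact hs.le
    refine ⟨t⁻¹, (inv_pos.2 ht).le, x, ⟨h.inter_subset ⟨hxw, hsU⟩, hxw, fun i hi => by
      rw [hxc, if_pos hi]⟩, x + t • -z, h.inter_subset ⟨fun i => ?_, ht2⟩, ?_⟩
    · by_cases hi : i ∈ J
      · rw [coord_add_smul, hxc, if_pos hi, inner_neg_right]
        have := mul_nonneg ht.le (hz i hi)
        linarith
      · exact ht1 i hi
    · rw [smul_neg, ← sub_eq_add_neg, sub_sub_cancel, smul_smul, inv_mul_cancel₀ ht.ne', one_smul]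

lemma riemannSum_eq {f : E n → ℝ} (hf : Function.support f ⊆ U) {N : ℕ} (hN : 0 < N) :
    riemannSum Δ f N = riemannSum c.wedge f N := by
  rw [riemannSum, riemannSum]
  congr 1
  refine finsum_mem_inter_support_eq' _ _ _ fun k hk => and_congr_right fun _ => ?_
  have hN0 : (N : ℝ) ≠ 0 := by exact_mod_cast hN.ne'
  rw [mem_smul_set_iff_inv_smul_mem₀ hN0, mem_smul_set_iff_inv_smul_mem₀ hN0]
  exact ⟨fun hx => h.subset_wedge hx, fun hx => h.inter_subset ⟨hx, hf hk⟩⟩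

end IsLocalModel

variable (c) in
lemma isClosed_face (J : Finset (Fin n)) : IsClosed (c.face J) := by
  have : c.face J = (⋂ i, {x | 0 ≤ c.coord i x}) ∩ ⋂ i ∈ J, {x | c.coord i x = 0} := by
    ext x; simp [face, wedge]
  rw [this]
  exact (isClosed_iInter fun i => isClosed_le continuous_const (c.continuous_coord i)).inter
    (isClosed_biInter fun i _ => isClosed_eq (c.continuous_coord i) continuous_const)

/-- The star normalization and the coordinate measure both divide Euclidean measure by the same
covolume, and on `U` the faces of `Δ` and of the wedge coincide. -/
lemma IsLocalModel.starIntegral_inter_face (h : c.IsLocalModel Δ U) (J : Finset (Fin n))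
    {g : E n → ℝ} (hg : Continuous g) (hgU : Function.support g ⊆ U) :
    starIntegral (Δ ∩ c.face J) g = c.orthantIntegral J g := by
  rw [c.starIntegral_eq (h.vectorSpan_inter_face J), c.orthantIntegral_eq_setIntegral J hg]
  congr 1
  refine (setIntegral_eq_of_subset_of_forall_sdiff_eq_zero (c.isClosed_face J).measurableSet
    inter_subset_right fun x hx => ?_).symm
  by_contra h0
  exact hx.2 ⟨h.inter_subset ⟨hx.1.1, hgU h0⟩, hx.1⟩

variable (c) in
lemma integrableOn_face (J : Finset (Fin n)) {g : E n → ℝ} (hg : Continuous g)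
    (hg' : HasCompactSupport g) : IntegrableOn g (c.face J)
      (Measure.euclideanHausdorffMeasure (finrank ℝ (c.dirSpace J))) := by
  have hG : Continuous fun s : {j // j ∉ J} → ℝ => c.chart (extendCoord J s) :=
    c.continuous_chart.comp (continuous_extendCoord J)
  have hemb : Topology.IsClosedEmbedding fun s : {j // j ∉ J} → ℝ => c.chart (extendCoord J s) := by
    refine c.chartHomeo.isClosedEmbedding.comp ?_
    have hl : Function.LeftInverse (fun (t : Fin n → ℝ) (j : {j // j ∉ J}) => t j)
        (extendCoord J) := fun s => funext fun j => by simp [extendCoord, j.2]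
    exact hl.isClosedEmbedding (by fun_prop) (continuous_extendCoord J)
  have h1 : Integrable (g ∘ fun s : {j // j ∉ J} → ℝ => c.chart (extendCoord J s))
      (volume.restrict (univ.pi fun _ => Ici (0 : ℝ))) :=
    ((hg.comp hG).integrable_of_hasCompactSupport (hg'.comp_isClosedEmbedding hemb)).restrict
  rw [← integrable_map_measure hg.aestronglyMeasurable hG.aemeasurable, map_faceChart,
    integrable_smul_measure _ ENNReal.ofReal_ne_top] at h1
  · exact h1
  · rw [Ne, ENNReal.ofReal_eq_zero, not_le, inv_pos]
    exact (covolume_span_basis _ (c.span_dirBasis J)).2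

lemma IsLocalModel.starIntegral_sum (h : c.IsLocalModel Δ U) (J : Finset (Fin n)) {ι : Type*}
    (s : Finset ι) {g : ι → E n → ℝ} (hg : ∀ i ∈ s, Continuous (g i))
    (hg' : ∀ i ∈ s, HasCompactSupport (g i)) :
    starIntegral (Δ ∩ c.face J) (fun x => ∑ i ∈ s, g i x) =
      ∑ i ∈ s, starIntegral (Δ ∩ c.face J) (g i) := by
  simp only [c.starIntegral_eq (h.vectorSpan_inter_face J)]
  rw [← Finset.mul_sum, integral_finsetSum]
  exact fun i hi => (c.integrableOn_face J (hg i hi) (hg' i hi)).mono_set inter_subset_right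

end Corner

end

section

/-! ### Local models of a Delzant polytope at its vertices -/

variable {n : ℕ}

section Polyhedron

variable {ι : Type*} {u : ι → E n} {b : ι → ℝ} {p : E n}

/-- The polyhedron given by the inequalities `⟨u i, x⟩ ≤ b i`. -/
def polyhedron (u : ι → E n) (b : ι → ℝ) : Set (E n) := {x | ∀ i, inner ℝ (u i) x ≤ b i}

lemma isClosed_polyhedron (u : ι → E n) (b : ι → ℝ) : IsClosed (polyhedron u b) := by
  rw [show polyhedron u b = ⋂ i, {x | inner ℝ (u i) x ≤ b i} by ext; simp [polyhedron]]
  exact isClosed_iInter fun i => isClosed_le (by fun_prop) continuous_const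

lemma convex_polyhedron (u : ι → E n) (b : ι → ℝ) : Convex ℝ (polyhedron u b) := by
  intro x hx y hy s t hs ht hst i
  rw [inner_add_right, inner_smul_right, inner_smul_right]
  calc s * inner ℝ (u i) x + t * inner ℝ (u i) y ≤ s * b i + t * b i :=
        add_le_add (mul_le_mul_of_nonneg_left (hx i) hs) (mul_le_mul_of_nonneg_left (hy i) ht)
    _ = b i := by rw [← add_mul, hst, one_mul]

lemma exists_add_smul_mem_polyhedron [Finite ι] {x w : E n} (hx : x ∈ polyhedron u b)
    (hw : ∀ i, inner ℝ (u i) x = b i → inner ℝ (u i) w ≤ 0) :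
    ∃ t : ℝ, 0 < t ∧ x + t • w ∈ polyhedron u b := by
  have hev : ∀ᶠ t : ℝ in nhdsWithin 0 (Ioi 0), ∀ i, inner ℝ (u i) (x + t • w) ≤ b i := by
    refine eventually_all.2 fun i => ?_
    rcases (hx i).eq_or_lt with h | h
    · filter_upwards [self_mem_nhdsWithin] with t ht
      rw [inner_add_right, inner_smul_right, h]
      have := mul_nonpos_of_nonneg_of_nonpos (le_of_lt ht) (hw i h)
      linarith
    · have ho : IsOpen {y | inner ℝ (u i) y < b i} := isOpen_lt (by fun_prop) continuous_const
      filter_upwards [eventually_add_smul_mem ho h w] with t ht using le_of_lt ht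
  obtain ⟨t, h1, h2⟩ := (hev.and self_mem_nhdsWithin).exists
  exact ⟨t, h2, h1⟩

lemma isFace_tight [Finite ι] (hp : p ∈ polyhedron u b) {S : Set ι}
    (hS : ∀ i ∈ S, inner ℝ (u i) p = b i) :
    IsFace (polyhedron u b) {x ∈ polyhedron u b | ∀ i ∈ S, inner ℝ (u i) x = b i} := by
  classical
  have := Fintype.ofFinite ι
  refine ⟨⟨p, hp, hS⟩, fun _ => ⟨innerSL ℝ (∑ i ∈ S.toFinset, u i), ?_⟩⟩
  have key : ∀ x, (innerSL ℝ (∑ i ∈ S.toFinset, u i)) x =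
      ∑ i ∈ S.toFinset, b i - ∑ i ∈ S.toFinset, (b i - inner ℝ (u i) x) := fun x => by
    rw [innerSL_apply_apply, sum_inner, Finset.sum_sub_distrib]
    ring
  have hnn : ∀ x ∈ polyhedron u b, ∀ i ∈ S.toFinset, 0 ≤ b i - inner ℝ (u i) x :=
    fun x hx i _ => sub_nonneg.2 (hx i)
  have hz : ∀ x, (∀ i ∈ S, inner ℝ (u i) x = b i) →
      ∑ i ∈ S.toFinset, (b i - inner ℝ (u i) x) = 0 := fun x hx =>
    Finset.sum_eq_zero fun i hi => by rw [hx i (Set.mem_toFinset.1 hi), sub_self]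
  ext x
  constructor
  · rintro ⟨hx, hxS⟩
    refine ⟨hx, fun y hy => ?_⟩
    rw [key x, key y, hz x hxS]
    have := Finset.sum_nonneg (hnn y hy)
    linarith
  · rintro ⟨hx, hxm⟩
    refine ⟨hx, fun i hi => ?_⟩
    have h1 := hxm p hp
    rw [key x, key p, hz p hS] at h1
    have h2 := (Finset.sum_eq_zero_iff_of_nonneg (hnn x hx)).1
      (le_antisymm (by linarith) (Finset.sum_nonneg (hnn x hx))) i (Set.mem_toFinset.2 hi)
    linarith

/-- If all constraints tight at `p` are constant along `w`, then `p` can be moved both ways along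
`w` inside the polyhedron. -/
lemma eq_zero_of_mem_extremePoints [Finite ι] (hp : p ∈ (polyhedron u b).extremePoints ℝ) {w : E n}
    (hw : ∀ i, inner ℝ (u i) p = b i → inner ℝ (u i) w = 0) : w = 0 := by
  obtain ⟨s, hs, hsP⟩ := exists_add_smul_mem_polyhedron hp.1 fun i hi => (hw i hi).le
  obtain ⟨t, ht, htP⟩ := exists_add_smul_mem_polyhedron (w := -w) hp.1 fun i hi => by
    rw [inner_neg_right, hw i hi, neg_zero]
  have hst : s + t ≠ 0 := (add_pos hs ht).ne'
  have := (mem_extremePoints.1 hp).2 _ hsP _ htP ⟨t / (s + t), s / (s + t), by positivity,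
    by positivity, by field_simp; ring, by
      rw [smul_add, smul_add, add_add_add_comm, ← add_smul, smul_neg, smul_smul, smul_neg,
        smul_smul, ← add_div, add_comm t s, div_self hst, one_smul, div_mul_comm,
        add_neg_cancel, add_zero]⟩
  have h1 := this.1
  rw [add_eq_left, smul_eq_zero] at h1
  exact h1.resolve_left hs.ne'

lemma finite_extremePoints_polyhedron [Finite ι] (u : ι → E n) (b : ι → ℝ) :
    ((polyhedron u b).extremePoints ℝ).Finite := by
  refine Set.Finite.of_finite_image (f := fun p => {i | inner ℝ (u i) p = b i}) (Set.toFinite _) ?_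
  intro p hp q _ hpq
  have : q - p = 0 := eq_zero_of_mem_extremePoints hp fun i hi => by
    have h : i ∈ {i | inner ℝ (u i) q = b i} := (Set.ext_iff.1 hpq i).1 hi
    rw [inner_sub_right, hi, show inner ℝ (u i) q = b i from h, sub_self]
  exact (sub_eq_zero.1 this).symm

/-- Take an extreme point of the compact face cut out by the constraints tight at `x`. -/
lemma exists_extremePoint_tight [Finite ι] (hb : Bornology.IsBounded (polyhedron u b)) {x : E n}
    (hx : x ∈ polyhedron u b) : ∃ p ∈ (polyhedron u b).extremePoints ℝ,
      ∀ i, inner ℝ (u i) x = b i → inner ℝ (u i) p = b i := by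
  have hcomp : IsCompact (polyhedron u b) :=
    Metric.isCompact_of_isClosed_isBounded (isClosed_polyhedron u b) hb
  obtain ⟨hne, hF⟩ := isFace_tight (S := {i | inner ℝ (u i) x = b i}) hx fun i hi => hi
  obtain ⟨p, hp⟩ := (hF.isCompact hcomp).extremePoints_nonempty hne
  exact ⟨p, hF.isExtreme.extremePoints_subset_extremePoints hp, hp.1.2⟩

/-- At a vertex whose edges lie on the rays in the directions of a basis, the tangent cone is
generated by this basis. -/
lemma tangentCone_iff [Finite ι] (hp : p ∈ (polyhedron u b).extremePoints ℝ)
    (a : Basis (Fin n) ℝ (E n)) (e : Fin n ≃ {G : Set (E n) // IsEdgeAt (polyhedron u b) p G})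
    (he : ∀ k, (e k : Set (E n)) ⊆ {x | ∃ t : ℝ, 0 ≤ t ∧ x = p + t • a k}) (z : E n) :
    (∀ i, inner ℝ (u i) p = b i → inner ℝ (u i) z ≤ 0) ↔ ∀ k, 0 ≤ a.repr z k := by
  classical
  have := Fintype.ofFinite ι
  constructor
  · set A := {i // inner ℝ (u i) p = b i}
    -- `T` below is the cone given by the constraints tight at `p`. The form `l` is negative on it
    -- away from `0`, so the slice `S` at height `-1` is compact and generates it; it suffices to
    -- locate the extreme points of `S`.
    set l : E n := ∑ i : A, u i with hl
    have hlz : ∀ z, inner ℝ l z = ∑ i : A, inner ℝ (u i) z := fun z => by rw [hl, sum_inner]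
    set T : Set (E n) := polyhedron (fun i : A => u i) 0 with hT
    have hl0 : ∀ z ∈ T, inner ℝ l z = 0 → z = 0 := by
      intro z hz h0
      rw [hlz, Finset.sum_eq_zero_iff_of_nonpos fun i _ => hz i] at h0
      exact eq_zero_of_mem_extremePoints hp fun i hi => h0 ⟨i, hi⟩ (Finset.mem_univ _)
    have hlneg : ∀ z ∈ T, inner ℝ l z ≤ 0 := fun z hz => by
      rw [hlz]; exact Finset.sum_nonpos fun i _ => hz i
    have hTsmul : ∀ z ∈ T, ∀ t : ℝ, 0 ≤ t → t • z ∈ T := fun z hz t ht i => by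
      rw [inner_smul_right]; exact mul_nonpos_of_nonneg_of_nonpos ht (hz i)
    set S : Set (E n) := T ∩ {z | inner ℝ l z = -1} with hS
    have hclosed : IsClosed S := (isClosed_polyhedron _ _).inter
      (isClosed_eq (by fun_prop) continuous_const)
    have hconv : Convex ℝ S := (convex_polyhedron _ _).inter fun x hx y hy s t _ _ hst => by
      simp only [mem_ofPred_eq] at hx hy ⊢
      rw [inner_add_right, inner_smul_right, inner_smul_right, hx, hy]
      linarith
    have hbdd : Bornology.IsBounded S := by
      -- On `S` the tight forms are nonpositive with sum `-1`, so each lies in `[-1, 0]`; jointly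
      -- they are injective, which bounds `S`.
      let Φ : E n →ₗ[ℝ] A → ℝ := LinearMap.pi fun i => innerₗ (E n) (u i)
      have hker : LinearMap.ker Φ = ⊥ := by
        refine LinearMap.ker_eq_bot'.2 fun w hw => eq_zero_of_mem_extremePoints hp fun i hi => ?_
        exact congrFun hw ⟨i, hi⟩
      obtain ⟨K, -, hK⟩ := Φ.exists_antilipschitzWith hker
      refine (hK.isBounded_preimage (Metric.isBounded_Icc (-1 : A → ℝ) 0)).subset ?_
      rintro w ⟨hw, hw1⟩
      refine ⟨fun i => ?_, fun i => hw i⟩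
      rw [mem_ofPred_eq, hlz] at hw1
      rw [Pi.neg_apply, Pi.one_apply, ← hw1, ← Finset.add_sum_erase _ _ (Finset.mem_univ i)]
      exact add_le_of_nonpos_right (Finset.sum_nonpos fun j _ => hw j)
    have hext : ∀ w ∈ S.extremePoints ℝ, ∀ k, 0 ≤ a.repr w k := by
      intro w hw
      have hwT : w ∈ T := hw.1.1
      have hw1 : inner ℝ l w = -1 := hw.1.2
      have hw0 : w ≠ 0 := by
        rintro rfl
        simp at hw1
      -- The face `G` where the constraints in `B` are tight turns out to be an edge in the
      -- direction `w`, so the Delzant hypothesis puts `w` on one of the rays.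
      set B : Set ι := {i | inner ℝ (u i) p = b i ∧ inner ℝ (u i) w = 0} with hB
      set G := {x ∈ polyhedron u b | ∀ i ∈ B, inner ℝ (u i) x = b i} with hG
      have hGface : IsFace (polyhedron u b) G := isFace_tight hp.1 fun i hi => hi.1
      have hpG : p ∈ G := ⟨hp.1, fun i hi => hi.1⟩
      obtain ⟨t, ht, htP⟩ := exists_add_smul_mem_polyhedron (w := w) hp.1 fun i hi => hwT ⟨i, hi⟩
      have htG : p + t • w ∈ G := ⟨htP, fun i hi => by
        rw [inner_add_right, inner_smul_right, hi.2, mul_zero, add_zero, hi.1]⟩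
      have hGw : ∀ x ∈ G, x - p ∈ span ℝ {w} := by
        intro x hx
        have hyT : x - p ∈ T := fun i => by
          rw [inner_sub_right, i.2]
          exact sub_nonpos.2 (hx.1 i)
        rcases (hlneg _ hyT).eq_or_lt with h0 | h0
        · rw [hl0 _ hyT h0]
          exact zero_mem _
        · set s : ℝ := -inner ℝ l (x - p) with hs
          have hs0 : 0 < s := by rw [hs]; linarith
          have hyS : s⁻¹ • (x - p) ∈ S := by
            refine ⟨hTsmul _ hyT _ (inv_pos.2 hs0).le, ?_⟩
            rw [mem_ofPred_eq, inner_smul_right, ← neg_neg (inner ℝ l (x - p)), ← hs, mul_neg,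
              inv_mul_cancel₀ hs0.ne']
          set y := s⁻¹ • (x - p) with hy
          -- All constraints of the cone tight at `w` are tight at `y` too, so the segment from `y`
          -- to `w` can be prolonged beyond `w` inside `S`; extremality of `w` gives `y = w`.
          obtain ⟨r, hr, hrT⟩ := exists_add_smul_mem_polyhedron (w := w - y) hwT fun i hi => by
            have h1 : inner ℝ (u i) y = 0 := by
              rw [hy, inner_smul_right, inner_sub_right, i.2, hx.2 i ⟨i.2, hi⟩, sub_self, mul_zero]
            rw [inner_sub_right, hi, h1, Pi.zero_apply, sub_zero]
          have hrS : w + r • (w - y) ∈ S := by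
            refine ⟨hrT, ?_⟩
            rw [mem_ofPred_eq, inner_add_right, inner_smul_right, inner_sub_right, hw1,
              show inner ℝ l y = -1 from hyS.2]
            ring
          have hr1 : 1 + r ≠ 0 := by positivity
          have := ((mem_extremePoints.1 hw).2 _ hrS _ hyS ⟨1 / (1 + r), r / (1 + r), by positivity,
            by positivity, by field_simp, by
              rw [smul_add, smul_smul, smul_sub, add_assoc, div_mul_eq_mul_div, one_mul,
                sub_add_cancel, ← add_smul, ← add_div, div_self hr1, one_smul]⟩).2
          refine mem_span_singleton.2 ⟨s, ?_⟩
          rw [← this, hy, smul_smul, mul_inv_cancel₀ hs0.ne', one_smul]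
      have hGspan : vectorSpan ℝ G = span ℝ {w} := by
        apply le_antisymm
        · rw [vectorSpan_def, span_le]
          rintro _ ⟨x, hx, y, hy, rfl⟩
          have := sub_mem (hGw x hx) (hGw y hy)
          simpa using this
        · rw [span_singleton_le_iff_mem]
          have := vsub_mem_vectorSpan ℝ htG hpG
          rw [vsub_eq_sub, add_sub_cancel_left] at this
          simpa [smul_smul, ht.ne'] using smul_mem _ t⁻¹ this
      obtain ⟨j, hj⟩ := e.surjective ⟨G, hGface, by rw [hGspan, finrank_span_singleton hw0], hpG⟩
      have hmem : p + t • w ∈ (e j : Set (E n)) := by rw [hj]; exact htG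
      obtain ⟨s, hs, hsj⟩ := he j hmem
      have hws : w = (t⁻¹ * s) • a j := by
        rw [mul_smul, ← add_left_cancel hsj, smul_smul, inv_mul_cancel₀ ht.ne', one_smul]
      intro k
      rw [hws, map_smul, Basis.repr_self, Finsupp.smul_apply, Finsupp.single_apply, smul_eq_mul]
      refine mul_nonneg (by positivity) ?_
      split_ifs <;> norm_num
    -- By Krein–Milman, `S` is the closed convex hull of its extreme points.
    have hSK : S ⊆ {z | ∀ k, 0 ≤ a.repr z k} := by
      rw [← closure_convexHull_extremePoints
        (Metric.isCompact_of_isClosed_isBounded hclosed hbdd) hconv]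
      refine closure_minimal (convexHull_min hext ?_) ?_
      · intro x hx y hy s t hs ht _ k
        rw [map_add, map_smul, map_smul]
        exact add_nonneg (mul_nonneg hs (hx k)) (mul_nonneg ht (hy k))
      · rw [show {z | ∀ k, 0 ≤ a.repr z k} = ⋂ k, {z | 0 ≤ a.coord k z} by ext; simp]
        exact isClosed_iInter fun k => isClosed_le continuous_const
          (LinearMap.continuous_of_finiteDimensional (a.coord k))
    intro hz k
    have hzT : z ∈ T := fun i => hz i i.2
    rcases (hlneg z hzT).eq_or_lt with h0 | h0
    · rw [hl0 z hzT h0]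
      simp
    · set s : ℝ := -inner ℝ l z with hs
      have hs0 : 0 < s := by rw [hs]; linarith
      have hzS : s⁻¹ • z ∈ S := by
        refine ⟨hTsmul _ hzT _ (inv_pos.2 hs0).le, ?_⟩
        rw [mem_ofPred_eq, inner_smul_right, ← neg_neg (inner ℝ l z), ← hs, mul_neg,
          inv_mul_cancel₀ hs0.ne']
      have := hSK hzS k
      rw [map_smul, Finsupp.smul_apply, smul_eq_mul] at this
      exact nonneg_of_mul_nonneg_right this (inv_pos.2 hs0)
  · intro hz i hi
    rw [← a.sum_repr z, inner_sum]
    refine Finset.sum_nonpos fun k _ => ?_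
    rw [inner_smul_right]
    refine mul_nonpos_of_nonneg_of_nonpos (hz k) ?_
    obtain ⟨hface, hrank, hpk⟩ := (e k).2
    obtain ⟨x, hx, hxp⟩ : ∃ x ∈ (e k : Set (E n)), x ≠ p := by
      by_contra! h
      have h1 : (e k : Set (E n)) = {p} := eq_singleton_iff_unique_mem.2 ⟨hpk, h⟩
      rw [h1, vectorSpan_singleton, finrank_bot] at hrank
      exact zero_ne_one hrank
    obtain ⟨t, ht, rfl⟩ := he k hx
    have ht0 : t ≠ 0 := by
      rintro rfl
      simp at hxp
    have hxP : p + t • a k ∈ polyhedron u b := hface.2.subset hx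
    have h1 := hxP i
    rw [inner_add_right, inner_smul_right, hi] at h1
    exact nonpos_of_mul_nonpos_right (by linarith) (lt_of_le_of_ne ht ht0.symm)

end Polyhedron

/-- A Delzant lattice polytope has finitely many local models at lattice corners, and their domains
cover it. -/
theorem IsDelzantLatticePolytope.exists_isLocalModel {Δ : Set (E n)}
    (hΔ : IsDelzantLatticePolytope Δ) :
    ∃ (ι : Type) (_ : Finite ι) (c : ι → Corner n) (U : ι → Set (E n)),
      (∀ i, (c i).IsLocalModel Δ (U i)) ∧ Δ ⊆ ⋃ i, U i := by
  obtain ⟨d, u, b, hub⟩ := hΔ.polyhedral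
  obtain rfl : Δ = polyhedron u b := hub
  -- The neighbourhood of a vertex consists of the points at which the constraints slack at the
  -- vertex remain slack. There only the tight constraints matter, and these define the tangent
  -- cone.
  have hmodel : ∀ p : (polyhedron u b).extremePoints ℝ, ∃ c : Corner n, c.IsLocalModel
      (polyhedron u b) {x | ∀ i, inner ℝ (u i) (p : E n) < b i → inner ℝ (u i) x < b i} := by
    rintro ⟨p, hp⟩
    obtain ⟨a, e, -, hspan, he⟩ := hΔ.delzant p hp
    have htop : ⊤ ≤ span ℝ (range a) := by
      rw [← (EuclideanSpace.basisFun (Fin n) ℝ).toBasis.span_eq, span_le]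
      rintro _ ⟨j, rfl⟩
      have hj : EuclideanSpace.basisFun (Fin n) ℝ j ∈ span ℤ (range a) := by
        rw [hspan]
        exact subset_span ⟨j, rfl⟩
      rw [OrthonormalBasis.coe_toBasis]
      exact span_subset_span ℤ ℝ (range a) hj
    let A : Basis (Fin n) ℝ (E n) := basisOfTopLeSpanOfCardEqFinrank a htop (by simp)
    have hA : ∀ k, A k = a k := fun k => by simp [A]
    have hcone := tangentCone_iff hp A e fun k => by rw [hA]; exact he k
    have hneg : range (A.map (LinearEquiv.neg ℝ)) = -range a := by
      ext x
      simp [hA, neg_eq_iff_eq_neg]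
    -- A corner spans its wedge by the vectors `- v i`, so the edge directions enter with the
    -- opposite sign.
    let c : Corner n := ⟨p, A.map (LinearEquiv.neg ℝ), hΔ.vertices hp, by
      rw [hneg, span_neg, hspan]⟩
    have hcoord : ∀ x i, c.coord i x = A.repr (x - p) i := fun x i => by
      simp [c, Corner.coord]
    refine ⟨c, ?_, fun i hi => hi, fun x hx i => ?_, ?_⟩
    · rw [show {x | ∀ i, inner ℝ (u i) p < b i → inner ℝ (u i) x < b i} =
        ⋂ i : {i // inner ℝ (u i) p < b i}, {x | inner ℝ (u i) x < b i} by ext; simp]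
      exact isOpen_iInter_of_finite fun i => isOpen_lt (by fun_prop) continuous_const
    · rw [hcoord]
      refine (hcone (x - p)).1 (fun j hj => ?_) i
      rw [inner_sub_right, hj]
      exact sub_nonpos.2 (hx j)
    · rintro x ⟨hx, hxU⟩ i
      rcases (hp.1 i).eq_or_lt with h | h
      · have := (hcone (x - p)).2 (fun k => by rw [← hcoord]; exact hx k) i h
        rw [inner_sub_right, h] at this
        linarith
      · exact (hxU i h).le
  choose c hc using hmodel
  refine ⟨_, (finite_extremePoints_polyhedron u b).to_subtype, c, _, hc, fun x hx => ?_⟩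
  obtain ⟨p, hp, hpx⟩ := exists_extremePoint_tight hΔ.bounded hx
  exact mem_iUnion.2 ⟨⟨p, hp⟩, fun i hi => (hx i).lt_of_ne fun h => hi.ne (hpx i h)⟩

end

section

/-! ### The expansion for a Delzant lattice polytope -/

variable {n : ℕ} {Δ U F : Set (E n)}

lemma exists_sum_eq_tsupport_subset {ι : Type*} [Fintype ι] {U : ι → Set (E n)}
    (hU : ∀ i, IsOpen (U i)) (hcov : ⋃ i, U i = univ) {f : smoothFun n}
    (hf : HasCompactSupport (f : E n → ℝ)) :
    ∃ g : ι → smoothFun n, ∑ i, g i = f ∧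
      ∀ i, HasCompactSupport (g i : E n → ℝ) ∧ tsupport (g i : E n → ℝ) ⊆ U i := by
  obtain ⟨ρ, hρ⟩ := SmoothPartitionOfUnity.exists_isSubordinate (modelWithCornersSelf ℝ (E n))
    (isClosed_univ (X := E n)) U hU hcov.ge
  refine ⟨fun i => ⟨fun x => ρ i x * (f : E n → ℝ) x,
    (ρ i).contMDiff.contDiff.mul (contDiff_coe f)⟩, ?_, fun i => ⟨hf.mul_left, ?_⟩⟩
  · ext x
    rw [AddSubmonoidClass.coe_finsetSum, Finset.sum_apply, ← Finset.sum_mul,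
      ← finsum_eq_sum_of_fintype, ρ.sum_eq_one (mem_univ x), one_mul]
  · exact (tsupport_mul_subset_left).trans (hρ i)

lemma riemannSum_sum (hΔ : Bornology.IsBounded Δ) {ι : Type*} (s : Finset ι) (g : ι → E n → ℝ)
    (N : ℕ) : riemannSum Δ (fun x => ∑ i ∈ s, g i x) N = ∑ i ∈ s, riemannSum Δ (g i) N := by
  have hfin : ((intLattice n : Set (E n)) ∩ (N : ℝ) • Δ).Finite := by
    have := ZSpan.setFinite_inter (EuclideanSpace.basisFun (Fin n) ℝ).toBasis (hΔ.smul₀ (N : ℝ))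
    rw [OrthonormalBasis.coe_toBasis] at this
    rwa [inter_comm]
  simp only [riemannSum, finsum_mem_eq_finite_toFinset_sum _ hfin]
  rw [← Finset.mul_sum, Finset.sum_comm]

lemma exists_coneOp_eq (q : ℕ) (C : Set (E n)) :
    ∃ P ∈ localOps n, ∀ f : smoothFun n, coneOp q C f = P f :=
  ⟨_, faceOp_mem_localOps _ _, fun f => extendOp_coe _ f⟩

lemma starIntegral_coneOp_eq_zero {q : ℕ} {C : Set (E n)} {f : smoothFun n}
    (hf : Disjoint F (tsupport (f : E n → ℝ))) : starIntegral F (coneOp q C f) = 0 := by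
  obtain ⟨P, hP, h⟩ := exists_coneOp_eq q C
  rw [starIntegral, faceIntegral, h, setIntegral_eq_zero_of_forall_eq_zero, mul_zero]
  intro x hx
  exact image_eq_zero_of_notMem_tsupport fun h' => hf.le_bot ⟨hx, hP f h'⟩

namespace Corner.IsLocalModel

variable {c : Corner n} (h : c.IsLocalModel Δ U)
include h

open Classical in
lemma starIntegral_coneOp (J : Finset (Fin n)) (q : ℕ) {f : smoothFun n}
    (hf : tsupport (f : E n → ℝ) ⊆ U) :
    starIntegral (Δ ∩ c.face J) (coneOp q (faceCone Δ (Δ ∩ c.face J)) f) =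
      c.orthantIntegral J (faceOp q (J.image c.u) f) := by
  rw [h.faceCone_inter_face, coneOp_innerCone, extendOp_coe]
  refine h.starIntegral_inter_face J (continuous_coe _) ?_
  exact (subset_tsupport _).trans ((faceOp_mem_localOps _ _ f).trans hf)

lemma isDiffOpAlong_coneOp (J : Finset (Fin n)) {q : ℕ} (hq : codim (Δ ∩ c.face J) ≤ q) :
    IsDiffOpAlong (vectorSpan ℝ (Δ ∩ c.face J))ᗮ (q - codim (Δ ∩ c.face J))
      (coneOp q (faceCone Δ (Δ ∩ c.face J))) := by
  classical
  have hcard : (J.image c.u).card = J.card := Finset.card_image_of_injective _ c.u_injective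
  rw [h.codim_inter_face] at hq ⊢
  rw [h.vectorSpan_inter_face, h.faceCone_inter_face, coneOp_innerCone, orthogonal_dirSpace,
    ← Finset.coe_image, ← hcard]
  exact isDiffOpAlong_extendOp (faceOp_mem_homogOp (hcard ▸ hq))

lemma setIntegral_wedge {g : E n → ℝ} (hgU : Function.support g ⊆ U) :
    ∫ x in c.wedge, g x = ∫ x in Δ, g x := by
  have hw : IsClosed c.wedge := by
    rw [show c.wedge = ⋂ i, {x | 0 ≤ c.coord i x} by ext; simp [wedge]]
    exact isClosed_iInter fun i => isClosed_le continuous_const (c.continuous_coord i)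
  refine setIntegral_eq_of_subset_of_forall_sdiff_eq_zero hw.measurableSet h.subset_wedge
    fun x hx => ?_
  by_contra h0
  exact hx.2 (h.inter_subset ⟨hx.1, hgU h0⟩)

open Classical in
lemma sum_orthantIntegral_zero {f : smoothFun n} (hf : tsupport (f : E n → ℝ) ⊆ U) :
    ∑ K : Finset (Fin n), c.orthantIntegral K (faceOp 0 (K.image c.u) f) =
      ∫ x in Δ, (f : E n → ℝ) x := by
  rw [Finset.sum_eq_single ∅]
  · rw [Finset.image_empty, faceOp_zero_empty, Module.End.one_apply,
      orthantIntegral_empty _ (continuous_coe f), h.setIntegral_wedge ((subset_tsupport _).trans hf)]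
  · intro K _ hK
    rw [faceOp_eq_zero]
    · simp [orthantIntegral]
    · rw [Finset.card_image_of_injective _ c.u_injective, Finset.card_pos]
      exact Finset.nonempty_iff_ne_empty.2 hK
  · exact fun h => absurd (Finset.mem_univ _) h

-- The faces of `Δ` that meet the support of `f` are exactly among the `Δ ∩ c.face K`, with `K`
-- unique; every other face contributes zero, as the operators do not enlarge supports. The sets `K`
-- that are empty or have more than `q` elements drop out because their operators vanish.
open Classical in
lemma sum_orthantIntegral_pos {f : smoothFun n} (hf : tsupport (f : E n → ℝ) ⊆ U) {q : ℕ}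
    (hq : q ≠ 0) (hfin : {F : Set (E n) | IsFace Δ F ∧ 1 ≤ codim F ∧ codim F ≤ q}.Finite) :
    ∑ K : Finset (Fin n), c.orthantIntegral K (faceOp q (K.image c.u) f) =
      ∑ F ∈ hfin.toFinset, starIntegral F (coneOp q (faceCone Δ F) f) := by
  have h1 : ∑ K : Finset (Fin n), c.orthantIntegral K (faceOp q (K.image c.u) f) =
      ∑ K with 1 ≤ K.card ∧ K.card ≤ q, c.orthantIntegral K (faceOp q (K.image c.u) f) := by
    rw [Finset.sum_filter_of_ne]
    intro K _ hK
    by_contra h0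
    refine hK ?_
    have : faceOp q (K.image c.u) = 0 := by
      rcases K.eq_empty_or_nonempty with rfl | hne
      · rw [Finset.image_empty, faceOp_empty hq]
      · refine faceOp_eq_zero ?_
        rw [Finset.card_image_of_injective _ c.u_injective]
        have := hne.card_pos
        omega
    rw [this]
    simp [orthantIntegral]
  rw [h1, Finset.sum_congr rfl fun K _ => (h.starIntegral_coneOp K q hf).symm,
    ← Finset.sum_image (f := fun F => starIntegral F (coneOp q (faceCone Δ F) f))
      (g := fun J => Δ ∩ c.face J) h.inter_face_injective.injOn]
  refine Finset.sum_subset ?_ fun F hF hF' => starIntegral_coneOp_eq_zero ?_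
  · intro F hF
    obtain ⟨K, hK, rfl⟩ := Finset.mem_image.1 hF
    rw [Set.Finite.mem_toFinset, mem_ofPred_eq, h.codim_inter_face]
    exact ⟨h.isFace_inter_face K, (Finset.mem_filter.1 hK).2⟩
  · rw [Set.Finite.mem_toFinset] at hF
    by_contra hd
    obtain ⟨x, hxF, hx⟩ := Set.not_disjoint_iff.1 hd
    obtain ⟨J, rfl⟩ := h.exists_eq_inter_face hF.1 (h.p_mem_of_isFace hF.1 ⟨x, hxF, hf hx⟩)
    refine hF' (Finset.mem_image_of_mem _ (Finset.mem_filter.2 ⟨Finset.mem_univ _, ?_⟩))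
    rw [← h.codim_inter_face]
    exact hF.2

end Corner.IsLocalModel

lemma exists_eq_inter_face_of_isFace {ι : Type*} {c : ι → Corner n} {U : ι → Set (E n)}
    (h : ∀ i, (c i).IsLocalModel Δ (U i)) (hU : Δ ⊆ ⋃ i, U i) (hF : IsFace Δ F) :
    ∃ i J, F = Δ ∩ (c i).face J := by
  obtain ⟨x, hx⟩ := hF.1
  obtain ⟨i, hi⟩ := mem_iUnion.1 (hU (hF.2.subset hx))
  exact ⟨i, (h i).exists_eq_inter_face hF ((h i).p_mem_of_isFace hF ⟨x, hx, hi⟩)⟩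

namespace IsDelzantLatticePolytope

theorem isDiffOpAlong_coneOp (hΔ : IsDelzantLatticePolytope Δ) {q : ℕ} (hF : IsFace Δ F)
    (hq : codim F ≤ q) :
    IsDiffOpAlong (vectorSpan ℝ F)ᗮ (q - codim F) (coneOp q (faceCone Δ F)) := by
  obtain ⟨ι, -, c, U, h, hU⟩ := hΔ.exists_isLocalModel
  obtain ⟨i, J, rfl⟩ := exists_eq_inter_face_of_isFace h hU hF
  exact (h i).isDiffOpAlong_coneOp J hq

theorem asymptoticExpansion_riemannSum (hΔ : IsDelzantLatticePolytope Δ) {f : E n → ℝ}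
    (hf : ContDiff ℝ ∞ f) (hf' : HasCompactSupport f) :
    AsymptoticExpansion (riemannSum Δ f) fun q =>
      if q = 0 then ∫ x in Δ, f x
      else ∑ᶠ F ∈ {F : Set (E n) | IsFace Δ F ∧ 1 ≤ codim F ∧ codim F ≤ q},
        starIntegral F (coneOp q (faceCone Δ F) f) := by
  classical
  lift f to smoothFun n using hf
  obtain ⟨ι, _, c, U, h, hU⟩ := hΔ.exists_isLocalModel
  have := Fintype.ofFinite ι
  have hclosed : IsClosed Δ := by
    obtain ⟨d, u, b, hub⟩ := hΔ.polyhedral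
    exact hub ▸ isClosed_polyhedron u b
  -- The index `none` carries the part of `f` supported off `Δ`, which affects neither the sums nor
  -- the integrals.
  obtain ⟨g, hgf, hg⟩ := exists_sum_eq_tsupport_subset (U := fun o : Option ι => o.elim Δᶜ U)
    (fun o => by
      cases o with
      | none => exact hclosed.isOpen_compl
      | some i => exact (h i).isOpen)
    (eq_univ_of_forall fun x => mem_iUnion.2 (by
      by_cases hx : x ∈ Δ
      · obtain ⟨i, hi⟩ := mem_iUnion.1 (hU hx)
        exact ⟨some i, hi⟩
      · exact ⟨none, hx⟩)) hf'
  have hfg : (f : E n → ℝ) = fun x => ∑ o, (g o : E n → ℝ) x := by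
    rw [← hgf, AddSubmonoidClass.coe_finsetSum]
    funext x
    rw [Finset.sum_apply]
  have hnone : ∀ x ∈ Δ, x ∉ tsupport (g none : E n → ℝ) := fun x hx hx' => (hg none).2 hx' hx
  refine (AsymptoticExpansion.sum Finset.univ fun i _ =>
    (c i).asymptoticExpansion_wedge_faceOp (hg (some i)).1).congr (fun N hN => ?_) fun q => ?_
  · rw [hfg, riemannSum_sum hΔ.bounded, Fintype.sum_option]
    have h0 : riemannSum Δ (g none : E n → ℝ) N = 0 := by
      rw [riemannSum, finsum_mem_eq_zero_of_forall_eq_zero, mul_zero]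
      rintro k ⟨-, hk⟩
      have hN0 : (N : ℝ) ≠ 0 := by exact_mod_cast hN.ne'
      rw [mem_smul_set_iff_inv_smul_mem₀ hN0] at hk
      exact image_eq_zero_of_notMem_tsupport (hnone _ hk)
    rw [h0, zero_add]
    exact Finset.sum_congr rfl fun i _ =>
      ((h i).riemannSum_eq ((subset_tsupport _).trans (hg (some i)).2) hN).symm
  · split_ifs with hq
    · subst hq
      rw [hfg, integral_finsetSum _ fun o _ =>
        ((continuous_coe (g o)).integrable_of_hasCompactSupport (hg o).1).integrableOn,
        Fintype.sum_option, setIntegral_eq_zero_of_forall_eq_zero fun x hx =>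
        image_eq_zero_of_notMem_tsupport (hnone x hx), zero_add]
      exact Finset.sum_congr rfl fun i _ => (h i).sum_orthantIntegral_zero (hg (some i)).2
    · have hfin : {F : Set (E n) | IsFace Δ F ∧ 1 ≤ codim F ∧ codim F ≤ q}.Finite := by
        refine (Set.finite_range fun a : ι × Finset (Fin n) => Δ ∩ (c a.1).face a.2).subset ?_
        rintro F ⟨hF, -⟩
        obtain ⟨i, J, rfl⟩ := exists_eq_inter_face_of_isFace h hU hF
        exact ⟨(i, J), rfl⟩
      rw [finsum_mem_eq_finite_toFinset_sum _ hfin, Finset.sum_congr rfl fun i _ =>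
        (h i).sum_orthantIntegral_pos (hg (some i)).2 hq hfin, Finset.sum_comm]
      refine Finset.sum_congr rfl fun F hF => ?_
      have hface : IsFace Δ F := (hfin.mem_toFinset.1 hF).1
      obtain ⟨i, J, hJ⟩ := exists_eq_inter_face_of_isFace h hU hface
      obtain ⟨P, hP, hPeq⟩ := exists_coneOp_eq q (faceCone Δ F)
      -- The operator depends on the cone of `F` alone, so the same one acts on all pieces of the
      -- partition and linearity reassembles `f`.
      have hsum : coneOp q (faceCone Δ F) f =
          fun x => ∑ o, coneOp q (faceCone Δ F) (g o : E n → ℝ) x := by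
        funext x
        simp only [hPeq]
        rw [← hgf, map_sum, AddSubmonoidClass.coe_finsetSum, Finset.sum_apply]
      have hadd := (h i).starIntegral_sum J Finset.univ
        (g := fun o => coneOp q (faceCone Δ F) (g o : E n → ℝ))
        (fun o _ => by rw [hPeq]; exact continuous_coe _)
        (fun o _ => by rw [hPeq]; exact hasCompactSupport_of_mem_localOps hP (hg o).1)
      rw [← hJ, ← hsum, Fintype.sum_option, starIntegral_coneOp_eq_zero (f := g none)
        (Set.disjoint_left.2 fun x hx => hnone x (hface.2.subset hx)), zero_add] at hadd
      exact hadd.symm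

end IsDelzantLatticePolytope

end

end EulerMaclaurin

end

open EulerMaclaurin

theorem theorem1 :
    (∀ (n : ℕ), 1 ≤ n → ∀ W : IntegerWedge n n, W.IsRegular →
      ∀ f : E n → ℝ, ContDiff ℝ ∞ f → HasCompactSupport f →
        AsymptoticExpansion (riemannSum W.carrier f) fun q =>
          ∑ α ∈ Finset.piAntidiag (Finset.univ : Finset (Fin n)) q,
            W.C α * faceIntegral (W.face α) (derivAlong W.dualVec (α - r α) f)) ∧
    (∀ (n : ℕ), n = 1 ∨ n = 2 ∨ n = 3 →
      ∃ R : ℕ → Set (E n) → (E n → ℝ) → E n → ℝ,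
        (∀ Δ : Set (E n), IsDelzantLatticePolytope Δ →
          ∀ q : ℕ, ∀ F : Set (E n), IsFace Δ F → 1 ≤ codim F → codim F ≤ q →
            IsDiffOpAlong (vectorSpan ℝ F)ᗮ (q - codim F) (R q (faceCone Δ F))) ∧
        ∀ Δ : Set (E n), IsDelzantLatticePolytope Δ →
          ∀ f : E n → ℝ, ContDiff ℝ ∞ f → HasCompactSupport f →
            AsymptoticExpansion (riemannSum Δ f) fun q =>
              if q = 0 then ∫ x in Δ, f x
              else ∑ᶠ F ∈ {F : Set (E n) | IsFace Δ F ∧ 1 ≤ codim F ∧ codim F ≤ q},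
                starIntegral F (R q (faceCone Δ F) f)) :=
  ⟨fun _ _ _ hW _ hf hf' => asymptoticExpansion_regularWedge hW hf hf',
    fun _ _ => ⟨coneOp, fun _ hΔ _ _ hF _ hq => hΔ.isDiffOpAlong_coneOp hF hq,
      fun _ hΔ _ hf hf' => hΔ.asymptoticExpansion_riemannSum hf hf'⟩⟩
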